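/- Let $k$ be an algebraically closed field and let $\mathcal{E}$ be a finite free EI category: a skeletal, connected category with finitely many objects and morphisms in which every endomorphism is an isomorphism and which has the following Unique Factorization Property. Call a morphism unfactorizable if it is not an automorphism and, whenever it is written as a composite of two morphisms, one of these is an automorphism. If a non-isomorphism has two decompositions $\alpha_n \cdots \alpha_1 = \beta_m \cdots \beta_1$ into unfactorizable morphisms, then $m = n$, both pass through the same objects $x_0, x_1, \dots, x_n$, and there are $h_i \in \operatorname{Aut}(x_i)$ for $0 \le i \le n$, with $h_0 = 1$ and $h_n = 1$, such that $h_i \alpha_i = \beta_i h_{i-1}$ for $1 \le i \le n$. Let $A = k\mathcal{E}$ be the category algebra (basis the morphisms; the product $\beta\cdot\alpha$ is the composite $\beta\alpha$ if it exists and $0$ otherwise), graded by length: $A_0$ is spanned by the isomorphisms, and $A_n$, $n \ge 1$, by the composites of $n$ unfactorizable morphisms. Regard $A_0 = k\mathcal{E}_0$ as the left $A$-module $A/\bigoplus_{i\ge1}A_i$. Then the following are equivalent: 1. $\operatorname{pd}_{A} k\mathcal{E}_0 \le 1$; 2. $A$ is a Koszul algebra, that is, $A$ with the length grading is a graded algebra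 with $A_iA_j = A_{i+j}$ for all $i,j\ge0$, and the graded module $A_0$, which is generated in degree $0$, has a graded projective resolution $\cdots \to P^1 \to P^0 \to A_0 \to 0$ by locally finite graded modules with degree-preserving maps in which each $P^i$ is generated in degree $i$; 3. $\mathcal{E}$ is standardly stratified over $k$ with respect to the canonical pre-order. Here, for an object $x$ and a primitive idempotent $e$ of $k\operatorname{End}(x)$, put $\lambda = (x,e)$ and $P_\lambda = Ae$; for $\mu = (y,f)$ write $\mu \preceq \lambda$ if there is a morphism $y \to x$, and $\lambda \prec \mu$ if $\lambda \preceq \mu$ but not $\mu \preceq \lambda$. The standard module is $\Delta_\lambda = P_\lambda / \sum_{\mu \not\preceq \lambda} \operatorname{tr}_{P_\mu}(P_\lambda)$, where $\operatorname{tr}_{P_\mu}(P_\lambda)$ is the sum of the images of all homomorphisms $P_\mu \to P_\lambda$. The condition is that for each $\lambda$ the kernel of $P_\lambda \to \Delta_\lambda$ has a finite filtration whose factors are isomorphic to modules $\Delta_\mu$ with $\mu \succ \lambda$; 4. $\operatorname{pd}_{A} k\mathcal{E}_0 < \infty$. -/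

import Mathlib

open CategoryTheory

universe a m w v u

noncomputable section

namespace FreeEI

/-! ## Graded algebras and Koszul modules -/

section Koszul

variable {k : Type w} [Field k] {A : Type a} [Ring A] [Algebra k A]

/-- `A = ⨁ A_i` is a non-negatively graded, locally finite `k`-algebra generated in degrees `0`
and `1`, that is, `A_i · A_j = A_{i+j}` for all `i, j ≥ 0`. -/
structure IsStandardGraded (𝒜 : ℕ → Submodule k A) : Prop where
  internal : DirectSum.IsInternal 𝒜
  one_mem : (1 : A) ∈ 𝒜 0
  mul_eq : ∀ i j, 𝒜 i * 𝒜 j = 𝒜 (i + j)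
  finite : ∀ i, Module.Finite k (𝒜 i)

/-- `M = ⨁ M_j` (`j ∈ ℤ`) is a locally finite graded `A`-module. -/
structure IsGradedModule (𝒜 : ℕ → Submodule k A) {M : Type m} [AddCommGroup M] [Module k M]
    [Module A M] [IsScalarTower k A M] (ℳ : ℤ → Submodule k M) : Prop where
  internal : DirectSum.IsInternal ℳ
  smul_mem : ∀ (i : ℕ) (j : ℤ), ∀ r ∈ 𝒜 i, ∀ x ∈ ℳ j, r • x ∈ ℳ (i + j)
  finite : ∀ j, Module.Finite k (ℳ j)

/-- `M` is generated in degree `s`, that is, `M = A · M_s`. -/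
def GeneratedInDegree (A : Type a) [Ring A] [Algebra k A] {M : Type m} [AddCommGroup M]
    [Module k M] [Module A M] (ℳ : ℤ → Submodule k M) (s : ℤ) : Prop :=
  Submodule.span A (ℳ s : Set M) = ⊤

/-- A linear projective resolution `⋯ → P 1 → P 0 → M → 0` of a graded module `M`: an exact
sequence of graded modules and degree-preserving maps in which `P n` is projective and generated
in degree `n`. (Such a resolution is automatically minimal.) -/
structure LinearResolution (𝒜 : ℕ → Submodule k A) {M : Type m} [AddCommGroup M] [Module k M]
    [Module A M] [IsScalarTower k A M] (ℳ : ℤ → Submodule k M) where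
  P : ℕ → Type a
  [addCommGroup : ∀ n, AddCommGroup (P n)]
  [moduleBase : ∀ n, Module k (P n)]
  [module : ∀ n, Module A (P n)]
  [isScalarTower : ∀ n, IsScalarTower k A (P n)]
  piece : ∀ n, ℤ → Submodule k (P n)
  graded : ∀ n, IsGradedModule 𝒜 (piece n)
  projective : ∀ n, Module.Projective A (P n)
  generated : ∀ n, GeneratedInDegree A (piece n) n
  ε : P 0 →ₗ[A] M
  d : ∀ n, P (n + 1) →ₗ[A] P n
  ε_mem : ∀ j, ∀ x ∈ piece 0 j, ε x ∈ ℳ j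
  d_mem : ∀ n j, ∀ x ∈ piece (n + 1) j, d n x ∈ piece n j
  surjective : Function.Surjective ε
  exact_zero : Function.Exact (d 0) ε
  exact_succ : ∀ n, Function.Exact (d (n + 1)) (d n)

/-- Koszul modules: graded modules generated in degree `0` with a linear projective resolution. -/
structure IsKoszulModule (𝒜 : ℕ → Submodule k A) {M : Type m} [AddCommGroup M] [Module k M]
    [Module A M] [IsScalarTower k A M] (ℳ : ℤ → Submodule k M) : Prop where
  graded : IsGradedModule 𝒜 ℳ
  generated : GeneratedInDegree A ℳ 0
  resolution : Nonempty (LinearResolution 𝒜 ℳ)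

/-- `J = ⨁_{i ≥ 1} A_i`, as a (left) ideal. -/
def positivePart (𝒜 : ℕ → Submodule k A) : Submodule A A :=
  Submodule.span A (⋃ i : ℕ, (𝒜 (i + 1) : Set A))

/-- `A_0` regarded as an `A`-module, through its identification with `A / J`. -/
abbrev DegreeZero (𝒜 : ℕ → Submodule k A) : Type a := A ⧸ positivePart 𝒜

open Classical in
/-- The grading of the `A`-module `A_0`: it is concentrated in degree `0`. -/
def degreeZeroGrading (𝒜 : ℕ → Submodule k A) (j : ℤ) : Submodule k (DegreeZero 𝒜) :=
  if j = 0 then ⊤ else ⊥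

/-- `A`, with the given grading, is a Koszul algebra: it is a graded algebra (locally finite,
generated in degrees `0` and `1`) and `A_0` is a Koszul `A`-module. -/
structure IsKoszulAlgebra (𝒜 : ℕ → Submodule k A) : Prop where
  graded : IsStandardGraded 𝒜
  koszul : IsKoszulModule 𝒜 (degreeZeroGrading 𝒜)

end Koszul

/-! ## Category algebras -/

section CategoryAlgebra

/-- The morphisms of a category, with arbitrary source and target. -/
structure Mor (E : Type u) [Category.{v} E] where
  src : E
  tgt : E
  hom : src ⟶ tgt

variable (k : Type w) [Field k] (E : Type u) [Category.{v} E]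

/-- The category algebra `kE`: the `k`-vector space with basis the morphisms of `E`. -/
def CatAlg : Type (max u v w) := Mor E →₀ k

instance : AddCommGroup (CatAlg k E) := inferInstanceAs (AddCommGroup (Mor E →₀ k))

instance : Module k (CatAlg k E) := inferInstanceAs (Module k (Mor E →₀ k))

variable {E}

/-- A morphism as a basis vector of the category algebra. -/
def CatAlg.of (α : Mor E) : CatAlg k E := Finsupp.single α 1

open Classical in
/-- The product `β · α` of two morphisms: the composite `β ∘ α` if the target of `α` is the source
of `β`, and `0` otherwise. -/
def CatAlg.basisMul (β α : Mor E) : CatAlg k E :=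
  if h : α.tgt = β.src then CatAlg.of k ⟨α.src, β.tgt, α.hom ≫ eqToHom h ≫ β.hom⟩ else 0

/-- The bilinear extension of the product of morphisms. -/
def CatAlg.mulLin : CatAlg k E →ₗ[k] CatAlg k E →ₗ[k] CatAlg k E :=
  Finsupp.linearCombination k fun β : Mor E =>
    (Finsupp.linearCombination k fun α : Mor E => CatAlg.basisMul k β α :
      (Mor E →₀ k) →ₗ[k] CatAlg k E)

/-- The idempotent `1_x` of the category algebra. -/
def CatAlg.idem (x : E) : CatAlg k E := CatAlg.of k ⟨x, x, 𝟙 x⟩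

instance : Mul (CatAlg k E) := ⟨fun f g => CatAlg.mulLin k f g⟩

instance [Fintype E] : One (CatAlg k E) := ⟨∑ x : E, CatAlg.idem k x⟩

variable {k}

theorem CatAlg.induction {p : CatAlg k E → Prop} (f : CatAlg k E) (zero : p 0)
    (add : ∀ f g, p f → p g → p (f + g)) (smul : ∀ (r : k) α, p (r • CatAlg.of k α)) : p f := by
  refine Finsupp.induction_linear (motive := p) f zero (fun f g => add f g) fun α r => ?_
  have h := smul r α
  have e : r • CatAlg.of k α = (Finsupp.single α r : Mor E →₀ k) := by
    change r • (Finsupp.single α 1 : Mor E →₀ k) = _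
    simp
  rwa [e] at h

theorem CatAlg.mul_def (f g : CatAlg k E) : f * g = CatAlg.mulLin k f g := rfl

theorem CatAlg.of_mul_of (β α : Mor E) :
    CatAlg.of k β * CatAlg.of k α = CatAlg.basisMul k β α := by
  rw [CatAlg.mul_def, CatAlg.mulLin, CatAlg.of, CatAlg.of]
  erw [Finsupp.linearCombination_single, one_smul, Finsupp.linearCombination_single, one_smul]

theorem CatAlg.smul_mul (r : k) (f g : CatAlg k E) : (r • f) * g = r • (f * g) := by
  simp [CatAlg.mul_def]

theorem CatAlg.mul_smul (r : k) (f g : CatAlg k E) : f * (r • g) = r • (f * g) := by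
  simp [CatAlg.mul_def]

instance : NonUnitalNonAssocRing (CatAlg k E) :=
  { (inferInstance : AddCommGroup (CatAlg k E)), (inferInstance : Mul (CatAlg k E)) with
    left_distrib := fun f g h => by simp [CatAlg.mul_def]
    right_distrib := fun f g h => by simp [CatAlg.mul_def]
    zero_mul := fun f => by simp [CatAlg.mul_def]
    mul_zero := fun f => by simp [CatAlg.mul_def] }

theorem CatAlg.of_mul_assoc (γ β α : Mor E) :
    CatAlg.of k γ * CatAlg.of k β * CatAlg.of k α =
      CatAlg.of k γ * (CatAlg.of k β * CatAlg.of k α) := by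
  obtain ⟨a, b, f⟩ := α
  obtain ⟨b', c, g⟩ := β
  obtain ⟨c', d, h⟩ := γ
  rw [CatAlg.of_mul_of, CatAlg.of_mul_of, CatAlg.basisMul, CatAlg.basisMul]
  by_cases h1 : b = b'
  · subst h1
    by_cases h2 : c = c'
    · subst h2
      simp [CatAlg.of_mul_of, CatAlg.basisMul]
    · simp [CatAlg.of_mul_of, CatAlg.basisMul, h2]
  · by_cases h2 : c = c'
    · subst h2
      simp [CatAlg.of_mul_of, CatAlg.basisMul, h1]
    · simp [h1, h2]

theorem CatAlg.idem_mul_of (x : E) (α : Mor E) [Decidable (α.tgt = x)] :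
    CatAlg.idem k x * CatAlg.of k α = if α.tgt = x then CatAlg.of k α else 0 := by
  obtain ⟨a, b, f⟩ := α
  rw [CatAlg.idem, CatAlg.of_mul_of, CatAlg.basisMul]
  by_cases h : b = x
  · subst h; simp
  · simp [h]

theorem CatAlg.of_mul_idem (x : E) (α : Mor E) [Decidable (α.src = x)] :
    CatAlg.of k α * CatAlg.idem k x = if α.src = x then CatAlg.of k α else 0 := by
  obtain ⟨a, b, f⟩ := α
  rw [CatAlg.idem, CatAlg.of_mul_of, CatAlg.basisMul]
  by_cases h : a = x
  · subst h; simp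
  · simp [h, Ne.symm h]

theorem CatAlg.one_def [Fintype E] : (1 : CatAlg k E) = ∑ x : E, CatAlg.idem k x := rfl

instance [Fintype E] : Ring (CatAlg k E) :=
  { (inferInstance : NonUnitalNonAssocRing (CatAlg k E)),
    (inferInstance : One (CatAlg k E)) with
    mul_assoc := fun f g h => by
      induction f using CatAlg.induction with
      | zero => simp
      | add f f' hf hf' => simp only [add_mul, hf, hf']
      | smul r γ =>
        induction g using CatAlg.induction with
        | zero => simp
        | add g g' hg hg' => simp only [add_mul, mul_add, hg, hg']
        | smul s β =>
          induction h using CatAlg.induction with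
          | zero => simp
          | add h h' hh hh' => simp only [mul_add, hh, hh']
          | smul t α => simp only [CatAlg.smul_mul, CatAlg.mul_smul, CatAlg.of_mul_assoc]
    one_mul := fun f => by
      classical
      induction f using CatAlg.induction with
      | zero => simp
      | add f f' hf hf' => simp only [mul_add, hf, hf']
      | smul r α =>
        rw [CatAlg.mul_smul, CatAlg.one_def, Finset.sum_mul]
        simp [CatAlg.idem_mul_of]
    mul_one := fun f => by
      classical
      induction f using CatAlg.induction with
      | zero => simp
      | add f f' hf hf' => simp only [add_mul, hf, hf']
      | smul r α =>
        rw [CatAlg.smul_mul, CatAlg.one_def, Finset.mul_sum]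
        simp [CatAlg.of_mul_idem] }

instance [Fintype E] : Algebra k (CatAlg k E) :=
  Algebra.ofModule CatAlg.smul_mul (fun r f g => CatAlg.mul_smul r f g)

end CategoryAlgebra

/-! ## Free EI categories and the length grading -/

section FreeEI

variable {E : Type u} [Category.{v} E]

/-- `α` is unfactorizable: it is not an automorphism, and in each decomposition `α = γ ∘ β` one of
`β`, `γ` is an automorphism. (In a skeletal category every isomorphism is an automorphism.) -/
def Unfactorizable {x y : E} (α : x ⟶ y) : Prop :=
  ¬ IsIso α ∧ ∀ (z : E) (β : x ⟶ z) (γ : z ⟶ y), β ≫ γ = α → IsIso β ∨ IsIso γ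

/-- Composable sequences `x = x_0 → x_1 → ⋯ → x_n = y` of unfactorizable morphisms, `n ≥ 1`. -/
inductive UPath : E → E → Type (max u v)
  | single {x y : E} (α : x ⟶ y) (hα : Unfactorizable α) : UPath x y
  | cons {x y z : E} (α : x ⟶ y) (hα : Unfactorizable α) (p : UPath y z) : UPath x z

/-- The composite morphism of a sequence. -/
def UPath.comp : {x y : E} → UPath x y → (x ⟶ y)
  | _, _, .single α _ => α
  | _, _, .cons α _ p => α ≫ p.comp

/-- The number of morphisms in a sequence. -/
def UPath.length : {x y : E} → UPath x y → ℕ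
  | _, _, .single _ _ => 1
  | _, _, .cons _ _ p => p.length + 1

/-- `Ladder h p q`: the sequences `p = (α_1, …, α_n)` and `q = (β_1, …, β_n)` have the same length
and run through the same objects `x_0, …, x_n`, and there are automorphisms `h_0 = h`,
`h_1, …, h_{n-1}`, `h_n = 1` with `h_i ∈ Aut (x_i)` and `h_i ∘ α_i = β_i ∘ h_{i-1}` for all `i`. -/
inductive Ladder : {x y : E} → (x ≅ x) → UPath x y → UPath x y → Prop
  | single {x y : E} (h : x ≅ x) (α β : x ⟶ y) (hα : Unfactorizable α) (hβ : Unfactorizable β)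
      (comm : α = h.hom ≫ β) : Ladder h (.single α hα) (.single β hβ)
  | cons {x y z : E} (h : x ≅ x) (g : y ≅ y) (α β : x ⟶ y) (hα : Unfactorizable α)
      (hβ : Unfactorizable β) (p q : UPath y z) (comm : α ≫ g.hom = h.hom ≫ β)
      (tail : Ladder g p q) : Ladder h (.cons α hα p) (.cons β hβ q)

variable (E) in
/-- The Unique Factorization Property: two decompositions of a non-isomorphism into unfactorizable
morphisms are related by a ladder of automorphisms which starts (and ends) with an identity. -/
def UniqueFactorization : Prop :=
  ∀ (x y : E) (α : x ⟶ y), ¬ IsIso α → ∀ p q : UPath x y, p.comp = α → q.comp = α →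
    Ladder (Iso.refl x) p q

variable (E) in
/-- A (skeletal, connected) finite free EI category: a skeletal and connected category with
finitely many objects and morphisms in which every endomorphism is an isomorphism, and which
satisfies the Unique Factorization Property. -/
structure IsFiniteFreeEI : Prop where
  finite_obj : Finite E
  finite_hom : ∀ x y : E, Finite (x ⟶ y)
  isIso_of_end : ∀ (x : E) (f : x ⟶ x), IsIso f
  skeletal : Skeletal E
  connected : ∀ x y : E, Zigzag x y
  ufp : UniqueFactorization E

/-- `α` has length `n`: it is an isomorphism and `n = 0`, or it is a composite of `n ≥ 1`
unfactorizable morphisms. -/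
def HasLength (α : Mor E) (n : ℕ) : Prop :=
  (n = 0 ∧ IsIso α.hom) ∨ ∃ p : UPath α.src α.tgt, p.length = n ∧ p.comp = α.hom

/-- The length grading: the degree `n` part of `kE` is spanned by the morphisms of length `n`. -/
def lengthGrading (k : Type w) [Field k] (E : Type u) [Category.{v} E] (n : ℕ) :
    Submodule k (CatAlg k E) :=
  Submodule.span k (CatAlg.of k '' {α : Mor E | HasLength α n})

end FreeEI

/-! ## Standard stratification -/

section Stratification

/-- A primitive idempotent: non-zero, and not the sum of two non-zero orthogonal idempotents. -/
structure IsPrimitiveIdem {A : Type a} [Ring A] (e : A) : Prop where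
  idem : IsIdempotentElem e
  ne_zero : e ≠ 0
  indecomposable : ∀ f g : A, IsIdempotentElem f → IsIdempotentElem g → f * g = 0 → g * f = 0 →
    f + g = e → f = 0 ∨ g = 0

variable (k : Type w) [Field k] (E : Type u) [Category.{v} E] [Fintype E]

/-- The index set `Λ` of the indecomposable projective `kE`-modules `P_λ = kE · e_λ`: pairs of an
object `x` and a primitive idempotent `e` of `1_x · kE · 1_x = k End(x)`. (All primitive idempotents
are used, instead of one complete orthogonal set for each `x`; this repeats modules up to
isomorphism, but adds no new isomorphism class.) -/
structure StratIndex where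
  obj : E
  e : CatAlg k E
  idem_mul : CatAlg.idem k obj * e = e
  mul_idem : e * CatAlg.idem k obj = e
  primitive : IsPrimitiveIdem e

namespace StratIndex

variable {k E}

/-- The canonical pre-order: `μ ≼ l` if there is a morphism from the object of `μ` to the object
of `l`. -/
def le (μ l : StratIndex k E) : Prop := Nonempty (μ.obj ⟶ l.obj)

/-- The strict relation `μ ≺ l` of the canonical pre-order. -/
def lt (μ l : StratIndex k E) : Prop := μ.le l ∧ ¬ l.le μ

/-- The projective module `P_l = kE · e_l`. -/
def proj (l : StratIndex k E) : Submodule (CatAlg k E) (CatAlg k E) :=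
  Submodule.span (CatAlg k E) {l.e}

/-- The sum of the traces of all `P_μ` with `μ ⋠ l` in `P_l`. -/
def traceSum (l : StratIndex k E) : Submodule (CatAlg k E) l.proj :=
  ⨆ (μ : StratIndex k E) (_ : ¬ μ.le l) (f : μ.proj →ₗ[CatAlg k E] l.proj), LinearMap.range f

/-- The standard module `Δ_l`, the quotient of `P_l` by the sum of the traces of all `P_μ` with
`μ ⋠ l`; it is the largest quotient of `P_l` all of whose composition factors are tops of
modules `P_μ` with `μ ≼ l`. -/
abbrev standard (l : StratIndex k E) : Type (max u v w) := l.proj ⧸ l.traceSum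

end StratIndex

variable {k E}

/-- `M` has a finite filtration whose factors are standard modules `Δ_μ` with `μ ∈ S`. -/
def HasDeltaFiltration (S : Set (StratIndex k E)) (M : Type m) [AddCommGroup M]
    [Module (CatAlg k E) M] : Prop :=
  ∃ (n : ℕ) (F : ℕ → Submodule (CatAlg k E) M), F 0 = ⊥ ∧ F n = ⊤ ∧
    ∀ i < n, F i ≤ F (i + 1) ∧ ∃ μ ∈ S,
      Nonempty ((F (i + 1) ⧸ (F i).submoduleOf (F (i + 1))) ≃ₗ[CatAlg k E] μ.standard)

variable (k E) in
/-- `E` is standardly stratified over `k` with respect to the canonical pre-order: for each `l` the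
kernel of `P_l → Δ_l` has a finite filtration with factors `Δ_μ`, `l ≺ μ`. -/
def IsStandardlyStratified : Prop :=
  ∀ l : StratIndex k E, HasDeltaFiltration {μ | l.lt μ} l.traceSum

end Stratification

end FreeEI

end

/-! All four conditions are equivalent to one arithmetic condition W: for each unfactorizable β : x
⟶ y, the order of the stabilizer of β in Aut(y) is invertible in k. `IsWeighted` states this without
division, by asking for a function whose sum over the Aut(y)-orbit of β, counted with
multiplicities, is 1. Write A = kE and let J be the span of the non-isomorphisms, so that the degree
zero part is A/J.

W implies the rest. By unique factorization a non-isomorphism determines its first unfactorizable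
factor β up to an automorphism of the middle object. Averaging over these choices with the weights
splits a map from a free module onto J (`exists_section_positivePart`), so J is projective. Then 0 →
J → A → A/J → 0 gives projective dimension at most 1, and it is a linear resolution because J is
generated by the unfactorizable morphisms, in degree 1. W also passes to all morphisms
(`IsFiniteFreeEI.isWeighted`), which makes the kernel of P_l → Δ_l projective over every kAut(y)
(`isRelProj_traceSum`). Such a module is filtered by standard modules, because Δ_l is the
indecomposable projective kAut(x)e placed at the single object x
(`hasDeltaFiltration_of_isRelProj`).

For the converses, projectivity of 1_y M over kAut(y) is encoded by Higman's criterion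
(`IsRelProj`): some k-linear θ satisfies ∑ gθg⁻¹ = 1_y on M. If such an M contains an element that
behaves like the point β, on which a stabilizer-invariant functional takes the value 1, then that
functional and θ together produce a weight for β (`IsRelProj.exists_weight`). The three converses
differ only in the choice of M: - finite projective dimension: M is the left ideal Aβ, a direct
summand of J; dimension shifting works because an injection between projective kAut(y)-modules
splits; - a linear resolution: M is P¹/JP¹, and linearity forces the kernel of P¹ → P⁰ into JP¹, so
that a lift of β is well defined modulo JP¹; - standard stratification: M is the product of the
kernels of P_l → Δ_l over a decomposition of 1_x into primitive idempotents. -/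

noncomputable section

namespace FreeEI

/-! ### Higman's criterion and relatively projective modules. -/

section Averaging

variable {k : Type*} [Field k] {A : Type*} [Ring A] [Algebra k A] {G : Type*} [Group G]
  (ρ : G →ₙ* A)
variable {L : Type*} [AddCommGroup L] [Module k L] [Module A L] [IsScalarTower k A L]
variable {M : Type*} [AddCommGroup M] [Module k M] [Module A M] [IsScalarTower k A M]
variable {N : Type*} [AddCommGroup N] [Module k N] [Module A N] [IsScalarTower k A N]

/-- A linear map commutes with the action of `G` through `ρ`. -/
def IsEquivariant (f : M →ₗ[k] N) : Prop := ∀ (g : G) (m : M), f (ρ g • m) = ρ g • f m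

theorem isEquivariant_restrictScalars (f : M →ₗ[A] N) : IsEquivariant ρ (f.restrictScalars k) :=
  fun _ _ => f.map_smul _ _

variable {ρ} in
theorem one_smul_one_smul (m : M) : ρ 1 • ρ 1 • m = ρ 1 • m := by
  rw [smul_smul, ← map_mul, one_mul]

variable [Fintype G]

/-- The average `∑ g f g⁻¹` of a linear map over a finite group acting through `ρ`. -/
def average (f : M →ₗ[k] N) : M →ₗ[k] N where
  toFun m := ∑ g : G, ρ g • f (ρ g⁻¹ • m)
  map_add' x y := by simp [Finset.sum_add_distrib]
  map_smul' c x := by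
    simp only [RingHom.id_apply, Finset.smul_sum]
    refine Finset.sum_congr rfl fun g _ => ?_
    rw [smul_comm _ c x, map_smul, smul_comm]

theorem average_apply (f : M →ₗ[k] N) (m : M) :
    average ρ f m = ∑ g : G, ρ g • f (ρ g⁻¹ • m) := rfl

theorem isEquivariant_average (f : M →ₗ[k] N) : IsEquivariant ρ (average ρ f) := by
  intro h m
  rw [average_apply, average_apply, Finset.smul_sum]
  refine Fintype.sum_equiv (Equiv.mulLeft h⁻¹) _ _ fun g => ?_
  rw [Equiv.coe_mulLeft, smul_smul, smul_smul, ← map_mul, ← map_mul]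
  congr 4
  · group
  · group

variable {ρ}

theorem average_comp_left {p : M →ₗ[k] N} (hp : IsEquivariant ρ p) (f : L →ₗ[k] M) (l : L) :
    p (average ρ f l) = average ρ (p ∘ₗ f) l := by
  simp only [average_apply, map_sum, LinearMap.comp_apply]
  exact Finset.sum_congr rfl fun g _ => hp g _

theorem average_comp_right {i : L →ₗ[k] M} (hi : IsEquivariant ρ i) (f : M →ₗ[k] N) (l : L) :
    average ρ f (i l) = average ρ (f ∘ₗ i) l := by
  simp only [average_apply, LinearMap.comp_apply]
  exact Finset.sum_congr rfl fun g _ => by rw [hi]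

variable (k ρ) in
/-- Higman's criterion for the projectivity of `ρ(1) M` as a `k G`-module. -/
def IsRelProj (M : Type*) [AddCommGroup M] [Module k M] [Module A M] [IsScalarTower k A M] :
    Prop :=
  ∃ θ : M →ₗ[k] M, ∀ m, average ρ θ m = ρ 1 • m

theorem IsRelProj.of_equivariant_retract (hM : IsRelProj k ρ M) {s : N →ₗ[k] M} {p : M →ₗ[k] N}
    (hs : IsEquivariant ρ s) (hp : IsEquivariant ρ p) (h : ∀ n, p (s n) = ρ 1 • n) :
    IsRelProj k ρ N := by
  obtain ⟨θ, hθ⟩ := hM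
  refine ⟨p ∘ₗ θ ∘ₗ s, fun n => ?_⟩
  rw [← average_comp_left hp, ← average_comp_right hs, hθ, hp, h, one_smul_one_smul]

theorem IsRelProj.of_retract (hM : IsRelProj k ρ M) (s : N →ₗ[A] M) (p : M →ₗ[A] N)
    (h : ∀ n, p (s n) = n) : IsRelProj k ρ N := by
  obtain ⟨θ, hθ⟩ := hM
  refine ⟨p.restrictScalars k ∘ₗ θ ∘ₗ s.restrictScalars k, fun n => ?_⟩
  rw [← average_comp_left (isEquivariant_restrictScalars ρ p),
    ← average_comp_right (isEquivariant_restrictScalars ρ s), hθ]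
  simp [h]

theorem IsRelProj.of_equiv (hM : IsRelProj k ρ M) (e : M ≃ₗ[A] N) : IsRelProj k ρ N :=
  hM.of_retract e.symm.toLinearMap e.toLinearMap (by simp)

/-- Over a field p has a k-linear section σ. Averaging σθ makes it equivariant, and pσ = 1 turns the
composite with p into the average of θ, which is the identity ρ(1). -/
theorem IsRelProj.exists_section (hN : IsRelProj k ρ N) {p : M →ₗ[A] N}
    (hp : Function.Surjective p) :
    ∃ s : N →ₗ[k] M, IsEquivariant ρ s ∧ ∀ n, p (s n) = ρ 1 • n := by
  obtain ⟨θ, hθ⟩ := hN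
  obtain ⟨σ, hσ⟩ := (p.restrictScalars k).exists_rightInverse_of_surjective
    (LinearMap.range_eq_top.2 hp)
  refine ⟨average ρ (σ ∘ₗ θ), isEquivariant_average _ _, fun n => ?_⟩
  have := average_comp_left (isEquivariant_restrictScalars ρ p) (σ ∘ₗ θ) n
  rw [← LinearMap.comp_assoc, hσ, LinearMap.id_comp, hθ] at this
  exact this

/-- Dual to the previous argument, averaging θσ for a k-linear retraction σ. This is the
self-injectivity of group algebras of finite groups, and it is what permits dimension shifting. -/
theorem IsRelProj.exists_retraction (hL : IsRelProj k ρ L) {i : L →ₗ[A] M}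
    (hi : Function.Injective i) :
    ∃ r : M →ₗ[k] L, IsEquivariant ρ r ∧ ∀ l, r (i l) = ρ 1 • l := by
  obtain ⟨θ, hθ⟩ := hL
  obtain ⟨σ, hσ⟩ := (i.restrictScalars k).exists_leftInverse_of_injective
    (LinearMap.ker_eq_bot.2 hi)
  refine ⟨average ρ (θ ∘ₗ σ), isEquivariant_average _ _, fun l => ?_⟩
  have := average_comp_right (isEquivariant_restrictScalars ρ i) (θ ∘ₗ σ) l
  rw [LinearMap.comp_assoc, hσ, LinearMap.comp_id, hθ] at this
  exact this

/-- The cokernel of an injection of relatively projective modules is relatively projective. -/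
theorem IsRelProj.of_exact_right (hL : IsRelProj k ρ L) (hM : IsRelProj k ρ M) {i : L →ₗ[A] M}
    {p : M →ₗ[A] N} (hi : Function.Injective i) (hp : Function.Surjective p)
    (hip : Function.Exact i p) : IsRelProj k ρ N := by
  obtain ⟨r, hr, hri⟩ := hL.exists_retraction hi
  have hpi (l : L) : p (i l) = 0 := (hip _).2 ⟨l, rfl⟩
  obtain ⟨σ, hσ⟩ := (p.restrictScalars k).exists_rightInverse_of_surjective
    (LinearMap.range_eq_top.2 hp)
  have hσ (n : N) : p (σ n) = n := LinearMap.congr_fun hσ n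
  -- The map t kills the image of i, so it factors through p. Hence tσ is equivariant although σ is
  -- only k-linear, and it exhibits N as a retract of M.
  let t : M →ₗ[k] M := Algebra.lsmul k k M (ρ 1) - i.restrictScalars k ∘ₗ r
  have ht (m : M) : t m = ρ 1 • m - i (r m) := rfl
  have hti (m m' : M) (h : p m = p m') : t m = t m' := by
    obtain ⟨l, hl⟩ := (hip (m - m')).1 (by rw [map_sub, h, sub_self])
    rw [← sub_eq_zero, ← map_sub, ← hl, ht, hri, i.map_smul, sub_self]
  refine hM.of_equivariant_retract (s := t ∘ₗ σ) (p := p.restrictScalars k) (fun g n => ?_)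
    (isEquivariant_restrictScalars ρ p) fun n => ?_
  · have h1 : t (σ (ρ g • n)) = t (ρ g • σ n) := hti _ _ (by rw [p.map_smul, hσ, hσ])
    simp only [LinearMap.comp_apply, h1]
    rw [ht, ht, hr, i.map_smul, smul_sub, smul_smul, smul_smul, ← map_mul, ← map_mul, one_mul,
      mul_one]
  · change p (t (σ n)) = _
    rw [ht, map_sub, hpi, sub_zero, p.map_smul, hσ]

/-- An extension of relatively projective modules is relatively projective. -/
theorem IsRelProj.of_exact_middle (hL : IsRelProj k ρ L) (hN : IsRelProj k ρ N) {i : L →ₗ[A] M}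
    {p : M →ₗ[A] N} (hi : Function.Injective i) (hp : Function.Surjective p)
    (hip : Function.Exact i p) : IsRelProj k ρ M := by
  obtain ⟨s, hs, hps⟩ := hN.exists_section hp
  obtain ⟨r₀, hr₀⟩ := (i.restrictScalars k).exists_leftInverse_of_injective
    (LinearMap.ker_eq_bot.2 hi)
  have hr₀ (l : L) : r₀ (i l) = l := LinearMap.congr_fun hr₀ l
  -- The complementary projection to sp: it lands in the image of i, and r₀t is an equivariant
  -- retraction. The criterion for M is then assembled from the two summands.
  let t : M →ₗ[k] M := Algebra.lsmul k k M (ρ 1) - s ∘ₗ p.restrictScalars k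
  have ht (m : M) : t m = ρ 1 • m - s (p m) := rfl
  have hpt (m : M) : p (t m) = 0 := by rw [ht, map_sub, hps, p.map_smul, sub_self]
  have htg : IsEquivariant ρ t := fun g m => by
    rw [ht, ht, p.map_smul, hs, smul_sub, smul_smul, smul_smul, ← map_mul, ← map_mul, one_mul,
      mul_one]
  have hit (m : M) : i (r₀ (t m)) = t m := by
    obtain ⟨l, hl⟩ := (hip _).1 (hpt m)
    rw [← hl, hr₀]
  have hr : IsEquivariant ρ (r₀ ∘ₗ t) := fun g m => hi (by
    rw [LinearMap.comp_apply, LinearMap.comp_apply, hit, i.map_smul, hit, htg])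
  obtain ⟨θ, hθ⟩ := hL
  obtain ⟨η, hη⟩ := hN
  refine ⟨i.restrictScalars k ∘ₗ θ ∘ₗ (r₀ ∘ₗ t) + s ∘ₗ η ∘ₗ p.restrictScalars k, fun m => ?_⟩
  have h1 := average_comp_left (isEquivariant_restrictScalars ρ i) (θ ∘ₗ (r₀ ∘ₗ t)) m
  have h2 := average_comp_left hs (η ∘ₗ p.restrictScalars k) m
  rw [← average_comp_right hr, hθ] at h1
  rw [← average_comp_right (isEquivariant_restrictScalars ρ p), hη] at h2
  have h3 (f g : M →ₗ[k] M) : average ρ (f + g) m = average ρ f m + average ρ g m := by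
    simp [average_apply, Finset.sum_add_distrib]
  rw [h3, ← h1, ← h2, hs]
  change i (ρ 1 • r₀ (t m)) + ρ 1 • s (p m) = _
  rw [i.map_smul, hit, ht, smul_sub, sub_add_cancel, one_smul_one_smul]

theorem IsRelProj.of_one_smul_eq_zero (h : ∀ m : M, ρ 1 • m = 0) : IsRelProj k ρ M :=
  ⟨0, fun m => by simp [average_apply, h]⟩

theorem IsRelProj.finsupp (hM : IsRelProj k ρ M) (ι : Type*) : IsRelProj k ρ (ι →₀ M) := by
  obtain ⟨θ, hθ⟩ := hM
  refine ⟨Finsupp.mapRange.linearMap θ, fun m => Finsupp.ext fun i => ?_⟩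
  rw [average_apply, Finsupp.finsetSum_apply, Finsupp.smul_apply, ← hθ, average_apply]
  simp

theorem IsRelProj.pi {ι : Type*} {M : ι → Type*} [∀ i, AddCommGroup (M i)] [∀ i, Module k (M i)]
    [∀ i, Module A (M i)] [∀ i, IsScalarTower k A (M i)] (hM : ∀ i, IsRelProj k ρ (M i)) :
    IsRelProj k ρ (∀ i, M i) := by
  choose θ hθ using hM
  refine ⟨LinearMap.pi fun i => θ i ∘ₗ LinearMap.proj i, fun m => funext fun i => ?_⟩
  rw [average_apply, Finset.sum_apply, Pi.smul_apply, ← hθ, average_apply]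
  rfl

/-- A relatively projective module containing an element which behaves like a point `β` of a
`G`-set `X` gives a weight on the orbit of `β`. -/
theorem IsRelProj.exists_weight (hM : IsRelProj k ρ M) {X : Type*} [MulAction G X] (β : X)
    (x : M) (c : M →ₗ[k] k) (hx : ∀ g : G, g • β = β → ρ g • x = x)
    (hc : ∀ g : G, g • β = β → ∀ m, c (ρ g • m) = c m) (h1 : c x = 1) :
    ∃ f : X → k, ∑ g : G, f (g • β) = 1 := by
  classical
  obtain ⟨θ, hθ⟩ := hM
  -- The weight at gβ is c(g⁻¹θ(gx)). Invariance of x and c under the stabilizer makes it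
  -- independent of g, and its sum over G is c applied to the average of θ at x, that is, c(x) = 1.
  refine ⟨fun δ => if h : ∃ g : G, g • β = δ then
    c (ρ h.choose⁻¹ • θ (ρ h.choose • x)) else 0, ?_⟩
  have key (g : G) : (if h : ∃ g' : G, g' • β = g • β then
      c (ρ h.choose⁻¹ • θ (ρ h.choose • x)) else 0) = c (ρ g⁻¹ • θ (ρ g • x)) := by
    have h : ∃ g' : G, g' • β = g • β := ⟨g, rfl⟩
    rw [dif_pos h]
    generalize hg' : h.choose = g'
    have hs : g' • β = g • β := hg' ▸ h.choose_spec
    have hs1 : (g⁻¹ * g') • β = β := by rw [mul_smul, hs, inv_smul_smul]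
    have e1 : ρ g' • x = ρ g • x := by
      conv_rhs => rw [← hx _ hs1, smul_smul, ← map_mul, mul_inv_cancel_left]
    rw [e1, ← hc _ hs1 (ρ g'⁻¹ • _), smul_smul, ← map_mul]
    congr 4
    group
  simp only [key]
  have h2 : c (average ρ θ x) = 1 := by rw [hθ, hx 1 (one_smul G β), h1]
  rw [← h2, average_apply, map_sum]
  exact Fintype.sum_equiv (Equiv.inv G) _ _ fun g => by simp

end Averaging

/-! ### Factorizations, lengths and orbits of morphisms. -/

section Combinatorics

variable {E : Type u} [Category.{v} E]

/-- Automorphisms of the target act on morphisms by composition. -/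
instance autMulAction (x y : E) : MulAction (Aut y) (x ⟶ y) where
  smul g α := α ≫ g.hom
  one_smul α := Category.comp_id α
  mul_smul g h α := (Category.assoc α h.hom g.hom).symm

theorem aut_smul_def {x y : E} (g : Aut y) (α : x ⟶ y) : g • α = α ≫ g.hom := rfl

theorem aut_mul_hom {x : E} (g h : Aut x) : (g * h).hom = h.hom ≫ g.hom := rfl

theorem Unfactorizable.comp_isIso {x y z : E} {β : x ⟶ y} (hβ : Unfactorizable β) (h : y ⟶ z)
    [IsIso h] : Unfactorizable (β ≫ h) := by
  refine ⟨fun (hi : IsIso _) => hβ.1 ?_, fun t γ δ e => ?_⟩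
  · have := IsIso.comp_isIso (f := β ≫ h) (h := inv h)
    simpa using this
  · refine (hβ.2 t γ (δ ≫ inv h) (by rw [← Category.assoc, e]; simp)).imp_right fun (hi : IsIso _) => ?_
    have := IsIso.comp_isIso (f := δ ≫ inv h) (h := h)
    simpa using this

theorem Unfactorizable.smul {x y : E} {β : x ⟶ y} (hβ : Unfactorizable β) (g : Aut y) :
    Unfactorizable (g • β) :=
  have : IsIso g.hom := Iso.isIso_hom g
  hβ.comp_isIso g.hom

theorem Ladder.length_eq {x y : E} {h : x ≅ x} {p q : UPath x y} (l : Ladder h p q) :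
    p.length = q.length := by
  induction l with
  | single => rfl
  | cons _ _ _ _ _ _ _ _ _ _ ih => simp [UPath.length, ih]

theorem Ladder.comp_eq {x y : E} {h : x ≅ x} {p q : UPath x y} (l : Ladder h p q) :
    p.comp = h.hom ≫ q.comp := by
  induction l with
  | single _ _ _ _ _ comm => exact comm
  | cons h g α β _ _ p q comm _ ih =>
    simp only [UPath.comp]
    rw [ih, ← Category.assoc, comm, Category.assoc]

namespace UPath

/-- Concatenation of sequences of unfactorizable morphisms. -/
def append : {x y z : E} → UPath x y → UPath y z → UPath x z
  | _, _, _, .single α hα, q => .cons α hα q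
  | _, _, _, .cons α hα p, q => .cons α hα (p.append q)

theorem append_comp {x y z : E} (p : UPath x y) (q : UPath y z) :
    (p.append q).comp = p.comp ≫ q.comp := by
  induction p with
  | single => rfl
  | cons _ _ _ ih => simp [append, comp, ih]

theorem length_pos {x y : E} (p : UPath x y) : 0 < p.length := by
  cases p <;> simp [length]

end UPath

theorem hasLength_zero_iff (α : Mor E) : HasLength α 0 ↔ IsIso α.hom := by
  constructor
  · rintro (h | ⟨p, hp, -⟩)
    · exact h.2
    · exact absurd hp p.length_pos.ne'
  · exact fun h => Or.inl ⟨rfl, h⟩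

theorem hasLength_one_iff (α : Mor E) : HasLength α 1 ↔ Unfactorizable α.hom := by
  constructor
  · rintro (h | ⟨p, hp, e⟩)
    · exact absurd h.1 one_ne_zero
    · rw [← e]
      cases p with
      | single β hβ => exact hβ
      | cons β hβ p =>
        have := p.length_pos
        simp [UPath.length] at hp
        omega
  · exact fun h => Or.inr ⟨.single _ h, rfl, rfl⟩

theorem Unfactorizable.isIso_comp {x y z : E} {β : y ⟶ z} (hβ : Unfactorizable β) (h : x ⟶ y)
    [IsIso h] : Unfactorizable (h ≫ β) := by
  refine ⟨fun (hi : IsIso _) => hβ.1 ?_, fun t γ δ e => ?_⟩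
  · have := IsIso.comp_isIso (f := inv h) (h := h ≫ β)
    simpa using this
  · refine (hβ.2 t (inv h ≫ γ) δ (by rw [Category.assoc, e]; simp)).imp_left
      fun (hi : IsIso _) => ?_
    have := IsIso.comp_isIso (f := h) (h := inv h ≫ γ)
    simpa using this

theorem hasLength_succ_iff {x y : E} {α : x ⟶ y} {n : ℕ} : HasLength ⟨x, y, α⟩ (n + 1) ↔
    ∃ (z : E) (β : x ⟶ z) (γ : z ⟶ y), Unfactorizable β ∧ HasLength ⟨z, y, γ⟩ n ∧ β ≫ γ = α := by
  constructor
  · rintro (h | ⟨p, hp, e⟩)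
    · exact absurd h.1 n.succ_ne_zero
    · change UPath x y at p
      change p.comp = α at e
      cases p with
      | single β hβ =>
        simp only [UPath.length] at hp
        obtain rfl : n = 0 := by omega
        exact ⟨y, β, 𝟙 y, hβ, (hasLength_zero_iff _).2 (inferInstanceAs (IsIso (𝟙 y))),
          (Category.comp_id β).trans e⟩
      | cons β hβ p =>
        exact ⟨_, β, p.comp, hβ, Or.inr ⟨p, by simpa [UPath.length] using hp, rfl⟩, e⟩
  · rintro ⟨z, β, γ, hβ, ⟨rfl, hγ⟩ | ⟨p, rfl, hp⟩, rfl⟩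
    · have : IsIso γ := hγ
      exact Or.inr ⟨.single (β ≫ γ) (hβ.comp_isIso γ), rfl, rfl⟩
    · exact Or.inr ⟨.cons β hβ p, rfl, congrArg (β ≫ ·) hp⟩

theorem HasLength.comp {x y z : E} {α : x ⟶ y} {β : y ⟶ z} {m n : ℕ}
    (hα : HasLength ⟨x, y, α⟩ m) (hβ : HasLength ⟨y, z, β⟩ n) :
    HasLength ⟨x, z, α ≫ β⟩ (n + m) := by
  induction m generalizing x with
  | zero =>
    have : IsIso α := (hasLength_zero_iff _).1 hα
    cases n with
    | zero =>
      have : IsIso β := (hasLength_zero_iff _).1 hβ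
      exact (hasLength_zero_iff _).2 (IsIso.comp_isIso (f := α) (h := β))
    | succ n =>
      obtain ⟨t, γ, δ, hγ, hδ, rfl⟩ := hasLength_succ_iff.1 hβ
      exact hasLength_succ_iff.2 ⟨t, α ≫ γ, δ, hγ.isIso_comp α, hδ, Category.assoc _ _ _⟩
  | succ m ih =>
    obtain ⟨t, γ, δ, hγ, hδ, rfl⟩ := hasLength_succ_iff.1 hα
    exact hasLength_succ_iff.2 ⟨t, γ, δ ≫ β, hγ, ih hδ, (Category.assoc _ _ _).symm⟩

theorem HasLength.exists_comp {x z : E} {α : x ⟶ z} {m n : ℕ}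
    (hα : HasLength ⟨x, z, α⟩ (n + m)) : ∃ (y : E) (β : x ⟶ y) (γ : y ⟶ z),
      HasLength ⟨x, y, β⟩ m ∧ HasLength ⟨y, z, γ⟩ n ∧ β ≫ γ = α := by
  induction m generalizing x with
  | zero =>
    exact ⟨x, 𝟙 x, α, (hasLength_zero_iff _).2 (inferInstanceAs (IsIso (𝟙 x))), hα,
      Category.id_comp α⟩
  | succ m ih =>
    obtain ⟨t, β, γ, hβ, hγ, rfl⟩ := hasLength_succ_iff.1 hα
    obtain ⟨y, δ, ε, hδ, hε, rfl⟩ := ih hγ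
    exact ⟨y, β ≫ δ, ε, hasLength_succ_iff.2 ⟨t, β, δ, hβ, hδ, rfl⟩, hε, Category.assoc _ _ _⟩


namespace IsFiniteFreeEI

/-- The endomorphisms f ≫ g and g ≫ f are invertible, which makes f both split mono and split epi.
With skeletality, the existence of a morphism is therefore a partial order on objects. -/
theorem isIso_of_hom (hE : IsFiniteFreeEI E) {x y : E} (f : x ⟶ y) (g : y ⟶ x) : IsIso f := by
  have := hE.isIso_of_end x (f ≫ g)
  have := hE.isIso_of_end y (g ≫ f)
  have : IsSplitMono f := ⟨⟨⟨g ≫ inv (f ≫ g), by rw [← Category.assoc, IsIso.hom_inv_id]⟩⟩⟩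
  have : IsSplitEpi f := ⟨⟨⟨inv (g ≫ f) ≫ g, by rw [Category.assoc, IsIso.inv_hom_id]⟩⟩⟩
  exact isIso_of_epi_of_isSplitMono f

theorem eq_of_isIso (hE : IsFiniteFreeEI E) {x y : E} (f : x ⟶ y) [IsIso f] : x = y := hE.skeletal ⟨asIso f⟩

theorem eq_of_hom (hE : IsFiniteFreeEI E) {x y : E} (f : x ⟶ y) (g : y ⟶ x) : x = y :=
  have := hE.isIso_of_hom f g
  hE.eq_of_isIso f

theorem isIso_left (hE : IsFiniteFreeEI E) {x y z : E} (f : x ⟶ y) (g : y ⟶ z) [IsIso (f ≫ g)] : IsIso f :=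
  hE.isIso_of_hom f (g ≫ inv (f ≫ g))

theorem isIso_right (hE : IsFiniteFreeEI E) {x y z : E} (f : x ⟶ y) (g : y ⟶ z) [IsIso (f ≫ g)] : IsIso g :=
  hE.isIso_of_hom g (inv (f ≫ g) ≫ f)

theorem not_isIso_comp_left (hE : IsFiniteFreeEI E) {x y z : E} {f : x ⟶ y} (hf : ¬ IsIso f) (g : y ⟶ z) :
    ¬ IsIso (f ≫ g) := fun _ => hf (hE.isIso_left f g)

theorem not_isIso_comp_right (hE : IsFiniteFreeEI E) {x y z : E} (f : x ⟶ y) {g : y ⟶ z} (hg : ¬ IsIso g) :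
    ¬ IsIso (f ≫ g) := fun _ => hg (hE.isIso_right f g)

theorem not_isIso_of_uPath (hE : IsFiniteFreeEI E) {x y : E} (p : UPath x y) : ¬ IsIso p.comp := by
  cases p with
  | single α hα => exact hα.1
  | cons α hα p => exact hE.not_isIso_comp_left hα.1 _

theorem exists_uPath (hE : IsFiniteFreeEI E) {x y : E} (α : x ⟶ y) (hα : ¬ IsIso α) : ∃ p : UPath x y, p.comp = α := by
  have := hE.finite_obj
  -- Induction on the number of objects between source and target. In a proper factorization through
  -- z, the interval from x to z omits y and the one from z to y omits x.
  let d (x y : E) : ℕ := Set.ncard {z : E | Nonempty (x ⟶ z) ∧ Nonempty (z ⟶ y)}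
  induction hn : d x y using Nat.strong_induction_on generalizing x y with
  | _ n ih =>
    by_cases h : Unfactorizable α
    · exact ⟨.single α h, rfl⟩
    · have : ∃ (z : E) (β : x ⟶ z) (γ : z ⟶ y), β ≫ γ = α ∧ ¬ IsIso β ∧ ¬ IsIso γ := by
        by_contra! hc
        exact h ⟨hα, fun z β γ e => or_iff_not_imp_left.2 fun hβ => not_not.1 fun hγ =>
          hγ (hc z β γ e hβ)⟩
      obtain ⟨z, β, γ, rfl, hβ, hγ⟩ := this
      have h1 : d x z < n := by
        rw [← hn]
        refine Set.ncard_lt_ncard ⟨fun t ht => ⟨ht.1, ht.2.map (· ≫ γ)⟩, fun hs => ?_⟩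
          (Set.toFinite _)
        obtain ⟨-, ⟨g⟩⟩ := hs (show y ∈ _ from ⟨⟨β ≫ γ⟩, ⟨𝟙 y⟩⟩)
        exact hγ (hE.isIso_of_hom γ g)
      have h2 : d z y < n := by
        rw [← hn]
        refine Set.ncard_lt_ncard ⟨fun t ht => ⟨ht.1.map (β ≫ ·), ht.2⟩, fun hs => ?_⟩
          (Set.toFinite _)
        obtain ⟨⟨g⟩, -⟩ := hs (show x ∈ _ from ⟨⟨𝟙 x⟩, ⟨β ≫ γ⟩⟩)
        exact hβ (hE.isIso_of_hom β g)
      obtain ⟨p, rfl⟩ := ih _ h1 β hβ rfl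
      obtain ⟨q, rfl⟩ := ih _ h2 γ hγ rfl
      exact ⟨p.append q, p.append_comp q⟩

theorem exists_factor (hE : IsFiniteFreeEI E) {x y : E} (α : x ⟶ y) (hα : ¬ IsIso α) :
    ∃ (z : E) (β : x ⟶ z) (γ : z ⟶ y), Unfactorizable β ∧ β ≫ γ = α := by
  obtain ⟨p, rfl⟩ := hE.exists_uPath α hα
  cases p with
  | single β hβ => exact ⟨_, β, 𝟙 _, hβ, Category.comp_id β⟩
  | cons β hβ p => exact ⟨_, β, p.comp, hβ, rfl⟩

theorem uPath_length_eq (hE : IsFiniteFreeEI E) {x y : E} (p q : UPath x y) (h : p.comp = q.comp) :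
    p.length = q.length :=
  (hE.ufp x y _ (hE.not_isIso_of_uPath q) p q h rfl).length_eq

/-- The form in which unique factorization is used: the first unfactorizable factor is determined up
to an isomorphism of the middle object. It is the first rung of the ladder. If γ or γ' is invertible
there is no tail to decompose; it is then absorbed into the first factor and the lengths are
compared. -/
theorem exists_iso_of_comp_eq_comp (hE : IsFiniteFreeEI E) {x y z z' : E} {β : x ⟶ z} {γ : z ⟶ y} {β' : x ⟶ z'}
    {γ' : z' ⟶ y} (hβ : Unfactorizable β) (hβ' : Unfactorizable β') (h : β ≫ γ = β' ≫ γ') :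
    ∃ e : z ≅ z', β ≫ e.hom = β' ∧ γ = e.hom ≫ γ' := by
  by_cases hγ : IsIso γ
  · by_cases hγ' : IsIso γ'
    · exact ⟨asIso γ ≪≫ (asIso γ').symm, by simp [← Category.assoc, h], by simp⟩
    · obtain ⟨q, rfl⟩ := hE.exists_uPath γ' hγ'
      have := hE.uPath_length_eq (.single (β ≫ γ) (hβ.comp_isIso γ)) (.cons β' hβ' q) h
      have := q.length_pos
      simp [UPath.length] at *
      omega
  · obtain ⟨p, rfl⟩ := hE.exists_uPath γ hγ
    by_cases hγ' : IsIso γ'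
    · have := hE.uPath_length_eq (.cons β hβ p) (.single (β' ≫ γ') (hβ'.comp_isIso γ')) h
      have := p.length_pos
      simp [UPath.length] at *
      omega
    · obtain ⟨q, rfl⟩ := hE.exists_uPath γ' hγ'
      have l := hE.ufp x y _ (hE.not_isIso_of_uPath _) (.cons β hβ p) (.cons β' hβ' q) rfl h.symm
      cases l with
      | cons _ g _ _ _ _ _ _ comm tail =>
        exact ⟨g, by simpa using comm, tail.comp_eq⟩

/-! ### The length of a morphism -/


theorem exists_hasLength (hE : IsFiniteFreeEI E) (α : Mor E) : ∃ n, HasLength α n := by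
  by_cases h : IsIso α.hom
  · exact ⟨0, Or.inl ⟨rfl, h⟩⟩
  · obtain ⟨p, hp⟩ := hE.exists_uPath α.hom h
    exact ⟨p.length, Or.inr ⟨p, rfl, hp⟩⟩

theorem hasLength_unique (hE : IsFiniteFreeEI E) {α : Mor E} {m n : ℕ} (hm : HasLength α m) (hn : HasLength α n) :
    m = n := by
  obtain ⟨rfl, hi⟩ | ⟨p, rfl, hp⟩ := hm <;> obtain ⟨rfl, hi'⟩ | ⟨q, rfl, hq⟩ := hn
  · rfl
  · exact absurd (hq ▸ hi) (hE.not_isIso_of_uPath q)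
  · exact absurd (hp ▸ hi') (hE.not_isIso_of_uPath p)
  · exact hE.uPath_length_eq p q (hp.trans hq.symm)

theorem not_isIso_of_hasLength (hE : IsFiniteFreeEI E) {α : Mor E} {n : ℕ} (h : HasLength α (n + 1)) : ¬ IsIso α.hom := by
  intro hi
  have := hE.hasLength_unique h (Or.inl ⟨rfl, hi⟩)
  omega


end IsFiniteFreeEI

/-! ### Weights on orbits of morphisms -/

instance autFinite [∀ x y : E, Finite (x ⟶ y)] (y : E) : Finite (Aut y) :=
  Finite.of_injective (fun g : Aut y => g.hom) fun _ _ h => Iso.ext h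

instance autFintype [∀ x y : E, Finite (x ⟶ y)] (y : E) : Fintype (Aut y) := Fintype.ofFinite _

/-- Pointwise existing weights on the orbits of a finite group can be chosen uniformly. -/
theorem exists_uniform_weight {k G X : Type*} [Field k] [Group G] [Fintype G] [MulAction G X] :
    ∃ f : X → k, ∀ β : X, (∃ f₀ : X → k, ∑ g : G, f₀ (g • β) = 1) → ∑ g : G, f (g • β) = 1 := by
  classical
  let F (β : X) : X → k := if h : ∃ f₀ : X → k, ∑ g : G, f₀ (g • β) = 1 then h.choose else 0
  -- At each point, use the weight chosen for the representative of its orbit; it does not change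
  -- along the orbit.
  let r (β : X) : X := Quotient.out (s := MulAction.orbitRel G X) (Quotient.mk _ β)
  refine ⟨fun β => F (r β) β, fun β hβ => ?_⟩
  have hr (g : G) : r (g • β) = r β := by
    have : (Quotient.mk (MulAction.orbitRel G X) (g • β)) = Quotient.mk _ β :=
      Quotient.sound (MulAction.mem_orbit β g)
    simp only [r, this]
  obtain ⟨h, hh⟩ : ∃ h : G, h • β = r β := Quotient.mk_out (s := MulAction.orbitRel G X) β
  have hs (f : X → k) : ∑ g : G, f (g • r β) = ∑ g : G, f (g • β) := by
    rw [← hh]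
    exact Fintype.sum_equiv (Equiv.mulRight h) _ _ fun g => by simp [mul_smul]
  have hex : ∃ f₀ : X → k, ∑ g : G, f₀ (g • r β) = 1 := hβ.imp fun f hf => (hs f).trans hf
  simp only [hr]
  rw [← hs]
  simp only [F, dif_pos hex]
  exact hex.choose_spec

/-- There is a function whose sum over the `Aut y`-orbit of `β` (with multiplicities) is `1`;
that is, the order of the stabilizer of `β` in `Aut y` is invertible in `k`. -/
def IsWeighted [∀ x y : E, Finite (x ⟶ y)] (k : Type*) [Field k] {x y : E} (β : x ⟶ y) : Prop :=
  ∃ f : (x ⟶ y) → k, ∑ g : Aut y, f (g • β) = 1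

/-- An isomorphism has trivial stabilizer, so the indicator function of α is a weight. -/
theorem isWeighted_of_isIso [∀ x y : E, Finite (x ⟶ y)] (k : Type*) [Field k] {x y : E}
    (α : x ⟶ y) [IsIso α] : IsWeighted k α := by
  classical
  refine ⟨fun δ => if δ = α then 1 else 0, ?_⟩
  rw [Finset.sum_eq_single 1 (fun g _ hg => if_neg fun h => hg ?_)
    fun h => absurd (Finset.mem_univ _) h]
  · simp
  · refine Iso.ext ?_
    rw [← cancel_epi α]
    exact h.trans (Category.comp_id α).symm

/-- If all unfactorizable morphisms are weighted, so are all morphisms. -/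
theorem IsFiniteFreeEI.isWeighted (hE : IsFiniteFreeEI E) [∀ x y : E, Finite (x ⟶ y)] {k : Type*}
    [Field k] (hw : ∀ (x y : E) (β : x ⟶ y), Unfactorizable β → IsWeighted k β) {x y : E}
    (α : x ⟶ y) : IsWeighted k α := by
  classical
  obtain ⟨n, hn⟩ := hE.exists_hasLength ⟨x, y, α⟩
  induction n generalizing x with
  | zero =>
    have : IsIso α := (hasLength_zero_iff _).1 hn
    exact isWeighted_of_isIso k α
  | succ n ih =>
    obtain ⟨z, β, γ, hβ, hγ, rfl⟩ := hasLength_succ_iff.1 hn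
    obtain ⟨f, hf⟩ := hw _ _ β hβ
    obtain ⟨f', hf'⟩ := exists_uniform_weight (k := k) (G := Aut y) (X := z ⟶ y)
    have hf' (h : Aut z) : ∑ g : Aut y, f' (g • (h⁻¹.hom ≫ γ)) = 1 :=
      hf' _ (ih (h⁻¹.hom ≫ γ)
        (HasLength.comp (m := 0) ((hasLength_zero_iff _).2 (Iso.isIso_hom (h⁻¹ : Aut z))) hγ))
    -- The candidate weight at β ≫ γ' combines a weight of β with the weights of the tails h⁻¹ ≫ γ'.
    -- It depends only on the composite: another tail differs by an element fixing β, which is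
    -- absorbed by reindexing h. Summing over Aut(y) first leaves the sum of f over the orbit of β.
    let F (γ' : z ⟶ y) : k := ∑ h : Aut z, f (h • β) * f' (h⁻¹.hom ≫ γ')
    have hF (γ' γ'' : z ⟶ y) (h : β ≫ γ' = β ≫ γ'') : F γ' = F γ'' := by
      obtain ⟨e, h1, rfl⟩ : ∃ e : Aut z, e • β = β ∧ γ' = e.hom ≫ γ'' :=
        hE.exists_iso_of_comp_eq_comp hβ hβ h
      refine Fintype.sum_equiv (Equiv.mulRight e⁻¹) _ _ fun h => ?_
      have h2 : e⁻¹ • β = β := by rw [inv_smul_eq_iff, h1]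
      have h3 : ((h * e⁻¹)⁻¹ : Aut z).hom ≫ γ'' = h⁻¹.hom ≫ e.hom ≫ γ'' := by
        rw [mul_inv_rev, inv_inv, aut_mul_hom, Category.assoc]
      rw [Equiv.coe_mulRight, mul_smul, h2, h3]
    refine ⟨fun δ => if h : ∃ γ' : z ⟶ y, β ≫ γ' = δ then F h.choose else 0, ?_⟩
    have key (g : Aut y) : (if h : ∃ γ' : z ⟶ y, β ≫ γ' = g • (β ≫ γ) then F h.choose else 0) =
        F (g • γ) := by
      have h : ∃ γ' : z ⟶ y, β ≫ γ' = g • (β ≫ γ) := ⟨g • γ, (Category.assoc _ _ _).symm⟩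
      rw [dif_pos h]
      exact hF _ _ (h.choose_spec.trans (Category.assoc _ _ _))
    simp only [key, F]
    rw [Finset.sum_comm, ← hf]
    refine Finset.sum_congr rfl fun h _ => ?_
    rw [← Finset.mul_sum]
    simp only [aut_smul_def] at hf' ⊢
    simp only [← Category.assoc, hf', mul_one]

end Combinatorics

/-! ### Recognizing internal direct sums. -/

section Linear

variable {k : Type*} [Field k] {M : Type*} [AddCommGroup M] [Module k M] {N : Type*}
  [AddCommGroup N] [Module k N]

/-- A family of subspaces which is separated by linear maps and spans the whole space is an
internal direct sum decomposition. -/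
theorem isInternal_of_separating {ι : Type*} [DecidableEq ι] (ℳ : ι → Submodule k M)
    (π : ι → M →ₗ[k] N) (hinj : ∀ j, ∀ x ∈ ℳ j, π j x = 0 → x = 0)
    (hzero : ∀ i j, i ≠ j → ∀ x ∈ ℳ i, π j x = 0) (htop : ∀ x, x ∈ ⨆ i, ℳ i) :
    DirectSum.IsInternal ℳ := by
  refine (DirectSum.isInternal_submodule_iff_iSupIndep_and_iSup_eq_top _).2
    ⟨fun j => ?_, eq_top_iff.2 fun x _ => htop x⟩
  rw [Submodule.disjoint_def]
  intro x hx hx'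
  refine hinj j x hx ?_
  have : ⨆ i, ⨆ (_ : i ≠ j), ℳ i ≤ LinearMap.ker (π j) :=
    iSup₂_le fun i hi y hy => hzero i j hi y hy
  exact this hx'

end Linear

/-! ### Decomposition into primitive idempotents. -/

section Idempotents

variable {B : Type*} [Ring B]

/-- In a finite-dimensional algebra each idempotent is a sum of primitive idempotents. -/
theorem exists_primitive_decomposition (k : Type*) [Field k] [Algebra k B] [Module.Finite k B]
    (e : B) (he : IsIdempotentElem e) :
    ∃ (n : ℕ) (f : Fin n → B), (∀ i, IsPrimitiveIdem (f i) ∧ e * f i = f i ∧ f i * e = f i) ∧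
      ∑ i, f i = e := by
  -- Induction on dim Be. If e = f + g is an orthogonal decomposition with g ≠ 0, then Bf is
  -- strictly smaller, since g lies in Be, and g ∈ Bf would give g = gf = 0.
  induction hn : Module.finrank k (LinearMap.range (LinearMap.mulRight k e))
    using Nat.strong_induction_on generalizing e with
  | _ n ih =>
    by_cases h0 : e = 0
    · exact ⟨0, Fin.elim0, fun i => i.elim0, by simp [h0]⟩
    by_cases hp : IsPrimitiveIdem e
    · exact ⟨1, fun _ => e, fun _ => ⟨hp, he, he⟩, by simp⟩
    have hs : ∃ f g : B, IsIdempotentElem f ∧ IsIdempotentElem g ∧ f * g = 0 ∧ g * f = 0 ∧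
        f + g = e ∧ f ≠ 0 ∧ g ≠ 0 := by
      by_contra! hc
      exact hp ⟨he, h0, fun f g hf hg hfg hgf h => or_iff_not_imp_left.2 fun hf0 =>
        hc f g hf hg hfg hgf h hf0⟩
    have step (f g : B) (hf : IsIdempotentElem f) (hg : IsIdempotentElem g) (hfg : f * g = 0)
        (hgf : g * f = 0) (h : f + g = e) (hg0 : g ≠ 0) :
        Module.finrank k (LinearMap.range (LinearMap.mulRight k f)) < n := by
      rw [← hn]
      refine Submodule.finrank_lt_finrank_of_lt (lt_of_le_of_ne ?_ fun heq => hg0 ?_)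
      · rintro _ ⟨b, rfl⟩
        exact ⟨b * f, by simp [← h, mul_add, mul_assoc, hf.eq, hfg]⟩
      · obtain ⟨b, hb⟩ : g ∈ LinearMap.range (LinearMap.mulRight k f) := by
          rw [heq]
          exact ⟨g, by simp [← h, mul_add, hg.eq, hgf]⟩
        have hb : b * f = g := hb
        rw [← hb, ← hf.eq, ← mul_assoc, hb, hgf]
    obtain ⟨f, g, hf, hg, hfg, hgf, h, hf0, hg0⟩ := hs
    obtain ⟨n₁, s, hs, hs'⟩ := ih _ (step f g hf hg hfg hgf h hg0) f hf rfl
    obtain ⟨n₂, t, ht, ht'⟩ := ih _ (step g f hg hf hgf hfg (by rw [add_comm, h]) hf0) g hg rfl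
    have hef : e * f = f := by rw [← h, add_mul, hf.eq, hgf, add_zero]
    have hfe : f * e = f := by rw [← h, mul_add, hf.eq, hfg, add_zero]
    have heg : e * g = g := by rw [← h, add_mul, hg.eq, hfg, zero_add]
    have hge : g * e = g := by rw [← h, mul_add, hg.eq, hgf, zero_add]
    refine ⟨n₁ + n₂, Fin.append s t, fun i => ?_, ?_⟩
    · refine Fin.addCases (fun i => ?_) (fun i => ?_) i
      · rw [Fin.append_left]
        refine ⟨(hs i).1, ?_, ?_⟩
        · rw [← (hs i).2.1, ← mul_assoc, hef]
        · rw [← (hs i).2.2, mul_assoc, hfe]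
      · rw [Fin.append_right]
        refine ⟨(ht i).1, ?_, ?_⟩
        · rw [← (ht i).2.1, ← mul_assoc, heg]
        · rw [← (ht i).2.2, mul_assoc, hge]
    · rw [Fin.sum_univ_add]
      simp [hs', ht', h]

end Idempotents

/-! ### Calculus in the category algebra: coefficients, spans of morphisms, left ideals. -/

section CategoryAlgebra

namespace CatAlg

variable {k : Type w} [Field k] {E : Type u} [Category.{v} E]

/-- A morphism `x ⟶ y` as an element of the category algebra. -/
def ofHom (k : Type w) [Field k] {x y : E} (f : x ⟶ y) : CatAlg k E := of k ⟨x, y, f⟩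

theorem of_eq_ofHom (α : Mor E) : of k α = ofHom k α.hom := rfl

theorem idem_eq_ofHom (x : E) : idem k x = ofHom k (𝟙 x) := rfl

theorem ofHom_mul_ofHom {x y z : E} (f : x ⟶ y) (g : y ⟶ z) :
    ofHom k g * ofHom k f = ofHom k (f ≫ g) := by
  rw [ofHom, ofHom, of_mul_of, basisMul, dif_pos rfl]
  simp [ofHom]

theorem ofHom_mul_ofHom_of_ne {x y y' z : E} (f : x ⟶ y) (g : y' ⟶ z) (h : y ≠ y') :
    ofHom k g * ofHom k f = 0 := by
  rw [ofHom, ofHom, of_mul_of, basisMul, dif_neg h]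

theorem idem_mul_ofHom {x y : E} (f : x ⟶ y) : idem k y * ofHom k f = ofHom k f := by
  rw [idem_eq_ofHom, ofHom_mul_ofHom, Category.comp_id]

theorem ofHom_mul_idem {x y : E} (f : x ⟶ y) : ofHom k f * idem k x = ofHom k f := by
  rw [idem_eq_ofHom, ofHom_mul_ofHom, Category.id_comp]

theorem idem_mul_idem (x : E) : idem k x * idem k x = idem k x := idem_mul_ofHom _

theorem sum_idem [Fintype E] : ∑ x : E, idem k x = (1 : CatAlg k E) := rfl

/-- The coefficient of a morphism. -/
def coeff (α : Mor E) : CatAlg k E →ₗ[k] k := Finsupp.lapply (M := k) (R := k) α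

theorem coeff_of [DecidableEq (Mor E)] (α β : Mor E) :
    coeff α (of k β) = if α = β then 1 else 0 := by
  change (Finsupp.single β (1 : k)) α = _
  rw [Finsupp.single_apply]
  simp only [eq_comm]

theorem coeff_of_self (α : Mor E) : coeff α (of k α) = 1 := by
  classical
  rw [coeff_of, if_pos rfl]

theorem coeff_of_ne {α β : Mor E} (h : α ≠ β) : coeff α (of k β) = 0 := by
  classical
  rw [coeff_of, if_neg h]

theorem ext_coeff {f g : CatAlg k E} (h : ∀ α, coeff α f = coeff α g) : f = g :=
  Finsupp.ext h

variable {M : Type*} [AddCommGroup M] [Module k M]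

/-- The linear extension of a function on morphisms. -/
def lift (f : Mor E → M) : CatAlg k E →ₗ[k] M :=
  (Finsupp.linearCombination k f : (Mor E →₀ k) →ₗ[k] M)

theorem lift_of (f : Mor E → M) (α : Mor E) : lift f (of k α) = f α := by
  change Finsupp.linearCombination k f (Finsupp.single α 1) = _
  simp

/-- The subspace spanned by a set of morphisms. -/
def spanOf (k : Type w) [Field k] (S : Set (Mor E)) : Submodule k (CatAlg k E) :=
  Submodule.span k (of k '' S)

theorem mem_spanOf_iff {S : Set (Mor E)} {f : CatAlg k E} :
    f ∈ spanOf k S ↔ ∀ α ∉ S, coeff α f = 0 := by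
  have : spanOf k S = Finsupp.supported k k S := (Finsupp.supported_eq_span_single k S).symm
  rw [this]
  exact Finsupp.mem_supported' _ _

theorem of_mem_spanOf {S : Set (Mor E)} {α : Mor E} (h : α ∈ S) : of k α ∈ spanOf k S :=
  Submodule.subset_span ⟨α, h, rfl⟩

theorem of_mem_spanOf_iff {S : Set (Mor E)} {α : Mor E} : of k α ∈ spanOf k S ↔ α ∈ S :=
  ⟨fun h => by_contra fun hα => one_ne_zero ((coeff_of_self α).symm.trans
    (mem_spanOf_iff.1 h α hα)), of_mem_spanOf⟩

theorem spanOf_induction {S : Set (Mor E)} {p : CatAlg k E → Prop} {f : CatAlg k E}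
    (hf : f ∈ spanOf k S) (hof : ∀ α ∈ S, p (of k α)) (hzero : p 0)
    (hadd : ∀ f g, p f → p g → p (f + g)) (hsmul : ∀ (r : k) f, p f → p (r • f)) : p f := by
  refine Submodule.span_induction (p := fun f _ => p f) ?_ hzero
    (fun f g _ _ => hadd f g) (fun r f _ => hsmul r f) hf
  rintro _ ⟨α, hα, rfl⟩
  exact hof α hα

theorem induction_of {p : CatAlg k E → Prop} (f : CatAlg k E) (hof : ∀ α, p (of k α))
    (hzero : p 0) (hadd : ∀ f g, p f → p g → p (f + g)) (hsmul : ∀ (r : k) f, p f → p (r • f)) :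
    p f :=
  CatAlg.induction f hzero hadd fun r α => hsmul r _ (hof α)

open Classical in
/-- The projection onto the subspace spanned by a set of morphisms. -/
def proj (k : Type w) [Field k] (S : Set (Mor E)) : CatAlg k E →ₗ[k] CatAlg k E :=
  lift fun α => if α ∈ S then of k α else 0

theorem proj_of_mem {S : Set (Mor E)} {α : Mor E} (h : α ∈ S) : proj k S (of k α) = of k α := by
  rw [proj, lift_of, if_pos h]

theorem proj_of_notMem {S : Set (Mor E)} {α : Mor E} (h : α ∉ S) : proj k S (of k α) = 0 := by
  rw [proj, lift_of, if_neg h]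

theorem proj_eq_self {S : Set (Mor E)} {f : CatAlg k E} (h : f ∈ spanOf k S) : proj k S f = f :=
  spanOf_induction (p := fun f => proj k S f = f) h (fun _ hα => proj_of_mem hα) (map_zero _)
    (fun f g hf hg => by rw [map_add, hf, hg]) (fun r f hf => by rw [map_smul, hf])

theorem proj_eq_zero {S T : Set (Mor E)} (hST : Disjoint S T) {f : CatAlg k E}
    (h : f ∈ spanOf k T) : proj k S f = 0 :=
  spanOf_induction (p := fun f => proj k S f = 0) h (fun _ hα => proj_of_notMem fun hS => Set.disjoint_left.1 hST hS hα)
    (map_zero _) (fun f g hf hg => by rw [map_add, hf, hg, add_zero])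
    (fun r f hf => by rw [map_smul, hf, smul_zero])

theorem proj_mem {S T : Set (Mor E)} {f : CatAlg k E} (h : f ∈ spanOf k T) :
    proj k S f ∈ spanOf k (S ∩ T) :=
  spanOf_induction (p := fun f => proj k S f ∈ spanOf k (S ∩ T)) h (fun α hα => by
    by_cases hS : α ∈ S
    · rw [proj_of_mem hS]
      exact of_mem_spanOf ⟨hS, hα⟩
    · rw [proj_of_notMem hS]
      exact zero_mem _) (by simp)
    (fun f g hf hg => by rw [map_add]; exact add_mem hf hg)
    (fun r f hf => by rw [map_smul]; exact Submodule.smul_mem _ _ hf)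

theorem mem_spanOf_univ (f : CatAlg k E) : f ∈ spanOf k (Set.univ : Set (Mor E)) :=
  mem_spanOf_iff.2 fun _ h => absurd (Set.mem_univ _) h

theorem sub_proj_mem {S : Set (Mor E)} (f : CatAlg k E) : f - proj k S f ∈ spanOf k Sᶜ := by
  classical
  induction f using induction_of with
  | hof α =>
    by_cases hS : α ∈ S
    · rw [proj_of_mem hS, sub_self]
      exact zero_mem _
    · rw [proj_of_notMem hS, sub_zero]
      exact of_mem_spanOf hS
  | hzero => simp
  | hadd f g hf hg => rw [map_add, add_sub_add_comm]; exact add_mem hf hg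
  | hsmul r f hf => rw [map_smul, ← smul_sub]; exact Submodule.smul_mem _ _ hf

/-- The action of `Aut y` through the category algebra. -/
def autHom (k : Type w) [Field k] (y : E) : Aut y →ₙ* CatAlg k E where
  toFun g := ofHom k g.hom
  map_mul' _ _ := (ofHom_mul_ofHom _ _).symm

theorem autHom_apply (y : E) (g : Aut y) : autHom k y g = ofHom k g.hom := rfl

theorem autHom_one (y : E) : autHom k y 1 = idem k y := rfl

theorem autHom_mul_ofHom {x y : E} (g : Aut y) (f : x ⟶ y) :
    autHom k y g * ofHom k f = ofHom k (g • f) := ofHom_mul_ofHom _ _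

variable [Fintype E]

/-- The left ideal spanned by a set of morphisms closed under composition from the left. -/
def leftIdeal (k : Type w) [Field k] (S : Set (Mor E))
    (hS : ∀ (x y z : E) (f : x ⟶ y) (g : y ⟶ z), (⟨x, y, f⟩ : Mor E) ∈ S → ⟨x, z, f ≫ g⟩ ∈ S) :
    Submodule (CatAlg k E) (CatAlg k E) where
  carrier := spanOf k S
  add_mem' := add_mem
  zero_mem' := zero_mem _
  smul_mem' c f hf := by
    rw [smul_eq_mul]
    induction c using induction_of with
    | hof γ =>
      refine spanOf_induction (p := fun f => of k γ * f ∈ spanOf k S) hf (fun α hα => ?_) (by simp)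
        (fun f g hf hg => by rw [mul_add]; exact add_mem hf hg)
        (fun r f hf => by rw [CatAlg.mul_smul]; exact Submodule.smul_mem _ _ hf)
      obtain ⟨x, y, f⟩ := α
      obtain ⟨y', z, g⟩ := γ
      by_cases h : y = y'
      · subst h
        rw [of_eq_ofHom, of_eq_ofHom, ofHom_mul_ofHom]
        exact of_mem_spanOf (hS _ _ _ _ _ hα)
      · rw [of_eq_ofHom, of_eq_ofHom, ofHom_mul_ofHom_of_ne _ _ h]
        exact zero_mem _
    | hzero => simp
    | hadd c d hc hd => rw [add_mul]; exact add_mem hc hd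
    | hsmul r c hc => rw [CatAlg.smul_mul]; exact Submodule.smul_mem _ _ hc

theorem mem_leftIdeal {S : Set (Mor E)} {hS} {f : CatAlg k E} :
    f ∈ leftIdeal k S hS ↔ f ∈ spanOf k S := Iff.rfl

end CatAlg

end CategoryAlgebra

/-! ### The length grading and the nilpotent ideal J. -/

section Grading

open CatAlg

variable {k : Type w} [Field k] {E : Type u} [Category.{v} E]

instance finite_mor [Finite E] [∀ x y : E, Finite (x ⟶ y)] : Finite (Mor E) :=
  Finite.of_injective (β := Σ (x : E) (y : E), x ⟶ y) (fun α => ⟨α.src, α.tgt, α.hom⟩) (by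
    rintro ⟨x, y, f⟩ ⟨x', y', f'⟩ h
    simp only [Sigma.mk.injEq] at h
    obtain ⟨rfl, h⟩ := h
    simp only [heq_eq_eq, Sigma.mk.injEq] at h
    obtain ⟨rfl, h⟩ := h
    simp only [heq_eq_eq] at h
    rw [h])

instance finite_catAlg [Finite E] [∀ x y : E, Finite (x ⟶ y)] : Module.Finite k (CatAlg k E) :=
  inferInstanceAs (Module.Finite k (Mor E →₀ k))

variable (E) in
/-- The set of morphisms which are not isomorphisms. -/
def nonIso : Set (Mor E) := {α | ¬ IsIso α.hom}

theorem lengthGrading_eq (n : ℕ) : lengthGrading k E n = spanOf k {α | HasLength α n} := rfl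

theorem lengthGrading_mul [Fintype E] (i j : ℕ) :
    lengthGrading k E i * lengthGrading k E j = lengthGrading k E (i + j) := by
  apply le_antisymm
  · rw [Submodule.mul_le]
    intro f hf g hg
    rw [lengthGrading_eq] at *
    refine spanOf_induction (p := fun f => f * g ∈ _) hf (fun β hβ => ?_) (by simp)
      (fun f f' h h' => by rw [add_mul]; exact add_mem h h')
      (fun r f h => by rw [CatAlg.smul_mul]; exact Submodule.smul_mem _ _ h)
    refine spanOf_induction (p := fun g => of k β * g ∈ _) hg (fun α hα => ?_) (by simp)
      (fun f f' h h' => by rw [mul_add]; exact add_mem h h')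
      (fun r f h => by rw [CatAlg.mul_smul]; exact Submodule.smul_mem _ _ h)
    obtain ⟨x, y, f⟩ := α
    obtain ⟨y', z, g⟩ := β
    by_cases h : y = y'
    · subst h
      rw [of_eq_ofHom, of_eq_ofHom, ofHom_mul_ofHom]
      exact of_mem_spanOf (HasLength.comp hα hβ)
    · rw [of_eq_ofHom, of_eq_ofHom, ofHom_mul_ofHom_of_ne _ _ h]
      exact zero_mem _
  · refine Submodule.span_le.2 ?_
    rintro _ ⟨⟨x, z, f⟩, hα, rfl⟩
    obtain ⟨y, β, γ, hβ, hγ, rfl⟩ := HasLength.exists_comp hα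
    rw [of_eq_ofHom]
    dsimp only
    rw [← ofHom_mul_ofHom]
    exact Submodule.mul_mem_mul (of_mem_spanOf hγ) (of_mem_spanOf hβ)

namespace IsFiniteFreeEI

variable (hE : IsFiniteFreeEI E)
include hE

theorem disjoint_length {i j : ℕ} (h : i ≠ j) :
    Disjoint {α : Mor E | HasLength α i} {α : Mor E | HasLength α j} :=
  Set.disjoint_left.2 fun _ h1 h2 => h (hE.hasLength_unique h1 h2)

theorem mem_iSup_lengthGrading (f : CatAlg k E) : f ∈ ⨆ n, lengthGrading k E n := by
  induction f using induction_of with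
  | hof α =>
    obtain ⟨n, hn⟩ := hE.exists_hasLength α
    exact Submodule.mem_iSup_of_mem n (of_mem_spanOf hn)
  | hzero => exact zero_mem _
  | hadd f g hf hg => exact add_mem hf hg
  | hsmul r f hf => exact Submodule.smul_mem _ _ hf

theorem nonIso_comp (x y z : E) (f : x ⟶ y) (g : y ⟶ z) (h : (⟨x, y, f⟩ : Mor E) ∈ nonIso E) :
    (⟨x, z, f ≫ g⟩ : Mor E) ∈ nonIso E := hE.not_isIso_comp_left h g

variable [Fintype E]

theorem isInternal_lengthGrading : DirectSum.IsInternal (lengthGrading k E) :=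
  isInternal_of_separating _ (fun j => proj k {α | HasLength α j})
    (fun j x hx h => by rw [← proj_eq_self hx, h])
    (fun i j h x hx => proj_eq_zero (hE.disjoint_length h.symm) hx) hE.mem_iSup_lengthGrading

theorem isStandardGraded : IsStandardGraded (lengthGrading k E) where
  internal := hE.isInternal_lengthGrading
  one_mem := by
    rw [← sum_idem]
    exact sum_mem fun x _ => of_mem_spanOf
      ((hasLength_zero_iff _).2 (inferInstanceAs (IsIso (𝟙 x))))
  mul_eq := lengthGrading_mul
  finite i := by
    have := hE.finite_hom
    infer_instance

theorem positivePart_eq :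
    positivePart (lengthGrading k E) = leftIdeal k (nonIso E) hE.nonIso_comp := by
  apply le_antisymm
  · refine Submodule.span_le.2 (Set.iUnion_subset fun i f hf => ?_)
    exact Submodule.span_mono (Set.image_mono fun α hα => hE.not_isIso_of_hasLength hα) hf
  · intro f hf
    refine spanOf_induction (p := fun f => f ∈ positivePart (lengthGrading k E)) hf
      (fun α hα => ?_) (zero_mem _) (fun _ _ => add_mem)
      (fun r f h => Submodule.smul_of_tower_mem _ r h)
    obtain ⟨n, hn⟩ := hE.exists_hasLength α
    cases n with
    | zero => exact absurd ((hasLength_zero_iff _).1 hn) hα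
    | succ n => exact Submodule.subset_span (Set.mem_iUnion.2 ⟨n, of_mem_spanOf hn⟩)

theorem mem_positivePart_iff {f : CatAlg k E} :
    f ∈ positivePart (lengthGrading k E) ↔ f ∈ spanOf k (nonIso E) := by
  rw [hE.positivePart_eq, mem_leftIdeal]

theorem ofHom_mem_positivePart_iff {x y : E} {α : x ⟶ y} :
    ofHom k α ∈ positivePart (lengthGrading k E) ↔ ¬ IsIso α := by
  rw [hE.mem_positivePart_iff]
  exact of_mem_spanOf_iff

theorem mul_mem_positivePart {f : CatAlg k E} (hf : f ∈ positivePart (lengthGrading k E))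
    (g : CatAlg k E) : f * g ∈ positivePart (lengthGrading k E) := by
  rw [hE.mem_positivePart_iff] at *
  induction g using induction_of with
  | hof α =>
    refine spanOf_induction (p := fun f => f * of k α ∈ _) hf (fun β hβ => ?_) (by simp)
      (fun f f' h h' => by rw [add_mul]; exact add_mem h h')
      (fun r f h => by rw [CatAlg.smul_mul]; exact Submodule.smul_mem _ _ h)
    obtain ⟨x, y, f⟩ := α
    obtain ⟨y', z, g⟩ := β
    by_cases h : y = y'
    · subst h
      rw [of_eq_ofHom, of_eq_ofHom, ofHom_mul_ofHom]
      exact of_mem_spanOf (hE.not_isIso_comp_right f hβ)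
    · rw [of_eq_ofHom, of_eq_ofHom, ofHom_mul_ofHom_of_ne _ _ h]
      exact zero_mem _
  | hzero => simp
  | hadd c d hc hd => rw [mul_add]; exact add_mem hc hd
  | hsmul r c hc => rw [CatAlg.mul_smul]; exact Submodule.smul_mem _ _ hc

/-- Lengths add under composition, so the n-th power is supported on lengths at least n, while the
finitely many morphisms have bounded length. -/
theorem isNilpotent_of_mem_positivePart {f : CatAlg k E}
    (hf : f ∈ positivePart (lengthGrading k E)) : IsNilpotent f := by
  have := hE.finite_hom
  rw [hE.mem_positivePart_iff] at hf
  choose l hl using fun α : Mor E => hE.exists_hasLength α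
  obtain ⟨N, hN⟩ := (Set.finite_range l).bddAbove
  have hpow (n : ℕ) : f ^ n ∈ spanOf k {α : Mor E | n ≤ l α} := by
    induction n with
    | zero => simpa using mem_spanOf_univ (1 : CatAlg k E)
    | succ n ih =>
      rw [pow_succ]
      refine spanOf_induction (p := fun g => f ^ n * g ∈ _) hf (fun α hα => ?_) (by simp)
        (fun f f' h h' => by rw [mul_add]; exact add_mem h h')
        (fun r f h => by rw [CatAlg.mul_smul]; exact Submodule.smul_mem _ _ h)
      refine spanOf_induction (p := fun g => g * of k α ∈ _) ih (fun β hβ => ?_) (by simp)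
        (fun f f' h h' => by rw [add_mul]; exact add_mem h h')
        (fun r f h => by rw [CatAlg.smul_mul]; exact Submodule.smul_mem _ _ h)
      have hα0 : l α ≠ 0 := fun h0 => hα ((hasLength_zero_iff _).1 (h0 ▸ hl α))
      obtain ⟨x, y, f⟩ := α
      obtain ⟨y', z, g⟩ := β
      by_cases h : y = y'
      · subst h
        rw [of_eq_ofHom, of_eq_ofHom, ofHom_mul_ofHom]
        refine of_mem_spanOf ?_
        have h1 := hE.hasLength_unique (hl _) (HasLength.comp (hl _) (hl _) :
          HasLength ⟨x, z, f ≫ g⟩ _)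
        have h2 : n ≤ l ⟨y, z, g⟩ := hβ
        simp only [Set.mem_ofPred_eq, h1]
        omega
      · rw [of_eq_ofHom, of_eq_ofHom, ofHom_mul_ofHom_of_ne _ _ h]
        exact zero_mem _
  refine ⟨N + 1, ext_coeff fun α => ?_⟩
  rw [map_zero]
  refine mem_spanOf_iff.1 (hpow (N + 1)) α fun h => ?_
  have := hN ⟨α, rfl⟩
  have h : N + 1 ≤ l α := h
  omega

end IsFiniteFreeEI

end Grading

/-! ### Projectivity of J from invertible stabilizer orders. -/

section Projectivity

open CatAlg

variable {k : Type w} [Field k] {E : Type u} [Category.{v} E] [Fintype E]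

namespace IsFiniteFreeEI

variable (hE : IsFiniteFreeEI E)
include hE

/-- An A-linear splitting of the map from the free module on all morphisms. A single choice of
factorization β ≫ γ would not be canonical, so the splitting averages over the factorizations (gβ,
g⁻¹ ≫ γ), which all have the same composite; the weights make the total coefficient 1. The
isomorphism components vanish, so only generators lying in J matter. -/
theorem exists_section_positivePart [∀ x y : E, Finite (x ⟶ y)]
    (hw : ∀ (x y : E) (β : x ⟶ y), Unfactorizable β → IsWeighted k β) :
    ∃ S : CatAlg k E →ₗ[k] Mor E →₀ CatAlg k E,
      (∀ c, ∀ f ∈ positivePart (lengthGrading k E), S (c * f) = c • S f) ∧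
      (∀ f, ∀ α : Mor E, IsIso α.hom → S f α = 0) ∧
      ∀ f ∈ positivePart (lengthGrading k E), Finsupp.linearCombination _ (of k) (S f) = f := by
  classical
  choose W hW using fun x y : E => exists_uniform_weight (k := k) (G := Aut y) (X := x ⟶ y)
  let T {x y z : E} (β : x ⟶ z) (γ : z ⟶ y) : Mor E →₀ CatAlg k E :=
    ∑ g : Aut z, W x z (g • β) • Finsupp.single ⟨x, z, g • β⟩ (ofHom k (g⁻¹.hom ≫ γ))
  have hT {x y z z' : E} {β : x ⟶ z} {γ : z ⟶ y} {β' : x ⟶ z'} {γ' : z' ⟶ y}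
      -- Two factorizations of the same composite differ by an automorphism e of the middle object,
      -- and g ↦ ge⁻¹ matches the two sums. This independence gives linearity from the left.
      (hβ : Unfactorizable β) (hβ' : Unfactorizable β') (h : β ≫ γ = β' ≫ γ') :
      T β γ = T β' γ' := by
    obtain ⟨e, he⟩ := hE.exists_iso_of_comp_eq_comp hβ hβ' h
    obtain rfl : z = z' := hE.skeletal ⟨e⟩
    obtain ⟨e, rfl, rfl⟩ : ∃ e : Aut z, e • β = β' ∧ γ = e.hom ≫ γ' := ⟨e, he⟩
    refine Fintype.sum_equiv (Equiv.mulRight e⁻¹) _ _ fun g => ?_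
    have h3 : ((g * e⁻¹)⁻¹ : Aut z).hom ≫ γ' = g⁻¹.hom ≫ e.hom ≫ γ' := by
      rw [mul_inv_rev, inv_inv, aut_mul_hom, Category.assoc]
    rw [Equiv.coe_mulRight, h3, smul_smul, inv_mul_cancel_right]
  have hfac (α : Mor E) (h : ¬ IsIso α.hom) := hE.exists_factor α.hom h
  choose fz fβ fγ hfβ hfβγ using hfac
  let S : CatAlg k E →ₗ[k] Mor E →₀ CatAlg k E :=
    CatAlg.lift fun α => if h : IsIso α.hom then 0 else T (fβ α h) (fγ α h)
  have hS0 (α : Mor E) (h : IsIso α.hom) : S (of k α) = 0 := by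
    rw [CatAlg.lift_of, dif_pos h]
  have hS {x y z : E} (β : x ⟶ z) (γ : z ⟶ y) (hβ : Unfactorizable β) :
      S (ofHom k (β ≫ γ)) = T β γ := by
    have h := hE.not_isIso_comp_left hβ.1 γ
    rw [ofHom, CatAlg.lift_of, dif_neg h]
    exact hT (hfβ _ h) hβ (hfβγ _ h)
  have hsm (c d : CatAlg k E) (r : k) (α : Mor E) :
      c • r • Finsupp.single α d = r • Finsupp.single α (c * d) := by
    rw [smul_comm, Finsupp.smul_single c, smul_eq_mul]
  refine ⟨S, fun c f hf => ?_, fun f α hα => ?_, fun f hf => ?_⟩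
  · rw [hE.mem_positivePart_iff] at hf
    induction c using induction_of with
    | hof δ =>
      refine spanOf_induction (p := fun f => S (of k δ * f) = of k δ • S f) hf (fun α hα => ?_)
        (by simp) (fun f f' h h' => by rw [mul_add, map_add, map_add, smul_add, h, h'])
        (fun r f h => by rw [CatAlg.mul_smul, map_smul, map_smul, h, smul_comm])
      obtain ⟨x, y, f⟩ := α
      obtain ⟨y', t, g⟩ := δ
      obtain ⟨z, β, γ, hβ, rfl⟩ := hE.exists_factor f hα
      rw [of_eq_ofHom, of_eq_ofHom, hS _ _ hβ]
      by_cases h : y = y'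
      · subst h
        rw [ofHom_mul_ofHom, Category.assoc, hS _ _ hβ, Finset.smul_sum]
        refine Finset.sum_congr rfl fun h _ => ?_
        rw [hsm, ofHom_mul_ofHom, Category.assoc]
      · rw [ofHom_mul_ofHom_of_ne _ _ h, map_zero, Finset.smul_sum]
        refine (Finset.sum_eq_zero fun g _ => ?_).symm
        rw [hsm, ofHom_mul_ofHom_of_ne _ _ h, Finsupp.single_zero, smul_zero]
    | hzero => simp
    | hadd c d hc hd => rw [add_mul, map_add, hc, hd, add_smul]
    | hsmul r c hc => rw [CatAlg.smul_mul, map_smul, hc, smul_assoc]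
  · induction f using induction_of with
    | hof δ =>
      by_cases h : IsIso δ.hom
      · rw [hS0 _ h, Finsupp.zero_apply]
      · obtain ⟨x, y, f⟩ := δ
        obtain ⟨z, β, γ, hβ, rfl⟩ := hE.exists_factor f h
        rw [of_eq_ofHom, hS _ _ hβ, Finsupp.finsetSum_apply]
        refine Finset.sum_eq_zero fun g _ => ?_
        rw [Finsupp.smul_apply, Finsupp.single_apply, if_neg, smul_zero]
        rintro rfl
        exact (hβ.smul g).1 hα
    | hzero => simp
    | hadd c d hc hd => rw [map_add, Finsupp.add_apply, hc, hd, add_zero]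
    | hsmul r c hc => rw [map_smul, Finsupp.smul_apply, hc, smul_zero]
  · rw [hE.mem_positivePart_iff] at hf
    refine spanOf_induction (p := fun f => Finsupp.linearCombination _ (of k) (S f) = f) hf
      (fun α hα => ?_) (by simp) (fun f f' h h' => by rw [map_add, map_add, h, h'])
      (fun r f h => by rw [map_smul, LinearMap.map_smul_of_tower, h])
    obtain ⟨x, y, f⟩ := α
    obtain ⟨z, β, γ, hβ, rfl⟩ := hE.exists_factor f hα
    rw [of_eq_ofHom, hS _ _ hβ, map_sum]
    have hterm (g : Aut z) : Finsupp.linearCombination (CatAlg k E) (of k)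
        (W x z (g • β) • Finsupp.single ⟨x, z, g • β⟩ (ofHom k (g⁻¹.hom ≫ γ))) =
        W x z (g • β) • ofHom k (β ≫ γ) := by
      rw [LinearMap.map_smul_of_tower, Finsupp.linearCombination_single, smul_eq_mul, of_eq_ofHom,
        ofHom_mul_ofHom]
      have : (g • β) ≫ g⁻¹.hom ≫ γ = (g⁻¹ • g • β) ≫ γ := by
        simp only [aut_smul_def, Category.assoc]
      rw [this, inv_smul_smul]
    rw [Finset.sum_congr rfl fun g _ => hterm g, ← Finset.sum_smul, hW _ _ _ (hw _ _ _ hβ),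
      one_smul]

theorem projective_positivePart [∀ x y : E, Finite (x ⟶ y)]
    (hw : ∀ (x y : E) (β : x ⟶ y), Unfactorizable β → IsWeighted k β) :
    Module.Projective (CatAlg k E) (positivePart (lengthGrading k E)) := by
  classical
  obtain ⟨S, hS, hS0, hS1⟩ := hE.exists_section_positivePart (k := k) hw
  let s : positivePart (lengthGrading k E) →ₗ[CatAlg k E] Mor E →₀ CatAlg k E :=
    { toFun := fun f => S f
      map_add' := fun f g => map_add S f.1 g.1
      map_smul' := fun c f => hS c f.1 f.2 }
  let π : (Mor E →₀ CatAlg k E) →ₗ[CatAlg k E] positivePart (lengthGrading k E) :=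
    Finsupp.linearCombination _ fun β => if h : IsIso β.hom then 0 else
      ⟨ofHom k β.hom, hE.ofHom_mem_positivePart_iff.2 h⟩
  refine Module.Projective.of_split s π (LinearMap.ext fun f => Subtype.ext ?_)
  change (positivePart (lengthGrading k E)).subtype (π (S f)) = f
  conv_rhs => rw [← hS1 f f.2]
  rw [Finsupp.linearCombination_apply, Finsupp.linearCombination_apply, Finsupp.sum, map_sum]
  refine Finset.sum_congr rfl fun α _ => ?_
  by_cases h : IsIso α.hom
  · simp only [hS0 _ _ h, zero_smul, map_zero]
  · rw [dif_neg h]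
    rfl

end IsFiniteFreeEI

end Projectivity

/-! ### Projective dimension of a cyclic quotient. -/

section ProjectiveDimension

variable {R : Type v} [Ring R]

theorem shortExact_of_exact {L M N : Type v} [AddCommGroup L] [Module R L] [AddCommGroup M]
    [Module R M] [AddCommGroup N] [Module R N] {i : L →ₗ[R] M} {p : M →ₗ[R] N}
    (hi : Function.Injective i) (hp : Function.Surjective p) (hip : Function.Exact i p) :
    (ShortComplex.moduleCatMk i p hip.linearMap_comp_eq_zero).ShortExact where
  exact := (ShortComplex.ShortExact.moduleCat_exact_iff_function_exact _).2 hip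
  mono_f := (ModuleCat.mono_iff_injective _).2 hi
  epi_g := (ModuleCat.epi_iff_surjective _).2 hp

theorem shortExact_quotient (I : Submodule R R) :
    (ShortComplex.moduleCatMk I.subtype I.mkQ
      (LinearMap.exact_subtype_mkQ I).linearMap_comp_eq_zero).ShortExact :=
  shortExact_of_exact I.subtype_injective I.mkQ_surjective (LinearMap.exact_subtype_mkQ I)

theorem projectiveDimension_quotient_le_one (I : Submodule R R) [Module.Projective R I] :
    projectiveDimension (ModuleCat.of R (R ⧸ I)) ≤ 1 := by
  refine (projectiveDimension_le_iff _ 1).2 ?_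
  have h1 : Projective (ModuleCat.of R I) := inferInstance
  have h2 : Projective (ModuleCat.of R R) := inferInstance
  exact ((shortExact_quotient I).hasProjectiveDimensionLT_X₃_iff 0 h2).2
    (inferInstanceAs (HasProjectiveDimensionLT (ModuleCat.of R I) 1))

theorem exists_hasProjectiveDimensionLT_of_quotient (I : Submodule R R)
    (h : projectiveDimension (ModuleCat.of R (R ⧸ I)) < ⊤) :
    ∃ n, HasProjectiveDimensionLT (ModuleCat.of R I) n := by
  obtain ⟨n, hn⟩ := (projectiveDimension_ne_top_iff _).1 h.ne
  have h2 : Projective (ModuleCat.of R R) := inferInstance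
  have hn : HasProjectiveDimensionLT (ModuleCat.of R (R ⧸ I)) (n + 2) :=
    hasProjectiveDimensionLT_of_ge _ (n + 1) _ (by omega)
  exact ⟨n + 1, ((shortExact_quotient I).hasProjectiveDimensionLT_X₃_iff n h2).1 hn⟩

end ProjectiveDimension

/-! ### The linear resolution given by a projective J. -/

section Koszul

open CatAlg

variable {k : Type w} [Field k] {E : Type u} [Category.{v} E]

variable (k E) in
/-- The length grading, indexed by the integers. -/
def intGrading (j : ℤ) : Submodule k (CatAlg k E) :=
  spanOf k {α | ∃ n : ℕ, (n : ℤ) = j ∧ HasLength α n}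

theorem lengthGrading_le_intGrading (n : ℕ) : lengthGrading k E n ≤ intGrading k E n :=
  Submodule.span_mono (Set.image_mono fun _ h => ⟨n, rfl, h⟩)

variable (E) in
/-- The sets of morphisms spanning the terms of the resolution `0 → J → kE` of the degree zero
part. -/
def resolutionSet (n : ℕ) : Set (Mor E) := {α | n = 0 ∨ n = 1 ∧ α ∈ nonIso E}

theorem resolutionSet_succ_subset (n : ℕ) : resolutionSet E (n + 1) ⊆ resolutionSet E n := by
  rintro α (h | ⟨h, -⟩)
  · omega
  · exact Or.inl (by omega)

theorem IsFiniteFreeEI.resolutionSet_comp (hE : IsFiniteFreeEI E) (n : ℕ) (x y z : E) (f : x ⟶ y) (g : y ⟶ z)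
    (h : (⟨x, y, f⟩ : Mor E) ∈ resolutionSet E n) : ⟨x, z, f ≫ g⟩ ∈ resolutionSet E n :=
  h.imp_right fun h => ⟨h.1, hE.nonIso_comp _ _ _ _ _ h.2⟩

theorem IsFiniteFreeEI.disjoint_intLength (hE : IsFiniteFreeEI E) {i j : ℤ} (h : i ≠ j) :
    Disjoint {α : Mor E | ∃ n : ℕ, (n : ℤ) = i ∧ HasLength α n}
      {α : Mor E | ∃ n : ℕ, (n : ℤ) = j ∧ HasLength α n} := by
  refine Set.disjoint_left.2 ?_
  rintro α ⟨m, hm, hm'⟩ ⟨n, hn, hn'⟩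
  exact h (by rw [← hm, ← hn, hE.hasLength_unique hm' hn'])

variable [Fintype E]

theorem intGrading_mul_mem (i : ℕ) (j : ℤ) {r f : CatAlg k E} (hr : r ∈ lengthGrading k E i)
    (hf : f ∈ intGrading k E j) : r * f ∈ intGrading k E (i + j) := by
  refine spanOf_induction (p := fun f => r * f ∈ intGrading k E (i + j)) hf ?_ (by simp)
    (fun f f' h h' => by rw [mul_add]; exact add_mem h h')
    (fun r f h => by rw [CatAlg.mul_smul]; exact Submodule.smul_mem _ _ h)
  rintro α ⟨n, rfl, hα⟩
  have h := Submodule.mul_mem_mul hr (show of k α ∈ lengthGrading k E n from of_mem_spanOf hα)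
  rw [lengthGrading_mul] at h
  exact_mod_cast lengthGrading_le_intGrading _ h

namespace IsFiniteFreeEI

variable (hE : IsFiniteFreeEI E)
include hE

theorem isGradedModule_leftIdeal (T : Set (Mor E)) (hT) :
    IsGradedModule (lengthGrading k E) fun j : ℤ =>
      (intGrading k E j).comap ((leftIdeal k T hT).subtype.restrictScalars k) where
  internal := by
    refine isInternal_of_separating _ (fun j : ℤ => proj k
      {α | ∃ n : ℕ, (n : ℤ) = j ∧ HasLength α n} ∘ₗ (leftIdeal k T hT).subtype.restrictScalars k)
      (fun j x hx h => Subtype.ext ?_) (fun i j h x hx => ?_) fun x => ?_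
    · rw [← proj_eq_self (show x.1 ∈ spanOf k _ from hx)]
      exact h
    · exact proj_eq_zero (hE.disjoint_intLength h.symm) hx
    · suffices h : ∃ h : x.1 ∈ leftIdeal k T hT, (⟨x.1, h⟩ : leftIdeal k T hT) ∈ ⨆ j : ℤ,
          (intGrading k E j).comap ((leftIdeal k T hT).subtype.restrictScalars k) from h.2
      refine spanOf_induction (p := fun f => ∃ h : f ∈ leftIdeal k T hT,
        (⟨f, h⟩ : leftIdeal k T hT) ∈ ⨆ j : ℤ,
          (intGrading k E j).comap ((leftIdeal k T hT).subtype.restrictScalars k)) x.2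
        (fun α hα => ⟨of_mem_spanOf hα, ?_⟩) ⟨zero_mem _, zero_mem _⟩ ?_ ?_
      · obtain ⟨n, hn⟩ := hE.exists_hasLength α
        exact Submodule.mem_iSup_of_mem n (show of k α ∈ intGrading k E n from
          of_mem_spanOf ⟨n, rfl, hn⟩)
      · rintro f g ⟨hf, hf'⟩ ⟨hg, hg'⟩
        exact ⟨add_mem hf hg, add_mem hf' hg'⟩
      · rintro r f ⟨hf, hf'⟩
        exact ⟨Submodule.smul_of_tower_mem _ r hf, Submodule.smul_mem _ r hf'⟩
  smul_mem i j r hr x hx := intGrading_mul_mem i j hr hx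
  finite j := by
    have := hE.finite_hom
    have : Module.Finite k (leftIdeal k T hT) :=
      inferInstanceAs (Module.Finite k ((leftIdeal k T hT).restrictScalars k))
    infer_instance

theorem isGradedModule_degreeZero :
    IsGradedModule (lengthGrading k E) (degreeZeroGrading (lengthGrading k E)) where
  internal := by
    refine isInternal_of_separating _ (fun j => if j = 0 then LinearMap.id else 0)
      (fun j x hx h => ?_) (fun i j h x hx => ?_) fun x => ?_
    · by_cases hj : j = 0
      · rwa [if_pos hj] at h
      · rw [degreeZeroGrading, if_neg hj] at hx
        exact hx
    · by_cases hj : j = 0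
      · rw [degreeZeroGrading, if_neg (hj ▸ h)] at hx
        rw [(Submodule.mem_bot _).1 hx, map_zero]
      · rw [if_neg hj, LinearMap.zero_apply]
    · refine Submodule.mem_iSup_of_mem 0 ?_
      rw [degreeZeroGrading, if_pos rfl]
      exact Submodule.mem_top
  smul_mem i j r hr x hx := by
    by_cases hj : j = 0
    · by_cases hi : i = 0
      · rw [hi, hj, degreeZeroGrading, if_pos (by simp)]
        exact Submodule.mem_top
      · have hr' : r ∈ positivePart (lengthGrading k E) := by
          obtain ⟨i, rfl⟩ := Nat.exists_eq_succ_of_ne_zero hi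
          exact Submodule.subset_span (Set.mem_iUnion.2 ⟨i, hr⟩)
        obtain ⟨f, rfl⟩ := Submodule.mkQ_surjective _ x
        rw [← map_smul, smul_eq_mul, Submodule.mkQ_apply,
          (Submodule.Quotient.mk_eq_zero _).2 (hE.mul_mem_positivePart hr' f)]
        exact zero_mem _
    · rw [degreeZeroGrading, if_neg hj] at hx
      rw [(Submodule.mem_bot _).1 hx, smul_zero]
      exact zero_mem _
  finite j := by
    have := hE.finite_hom
    have : Module.Finite k (DegreeZero (lengthGrading k E)) :=
      Module.Finite.of_surjective
        ((positivePart (lengthGrading k E)).mkQ.restrictScalars k)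
        (positivePart (lengthGrading k E)).mkQ_surjective
    infer_instance

variable (k) in
/-- The terms of the resolution `0 → J → kE` of the degree zero part. -/
abbrev resolutionTerm (n : ℕ) : Submodule (CatAlg k E) (CatAlg k E) :=
  leftIdeal k (resolutionSet E n) (hE.resolutionSet_comp n)

theorem resolutionTerm_zero : hE.resolutionTerm k 0 = ⊤ :=
  eq_top_iff.2 fun _ _ => mem_spanOf_iff.2 fun _ h => absurd (Or.inl rfl) h

theorem resolutionTerm_one : hE.resolutionTerm k 1 = positivePart (lengthGrading k E) := by
  ext f
  rw [hE.mem_positivePart_iff, mem_leftIdeal]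
  have : resolutionSet E 1 = nonIso E := Set.ext fun α => by simp [resolutionSet]
  rw [this]

theorem resolutionTerm_add_two (n : ℕ) : hE.resolutionTerm k (n + 2) = ⊥ := by
  refine eq_bot_iff.2 fun f hf => (Submodule.mem_bot _).2 (ext_coeff fun α => ?_)
  rw [map_zero]
  exact mem_spanOf_iff.1 hf α fun h => by simp [resolutionSet] at h

theorem projective_resolutionTerm
    (hJ : Module.Projective (CatAlg k E) (positivePart (lengthGrading k E))) (n : ℕ) :
    Module.Projective (CatAlg k E) (hE.resolutionTerm k n) := by
  match n with
  | 0 =>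
    rw [hE.resolutionTerm_zero]
    exact Module.Projective.of_equiv' (Submodule.topEquiv (R := CatAlg k E)).symm
  | 1 => rw [hE.resolutionTerm_one]; exact hJ
  | n + 2 =>
    rw [hE.resolutionTerm_add_two]
    infer_instance

/-- A is generated by 1 in degree 0, J by the unfactorizable first factors in degree 1, and the
remaining terms are zero. -/
theorem generated_resolutionTerm (n : ℕ) :
    GeneratedInDegree (CatAlg k E) (fun j : ℤ => (intGrading k E j).comap
      ((hE.resolutionTerm k n).subtype.restrictScalars k)) n := by
  rw [GeneratedInDegree, eq_top_iff]
  rintro ⟨f, hf⟩ -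
  match n with
  | 0 =>
    have h1 : (1 : CatAlg k E) ∈ hE.resolutionTerm k 0 := by
      rw [hE.resolutionTerm_zero]; exact Submodule.mem_top
    have h2 : (⟨f, hf⟩ : hE.resolutionTerm k 0) = f • ⟨1, h1⟩ := Subtype.ext (mul_one f).symm
    rw [h2]
    exact Submodule.smul_mem _ _ (Submodule.subset_span
      (lengthGrading_le_intGrading 0 hE.isStandardGraded.one_mem))
  | 1 =>
    suffices h : ∃ h : f ∈ hE.resolutionTerm k 1, (⟨f, h⟩ : hE.resolutionTerm k 1) ∈
        Submodule.span (CatAlg k E) (((intGrading k E 1).comap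
          ((hE.resolutionTerm k 1).subtype.restrictScalars k) :
          Submodule k (hE.resolutionTerm k 1)) : Set (hE.resolutionTerm k 1)) from h.2
    refine spanOf_induction (p := fun f => ∃ h : f ∈ hE.resolutionTerm k 1, (⟨f, h⟩ :
      hE.resolutionTerm k 1) ∈ Submodule.span (CatAlg k E) (((intGrading k E 1).comap
          ((hE.resolutionTerm k 1).subtype.restrictScalars k) :
          Submodule k (hE.resolutionTerm k 1)) : Set (hE.resolutionTerm k 1)))
      hf (fun α hα => ⟨of_mem_spanOf hα, ?_⟩) ⟨zero_mem _, zero_mem _⟩ ?_ ?_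
    · have hα' : ¬ IsIso α.hom := by simpa [resolutionSet, nonIso] using hα
      obtain ⟨x, y, f⟩ := α
      obtain ⟨z, β, γ, hβ, rfl⟩ := hE.exists_factor f hα'
      have h1 : ofHom k β ∈ hE.resolutionTerm k 1 := of_mem_spanOf (Or.inr ⟨rfl, hβ.1⟩)
      have h2 : (⟨of k ⟨x, y, β ≫ γ⟩, of_mem_spanOf hα⟩ : hE.resolutionTerm k 1) =
          ofHom k γ • ⟨ofHom k β, h1⟩ := Subtype.ext (ofHom_mul_ofHom β γ).symm
      rw [h2]
      refine Submodule.smul_mem _ _ (Submodule.subset_span (show ofHom k β ∈ intGrading k E 1 from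
        of_mem_spanOf ⟨1, rfl, (hasLength_one_iff _).2 hβ⟩))
    · rintro f g ⟨hf, hf'⟩ ⟨hg, hg'⟩
      exact ⟨add_mem hf hg, add_mem hf' hg'⟩
    · rintro r f ⟨hf, hf'⟩
      exact ⟨Submodule.smul_of_tower_mem _ r hf, Submodule.smul_of_tower_mem _ r hf'⟩
  | n + 2 =>
    have : (⟨f, hf⟩ : hE.resolutionTerm k (n + 2)) = 0 :=
      Subtype.ext ((Submodule.mem_bot (CatAlg k E)).1 ((hE.resolutionTerm_add_two n).le hf))
    rw [this]
    exact zero_mem _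

theorem intGrading_le_positivePart {j : ℤ} (hj : j ≠ 0) {f : CatAlg k E}
    (hf : f ∈ intGrading k E j) : f ∈ positivePart (lengthGrading k E) := by
  refine hE.mem_positivePart_iff.2 (Submodule.span_mono (Set.image_mono ?_) hf)
  rintro α ⟨n, rfl, hn⟩ hi
  have := hE.hasLength_unique hn ((hasLength_zero_iff _).2 hi)
  exact hj (by exact_mod_cast this)

/-- If `J` is projective, `0 → J → kE` is a linear resolution of the degree zero part. -/
def linearResolution (hJ : Module.Projective (CatAlg k E) (positivePart (lengthGrading k E))) :
    LinearResolution (lengthGrading k E) (degreeZeroGrading (lengthGrading k E)) where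
  P n := hE.resolutionTerm k n
  piece n j := (intGrading k E j).comap ((hE.resolutionTerm k n).subtype.restrictScalars k)
  graded n := hE.isGradedModule_leftIdeal _ _
  projective := hE.projective_resolutionTerm hJ
  generated := hE.generated_resolutionTerm
  ε := (positivePart (lengthGrading k E)).mkQ ∘ₗ (hE.resolutionTerm k 0).subtype
  d n := Submodule.inclusion fun _ hf =>
    Submodule.span_mono (Set.image_mono (resolutionSet_succ_subset n)) hf
  ε_mem j x hx := by
    by_cases hj : j = 0
    · rw [degreeZeroGrading, if_pos hj]
      exact Submodule.mem_top
    · rw [degreeZeroGrading, if_neg hj, Submodule.mem_bot]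
      exact (Submodule.Quotient.mk_eq_zero _).2 (hE.intGrading_le_positivePart hj hx)
  d_mem n j x hx := hx
  surjective y := by
    obtain ⟨f, rfl⟩ := Submodule.mkQ_surjective _ y
    exact ⟨⟨f, by rw [hE.resolutionTerm_zero]; exact Submodule.mem_top⟩, rfl⟩
  exact_zero x := by
    constructor
    · intro h
      have h : x.1 ∈ positivePart (lengthGrading k E) := (Submodule.Quotient.mk_eq_zero _).1 h
      exact ⟨⟨x.1, by rw [hE.resolutionTerm_one]; exact h⟩, rfl⟩
    · rintro ⟨y, rfl⟩
      exact (Submodule.Quotient.mk_eq_zero _).2 (hE.resolutionTerm_one.le y.2)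
  exact_succ n x := by
    constructor
    · intro h
      refine ⟨0, ?_⟩
      rw [map_zero]
      exact Subtype.ext (congrArg Subtype.val h).symm
    · rintro ⟨y, rfl⟩
      exact Subtype.ext ((Submodule.mem_bot (CatAlg k E)).1 ((hE.resolutionTerm_add_two n).le y.2))

theorem isKoszulAlgebra (hJ : Module.Projective (CatAlg k E) (positivePart (lengthGrading k E))) :
    IsKoszulAlgebra (lengthGrading k E) where
  graded := hE.isStandardGraded
  koszul :=
    { graded := hE.isGradedModule_degreeZero
      generated := by
        rw [GeneratedInDegree, degreeZeroGrading, if_pos rfl]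
        exact Submodule.span_univ
      resolution := ⟨hE.linearResolution hJ⟩ }

end IsFiniteFreeEI

end Koszul

/-! ### Finite projective dimension forces invertible stabilizer orders. -/

section FiniteProjectiveDimension

open CatAlg

variable {k : Type w} [Field k] {E : Type u} [Category.{v} E]

theorem CatAlg.mor_hom_injective {x y : E} {f g : x ⟶ y} (h : (⟨x, y, f⟩ : Mor E) = ⟨x, y, g⟩) :
    f = g := by
  cases h
  rfl

variable [Fintype E]

namespace CatAlg

theorem coeff_autHom_mul {x y : E} (g : Aut y) (β : x ⟶ y) (f : CatAlg k E) :
    coeff ⟨x, y, g • β⟩ (autHom k y g * f) = coeff ⟨x, y, β⟩ f := by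
  classical
  induction f using induction_of with
  | hof α =>
    obtain ⟨x', y', f⟩ := α
    by_cases hy : y' = y
    · subst hy
      rw [of_eq_ofHom, autHom_mul_ofHom, ofHom, ofHom]
      by_cases hx : x = x'
      · subst hx
        by_cases hf : β = f
        · rw [hf, coeff_of_self, coeff_of_self]
        · rw [coeff_of_ne, coeff_of_ne]
          · exact fun h => hf (mor_hom_injective h)
          · exact fun h => hf (smul_left_cancel g (mor_hom_injective h))
      · rw [coeff_of_ne, coeff_of_ne]
        · exact fun h => hx (congrArg Mor.src h)
        · exact fun h => hx (congrArg Mor.src h)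
    · rw [of_eq_ofHom, autHom_apply, ofHom_mul_ofHom_of_ne _ _ hy, map_zero, ofHom, coeff_of_ne]
      exact fun h => hy (congrArg Mor.tgt h).symm
  | hzero => simp
  | hadd f g hf hg => rw [mul_add, map_add, map_add, hf, hg]
  | hsmul r f hf => rw [CatAlg.mul_smul, map_smul, map_smul, hf]

end CatAlg

namespace IsFiniteFreeEI

variable (hE : IsFiniteFreeEI E) [∀ x y : E, Finite (x ⟶ y)]
include hE

/-- The endomorphisms of y are its automorphisms, so 1_y f 1_y lies in kAut(y), and the coefficient
of g in it is that of the identity in g⁻¹f. Thus "coefficient of the identity" is a Higman map for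
the regular module. -/
theorem sum_coeff_autHom (y : E) (f : CatAlg k E) :
    ∑ g : Aut y, coeff ⟨y, y, 𝟙 y⟩ (autHom k y g⁻¹ * f) • autHom k y g =
      idem k y * f * idem k y := by
  classical
  induction f using induction_of with
  | hof α =>
    obtain ⟨x, z, f⟩ := α
    rw [of_eq_ofHom]
    by_cases hz : z = y
    · subst hz
      by_cases hx : x = z
      · subst hx
        have hi := hE.isIso_of_end x f
        let a : Aut x := asIso f
        have ha : ofHom k f = autHom k x a := rfl
        have h1 (g : Aut x) : coeff ⟨x, x, 𝟙 x⟩ (autHom k x g⁻¹ * ofHom k f) =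
            if a = g then 1 else 0 := by
          have h2 := coeff_autHom_mul (k := k) g⁻¹ (g.hom) (ofHom k f)
          have h3 : g⁻¹ • g.hom = 𝟙 x := g.hom_inv_id
          rw [h3] at h2
          rw [h2, ofHom]
          by_cases h : a = g
          · rw [if_pos h, ← h]
            exact coeff_of_self _
          · rw [if_neg h]
            exact coeff_of_ne fun h' => h (Iso.ext (mor_hom_injective h').symm)
        dsimp only
        simp only [h1, ite_smul, one_smul, zero_smul, Finset.sum_ite_eq, Finset.mem_univ, if_true]
        rw [idem_mul_ofHom, ofHom_mul_idem, ha]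
      · rw [mul_assoc, idem_eq_ofHom (k := k) z, ofHom_mul_ofHom_of_ne _ _ (Ne.symm hx), mul_zero]
        refine Finset.sum_eq_zero fun g _ => ?_
        rw [autHom_mul_ofHom, ofHom, coeff_of_ne, zero_smul]
        exact fun h => hx (congrArg Mor.src h).symm
    · rw [idem_eq_ofHom (k := k) y, ofHom_mul_ofHom_of_ne _ _ hz, zero_mul]
      refine Finset.sum_eq_zero fun g _ => ?_
      rw [autHom_apply, ofHom_mul_ofHom_of_ne _ _ hz, map_zero, zero_smul]
  | hzero => simp
  | hadd f g hf hg =>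
    simp only [mul_add, add_mul, map_add, add_smul, Finset.sum_add_distrib, hf, hg]
  | hsmul r f hf =>
    simp only [CatAlg.mul_smul, CatAlg.smul_mul, map_smul, smul_assoc, ← Finset.smul_sum, hf]

end IsFiniteFreeEI

variable (k) in
/-- The projective left ideal spanned by the morphisms whose source lies above `y`. -/
abbrev idealAbove (y : E) : Submodule (CatAlg k E) (CatAlg k E) :=
  leftIdeal k {α : Mor E | Nonempty (y ⟶ α.src)} fun _ _ _ _ _ h => h

variable (k) in
open Classical in
/-- The idempotent `∑ 1_z`, where `z` runs over the objects above `y`. -/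
def idemAbove (y : E) : CatAlg k E := ∑ z : E, if Nonempty (y ⟶ z) then idem k z else 0

theorem idemAbove_mem (y : E) : idemAbove k y ∈ idealAbove k y := by
  refine sum_mem fun z _ => ?_
  split_ifs with h
  · exact of_mem_spanOf h
  · exact zero_mem _

theorem mul_idemAbove_mem (y : E) (f : CatAlg k E) : f * idemAbove k y ∈ idealAbove k y :=
  Submodule.smul_mem _ f (idemAbove_mem y)

theorem mul_idemAbove (y : E) {f : CatAlg k E} (hf : f ∈ idealAbove k y) :
    f * idemAbove k y = f := by
  classical
  refine spanOf_induction (p := fun f => f * idemAbove k y = f) hf (fun α hα => ?_) (by simp)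
    (fun f g hf hg => by rw [add_mul, hf, hg]) (fun r f hf => by rw [CatAlg.smul_mul, hf])
  rw [idemAbove, Finset.mul_sum, Finset.sum_eq_single α.src]
  · rw [if_pos (show Nonempty (y ⟶ α.src) from hα)]
    exact ofHom_mul_idem α.hom
  · intro z _ hz
    split_ifs
    · rw [CatAlg.of_mul_idem, if_neg hz.symm]
    · exact mul_zero _
  · exact fun h => absurd (Finset.mem_univ _) h

instance projective_idealAbove (y : E) : Module.Projective (CatAlg k E) (idealAbove k y) := by
  let p : CatAlg k E →ₗ[CatAlg k E] idealAbove k y :=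
    { toFun := fun f => ⟨f * idemAbove k y, mul_idemAbove_mem y f⟩
      map_add' := fun f g => Subtype.ext (add_mul f g _)
      map_smul' := fun c f => Subtype.ext (mul_assoc c f _) }
  have : Module.Projective (CatAlg k E) (CatAlg k E) := inferInstance
  exact Module.Projective.of_split (idealAbove k y).subtype p
    (LinearMap.ext fun f => Subtype.ext (mul_idemAbove y f.2))

theorem idem_mul_of_mem_idealAbove {y z : E} (hz : IsEmpty (y ⟶ z)) {f : CatAlg k E}
    (hf : f ∈ idealAbove k y) : idem k z * f = 0 := by
  classical
  refine spanOf_induction (p := fun f => idem k z * f = 0) hf (fun α hα => ?_) (by simp)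
    (fun f g hf hg => by rw [mul_add, hf, hg, add_zero])
    (fun r f hf => by rw [CatAlg.mul_smul, hf, smul_zero])
  rw [CatAlg.idem_mul_of, if_neg]
  rintro rfl
  exact hα.elim fun g => hz.elim (g ≫ α.hom)

/-- A morphism that ends at y and starts above y starts at y. So the part of this ideal at y is the
regular module kAut(y). -/
theorem IsFiniteFreeEI.idem_mul_mul_idem_of_mem_idealAbove (hE : IsFiniteFreeEI E) (y : E) {f : CatAlg k E} (hf : f ∈ idealAbove k y) :
    idem k y * f * idem k y = idem k y * f := by
  classical
  refine spanOf_induction (p := fun f => idem k y * f * idem k y = idem k y * f) hf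
    (fun α hα => ?_) (by simp) (fun f g hf hg => by rw [mul_add, add_mul, hf, hg])
    (fun r f hf => by rw [CatAlg.mul_smul, CatAlg.smul_mul, hf])
  rw [CatAlg.idem_mul_of]
  split_ifs with h
  · rw [CatAlg.of_mul_idem, if_pos]
    obtain ⟨x, z, f⟩ := α
    obtain rfl : z = y := h
    exact hE.eq_of_hom f hα.some
  · rw [zero_mul]

/-- The module `M` is supported on the objects above `y`. -/
def IsSupportedAbove (k : Type w) [Field k] (y : E) (M : Type*) [AddCommGroup M]
    [Module (CatAlg k E) M] : Prop :=
  ∀ z : E, IsEmpty (y ⟶ z) → ∀ m : M, idem k z • m = 0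

theorem IsSupportedAbove.idemAbove_smul {y : E} {M : Type*} [AddCommGroup M]
    [Module (CatAlg k E) M] (h : IsSupportedAbove k y M) (m : M) : idemAbove k y • m = m := by
  classical
  conv_rhs => rw [← one_smul (CatAlg k E) m, ← sum_idem, Finset.sum_smul]
  rw [idemAbove, Finset.sum_smul]
  refine Finset.sum_congr rfl fun z _ => ?_
  split_ifs with hz
  · rfl
  · rw [zero_smul, h z (not_nonempty_iff.1 hz)]

theorem isSupportedAbove_leftIdeal {y : E} {S : Set (Mor E)} {hS}
    (h : ∀ α ∈ S, Nonempty (y ⟶ α.tgt)) : IsSupportedAbove k y (leftIdeal k S hS) := by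
  classical
  rintro z hz ⟨f, hf⟩
  refine Subtype.ext ?_
  refine spanOf_induction (p := fun f => idem k z * f = 0) hf (fun α hα => ?_) (by simp)
    (fun f g hf hg => by rw [mul_add, hf, hg, add_zero])
    (fun r f hf => by rw [CatAlg.mul_smul, hf, smul_zero])
  rw [CatAlg.idem_mul_of, if_neg]
  rintro rfl
  exact (h α hα).elim hz.elim

namespace IsFiniteFreeEI

variable (hE : IsFiniteFreeEI E) [∀ x y : E, Finite (x ⟶ y)]
include hE

theorem isRelProj_idealAbove (y : E) : IsRelProj k (autHom k y) (idealAbove k y) := by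
  have hy : idem k y ∈ idealAbove k y := of_mem_spanOf (S := {α : Mor E | Nonempty (y ⟶ α.src)}) ⟨𝟙 y⟩
  refine ⟨(coeff ⟨y, y, 𝟙 y⟩ ∘ₗ (idealAbove k y).subtype.restrictScalars k).smulRight ⟨_, hy⟩,
    fun f => Subtype.ext ?_⟩
  rw [average_apply, AddSubmonoidClass.coe_finsetSum]
  refine Eq.trans ?_ ((hE.sum_coeff_autHom y f.1).trans
    (hE.idem_mul_mul_idem_of_mem_idealAbove y f.2))
  refine Finset.sum_congr rfl fun g _ => ?_
  change autHom k y g * (coeff ⟨y, y, 𝟙 y⟩ (autHom k y g⁻¹ * f.1) • idem k y) = _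
  rw [CatAlg.mul_smul, ← autHom_one, ← map_mul, mul_one]

/-- Dimension shifting along covers by copies of `idealAbove k y`. The support condition is what
makes these covers surjective: an arbitrary free module would bring in permutation modules at y that
need not be projective. The kernel is again supported above y, and `IsRelProj.of_exact_right`
returns from the kernel to M. -/
theorem isRelProj_of_hasProjectiveDimensionLT (y : E) (n : ℕ) (M : Type (max u v w))
    [AddCommGroup M] [Module k M] [Module (CatAlg k E) M] [IsScalarTower k (CatAlg k E) M]
    (hM : HasProjectiveDimensionLT (ModuleCat.of (CatAlg k E) M) n)
    (hs : IsSupportedAbove k y M) : IsRelProj k (autHom k y) M := by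
  induction n using Nat.strong_induction_on generalizing M with
  | _ n ih =>
    let π : (M →₀ idealAbove k y) →ₗ[CatAlg k E] M := Finsupp.lsum ℕ fun m =>
      LinearMap.toSpanSingleton (CatAlg k E) M m ∘ₗ (idealAbove k y).subtype
    have hπ : Function.Surjective π := fun m =>
      ⟨Finsupp.single m ⟨_, idemAbove_mem y⟩, by
        rw [Finsupp.lsum_single]
        exact hs.idemAbove_smul m⟩
    have hP := (hE.isRelProj_idealAbove (k := k) y).finsupp M
    match n with
    | 0 =>
      have : Subsingleton M := ModuleCat.subsingleton_of_isZero
        (isZero_of_hasProjectiveDimensionLT_zero (ModuleCat.of (CatAlg k E) M))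
      exact .of_one_smul_eq_zero fun m => Subsingleton.elim _ _
    | 1 =>
      have : Projective (ModuleCat.of (CatAlg k E) M) := inferInstance
      have : Module.Projective (CatAlg k E) M := (IsProjective.iff_projective M).2 this
      obtain ⟨s, hs⟩ := Module.projective_lifting_property π LinearMap.id hπ
      exact hP.of_retract s π fun m => LinearMap.congr_fun hs m
    | n + 2 =>
      have hex : Function.Exact (LinearMap.ker π).subtype π := LinearMap.exact_subtype_ker_map π
      have : Module.Projective (CatAlg k E) (M →₀ idealAbove k y) := by
        classical
        exact Module.Projective.of_equiv' (finsuppLequivDFinsupp (CatAlg k E)).symm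
      have h2 : Projective (ModuleCat.of (CatAlg k E) (M →₀ idealAbove k y)) := inferInstance
      have hK : HasProjectiveDimensionLT (ModuleCat.of (CatAlg k E) (LinearMap.ker π)) (n + 1) :=
        ((shortExact_of_exact (LinearMap.ker π).subtype_injective hπ
          hex).hasProjectiveDimensionLT_X₃_iff n h2).1 hM
      refine (ih (n + 1) (by omega) (LinearMap.ker π) hK fun z hz f => Subtype.ext
        (Finsupp.ext fun m => Subtype.ext ?_)).of_exact_right hP
        (LinearMap.ker π).subtype_injective hπ hex
      exact idem_mul_of_mem_idealAbove hz (f.1 m).2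

/-- If the degree zero part has finite projective dimension, then the stabilizers of the
unfactorizable morphisms have invertible order. -/
theorem isWeighted_of_hasProjectiveDimensionLT {n : ℕ} (hn : HasProjectiveDimensionLT
      (ModuleCat.of (CatAlg k E) (positivePart (lengthGrading k E))) n)
    {x y : E} (β : x ⟶ y) (hβ : Unfactorizable β) : IsWeighted k β := by
  classical
  -- The morphisms that factor through β from the right; their span is the left ideal Aβ.
  let S : Set (Mor E) := {α | ∃ (z : E) (γ : y ⟶ z), α = ⟨x, z, β ≫ γ⟩}
  have hS (x' y' z' : E) (f : x' ⟶ y') (g : y' ⟶ z') (h : (⟨x', y', f⟩ : Mor E) ∈ S) :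
      (⟨x', z', f ≫ g⟩ : Mor E) ∈ S := by
    obtain ⟨z, γ, h⟩ := h
    cases h
    exact ⟨z', γ ≫ g, by rw [Category.assoc]⟩
  have hSJ : S ⊆ nonIso E := by
    rintro _ ⟨z, γ, rfl⟩
    exact hE.not_isIso_comp_left hβ.1 γ
  -- By unique factorization, if f ≫ g starts with β then so does the non-isomorphism f. Hence the
  -- non-isomorphisms outside S are closed under composition too, and the coordinate projection J →
  -- Aβ is A-linear.
  have hS' (x' y' z' : E) (f : x' ⟶ y') (g : y' ⟶ z') (hf : ¬ IsIso f)
      (h : (⟨x', z', f ≫ g⟩ : Mor E) ∈ S) : (⟨x', y', f⟩ : Mor E) ∈ S := by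
    obtain ⟨z, γ, h⟩ := h
    obtain rfl : x' = x := congrArg Mor.src h
    obtain rfl : z' = z := congrArg Mor.tgt h
    have h := mor_hom_injective h
    obtain ⟨t, β', γ', hβ', rfl⟩ := hE.exists_factor f hf
    rw [Category.assoc] at h
    obtain ⟨e, rfl, -⟩ := hE.exists_iso_of_comp_eq_comp hβ hβ' h.symm
    exact ⟨_, e.hom ≫ γ', by rw [Category.assoc]⟩
  have hproj (c f : CatAlg k E) (hf : f ∈ positivePart (lengthGrading k E)) :
      proj k S (c * f) = c * proj k S f := by
    rw [hE.mem_positivePart_iff] at hf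
    induction c using induction_of with
    | hof δ =>
      refine spanOf_induction (p := fun f => proj k S (of k δ * f) = of k δ * proj k S f) hf
        (fun α hα => ?_) (by simp) (fun f f' h h' => by rw [mul_add, map_add, map_add, mul_add, h, h'])
        (fun r f h => by rw [CatAlg.mul_smul, map_smul, map_smul, h, CatAlg.mul_smul])
      obtain ⟨x', y', f⟩ := α
      obtain ⟨y'', z', g⟩ := δ
      by_cases hy : y' = y''
      · subst hy
        by_cases h : (⟨x', y', f⟩ : Mor E) ∈ S
        · rw [proj_of_mem h, of_eq_ofHom, of_eq_ofHom, ofHom_mul_ofHom, ofHom,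
            proj_of_mem (hS _ _ _ _ _ h)]
        · rw [proj_of_notMem h, of_eq_ofHom, of_eq_ofHom, ofHom_mul_ofHom, ofHom,
            proj_of_notMem fun h' => h (hS' _ _ _ _ _ hα h'), mul_zero]
      · by_cases h : (⟨x', y', f⟩ : Mor E) ∈ S
        · rw [proj_of_mem h, of_eq_ofHom, of_eq_ofHom, ofHom_mul_ofHom_of_ne _ _ hy, map_zero]
        · rw [proj_of_notMem h, of_eq_ofHom, of_eq_ofHom, ofHom_mul_ofHom_of_ne _ _ hy, map_zero,
            mul_zero]
    | hzero => simp
    | hadd c d hc hd => rw [add_mul, map_add, hc, hd, add_mul]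
    | hsmul r c hc => rw [CatAlg.smul_mul, map_smul, hc, CatAlg.smul_mul]
  let i : leftIdeal k S hS →ₗ[CatAlg k E] positivePart (lengthGrading k E) :=
    Submodule.inclusion fun f hf => hE.mem_positivePart_iff.2
      (Submodule.span_mono (Set.image_mono hSJ) hf)
  let r : positivePart (lengthGrading k E) →ₗ[CatAlg k E] leftIdeal k S hS :=
    { toFun := fun f => ⟨proj k S f, by
        have := proj_mem (S := S) (mem_spanOf_univ f.1)
        rwa [Set.inter_univ] at this⟩
      map_add' := fun f g => Subtype.ext (map_add _ _ _)
      map_smul' := fun c f => Subtype.ext (hproj c f f.2) }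
  have hri : r ∘ₗ i = LinearMap.id := LinearMap.ext fun f => Subtype.ext (proj_eq_self f.2)
  have hret : Retract (ModuleCat.of (CatAlg k E) (leftIdeal k S hS))
      (ModuleCat.of (CatAlg k E) (positivePart (lengthGrading k E))) :=
    { i := ModuleCat.ofHom i
      r := ModuleCat.ofHom r
      retract := by rw [← ModuleCat.ofHom_comp, hri, ModuleCat.ofHom_id] }
  have hrel : IsRelProj k (autHom k y) (leftIdeal k S hS) :=
    hE.isRelProj_of_hasProjectiveDimensionLT y n _ (hret.hasProjectiveDimensionLT n)
      (isSupportedAbove_leftIdeal (by rintro _ ⟨z, γ, rfl⟩; exact ⟨γ⟩))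
  have hβS : ofHom k β ∈ leftIdeal k S hS :=
    of_mem_spanOf (S := S) ⟨y, 𝟙 y, by rw [Category.comp_id]⟩
  refine hrel.exists_weight β ⟨ofHom k β, hβS⟩
    (coeff ⟨x, y, β⟩ ∘ₗ (leftIdeal k S hS).subtype.restrictScalars k) (fun g hg => Subtype.ext ?_)
    (fun g hg f => ?_) (coeff_of_self _)
  · exact (autHom_mul_ofHom g β).trans (by rw [hg])
  · have := coeff_autHom_mul g β f.1
    rw [hg] at this
    exact this

end IsFiniteFreeEI

end FiniteProjectiveDimension

/-! ### Degree bounds for graded modules generated in one degree. -/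

section GradedModules

variable {k : Type w} [Field k] {A : Type a} [Ring A] [Algebra k A] {𝒜 : ℕ → Submodule k A}
variable {M : Type m} [AddCommGroup M] [Module k M] [Module A M] [IsScalarTower k A M]
  {ℳ : ℤ → Submodule k M}

/-- A module generated in degree `s` is the sum of its degree `s` part and of a part which lies in
higher degrees and in `J M`. -/
theorem IsGradedModule.exists_add (h𝒜 : DirectSum.IsInternal 𝒜) (hM : IsGradedModule 𝒜 ℳ) {s : ℤ}
    (hs : GeneratedInDegree A ℳ s) (x : M) :
    ∃ y ∈ ℳ s, ∃ z ∈ ⨆ i : ℕ, ℳ (s + 1 + i),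
      z ∈ (positivePart 𝒜 : Ideal A) • (⊤ : Submodule A M) ∧ x = y + z := by
  have hx : x ∈ Submodule.span A (ℳ s : Set M) := hs ▸ Submodule.mem_top
  obtain ⟨n, f, g, rfl⟩ := Submodule.mem_span_set'.1 hx
  let p (x : M) : Prop := ∃ y ∈ ℳ s, ∃ z ∈ ⨆ i : ℕ, ℳ (s + 1 + i),
      z ∈ (positivePart 𝒜 : Ideal A) • (⊤ : Submodule A M) ∧ x = y + z
  have h0 : p 0 := ⟨0, zero_mem _, 0, zero_mem _, zero_mem _, by simp⟩
  have hadd (x x' : M) (h : p x) (h' : p x') : p (x + x') := by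
    obtain ⟨y, hy, z, hz, hz', rfl⟩ := h
    obtain ⟨y', hy', t, ht, ht', rfl⟩ := h'
    exact ⟨y + y', add_mem hy hy', z + t, add_mem hz ht, add_mem hz' ht', by abel⟩
  change p (∑ i, f i • (g i : M))
  refine Finset.sum_induction _ p hadd h0 fun i _ => ?_
  have hf : f i ∈ ⨆ j, 𝒜 j := by
    rw [h𝒜.submodule_iSup_eq_top]
    exact Submodule.mem_top
  refine Submodule.iSup_induction (motive := fun a => p (a • (g i : M))) 𝒜 hf (fun j r hr => ?_)
    (by simpa using h0) fun r r' h h' => by rw [add_smul]; exact hadd _ _ h h'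
  have hm := hM.smul_mem j s r hr _ (g i).2
  cases j with
  | zero => exact ⟨_, by simpa using hm, 0, zero_mem _, zero_mem _, (add_zero _).symm⟩
  | succ j =>
    refine ⟨0, zero_mem _, _, Submodule.mem_iSup_of_mem j ?_, Submodule.smul_mem_smul
      (Submodule.subset_span (Set.mem_iUnion.2 ⟨j, hr⟩)) Submodule.mem_top, (zero_add _).symm⟩
    have : s + 1 + (j : ℤ) = ((j + 1 : ℕ) : ℤ) + s := by push_cast; ring
    rwa [this]

theorem IsGradedModule.mem_iSup_of_generated (h𝒜 : DirectSum.IsInternal 𝒜)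
    (hM : IsGradedModule 𝒜 ℳ) {s : ℤ} (hs : GeneratedInDegree A ℳ s) (x : M) :
    x ∈ ⨆ i : ℕ, ℳ (s + i) := by
  obtain ⟨y, hy, z, hz, -, rfl⟩ := hM.exists_add h𝒜 hs x
  refine add_mem (Submodule.mem_iSup_of_mem 0 (by simpa using hy)) ?_
  refine (iSup_le fun i => ?_ : ⨆ i : ℕ, ℳ (s + 1 + i) ≤ _) hz
  refine le_trans (le_of_eq ?_) (le_iSup _ (i + 1))
  congr 1
  push_cast
  ring

theorem IsGradedModule.eq_zero_of_mem (hM : IsGradedModule 𝒜 ℳ) {s : ℤ} {x : M} (hx : x ∈ ℳ s)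
    (hx' : x ∈ ⨆ i : ℕ, ℳ (s + 1 + i)) : x = 0 := by
  have h := (DirectSum.isInternal_submodule_iff_iSupIndep_and_iSup_eq_top _).1 hM.internal
  refine Submodule.disjoint_def.1 (h.1 s) x hx
    ((iSup_le fun i => ?_ : ⨆ i : ℕ, ℳ (s + 1 + i) ≤ _) hx')
  exact le_iSup₂ (f := fun j (_ : j ≠ s) => ℳ j) (s + 1 + i) (by omega)

theorem map_mem_iSup {N : Type*} [AddCommGroup N] [Module k N] [Module A N] [IsScalarTower k A N]
    {𝒩 : ℤ → Submodule k N} (f : M →ₗ[A] N) (hf : ∀ j, ∀ x ∈ ℳ j, f x ∈ 𝒩 j) {s : ℤ} {x : M}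
    (hx : x ∈ ⨆ i : ℕ, ℳ (s + i)) : f x ∈ ⨆ i : ℕ, 𝒩 (s + i) := by
  have : ⨆ i : ℕ, ℳ (s + i) ≤ (⨆ i : ℕ, 𝒩 (s + i)).comap (f.restrictScalars k) :=
    iSup_le fun i y hy => Submodule.mem_iSup_of_mem i (hf _ y hy)
  exact this hx

end GradedModules

/-! ### Tops of projective modules. -/

section Top

variable {R : Type*} [Ring R] (J : Ideal R)

/-- If `P` is projective, then `P / J P` is a retract of a direct sum of copies of `R / J`. -/
theorem exists_retract_top (hJ : ∀ r ∈ J, ∀ s, r * s ∈ J) (P : Type*) [AddCommGroup P]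
    [Module R P] [Module.Projective R P] :
    ∃ (s : (P ⧸ (J • ⊤ : Submodule R P)) →ₗ[R] P →₀ (R ⧸ J))
      (p : (P →₀ (R ⧸ J)) →ₗ[R] P ⧸ (J • ⊤ : Submodule R P)), ∀ x, p (s x) = x := by
  obtain ⟨σ, hσ⟩ := Module.Projective.out (R := R) (P := P)
  let s₀ : P →ₗ[R] P →₀ (R ⧸ J) := Finsupp.mapRange.linearMap J.mkQ ∘ₗ σ
  have hs₀ : J • ⊤ ≤ LinearMap.ker s₀ := by
    refine Submodule.smul_le.2 fun r hr x _ => ?_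
    rw [LinearMap.mem_ker, map_smul]
    ext i
    obtain ⟨t, ht⟩ := J.mkQ_surjective (s₀ x i)
    rw [Finsupp.smul_apply, ← ht, ← map_smul]
    exact (Submodule.Quotient.mk_eq_zero _).2 (hJ r hr t)
  let p : (P →₀ (R ⧸ J)) →ₗ[R] P ⧸ (J • ⊤ : Submodule R P) := Finsupp.lsum ℕ fun x =>
    J.liftQ ((J • ⊤ : Submodule R P).mkQ ∘ₗ LinearMap.toSpanSingleton R P x) fun r hr =>
      (Submodule.Quotient.mk_eq_zero _).2 (Submodule.smul_mem_smul hr Submodule.mem_top)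
  have hp : p ∘ₗ Finsupp.mapRange.linearMap J.mkQ =
      (J • ⊤ : Submodule R P).mkQ ∘ₗ Finsupp.linearCombination R id := by
    refine Finsupp.lhom_ext fun x r => ?_
    simp only [p, LinearMap.comp_apply, Finsupp.mapRange.linearMap_apply, Finsupp.mapRange_single,
      Finsupp.lsum_single, Finsupp.linearCombination_single, id]
    rfl
  refine ⟨(J • ⊤ : Submodule R P).liftQ s₀ hs₀, p, fun x => ?_⟩
  obtain ⟨x, rfl⟩ := Submodule.mkQ_surjective _ x
  have := LinearMap.congr_fun hp (σ x)
  simp only [LinearMap.comp_apply, hσ x] at this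
  exact this

end Top

/-! ### A linear resolution forces invertible stabilizer orders. -/

section Koszul

open CatAlg

variable {k : Type w} [Field k] {E : Type u} [Category.{v} E] [Fintype E]

namespace IsFiniteFreeEI

variable (hE : IsFiniteFreeEI E)
include hE

theorem idem_mul_sub_mem (y : E) (f : CatAlg k E) :
    idem k y * f * idem k y - idem k y * f ∈ positivePart (lengthGrading k E) := by
  classical
  induction f using induction_of with
  | hof α =>
    rw [CatAlg.idem_mul_of]
    split_ifs with h
    · rw [CatAlg.of_mul_idem]
      split_ifs with h'
      · rw [sub_self]
        exact zero_mem _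
      · rw [zero_sub]
        refine neg_mem (hE.ofHom_mem_positivePart_iff.2 fun hi => h' ?_)
        rw [← h]
        exact hE.eq_of_isIso α.hom
    · simp
  | hzero => simp
  | hadd f g hf hg =>
    rw [mul_add, add_mul, add_sub_add_comm]
    exact add_mem hf hg
  | hsmul r f hf =>
    rw [CatAlg.mul_smul, CatAlg.smul_mul, ← smul_sub]
    exact Submodule.smul_of_tower_mem _ r hf

theorem coeff_eq_zero_of_mem {x y : E} {α : x ⟶ y} [IsIso α] {f : CatAlg k E}
    (hf : f ∈ positivePart (lengthGrading k E)) : coeff ⟨x, y, α⟩ f = 0 :=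
  mem_spanOf_iff.1 (hE.mem_positivePart_iff.1 hf) _ fun h => h inferInstance

theorem coeff_mul_eq_zero_of_mem {x y : E} {α : x ⟶ y} (hα : Unfactorizable α) {f g : CatAlg k E}
    (hf : f ∈ positivePart (lengthGrading k E)) (hg : g ∈ positivePart (lengthGrading k E)) :
    coeff ⟨x, y, α⟩ (f * g) = 0 := by
  rw [hE.mem_positivePart_iff] at hf hg
  refine spanOf_induction (p := fun f => coeff ⟨x, y, α⟩ (f * g) = 0) hf (fun δ hδ => ?_)
    (by simp) (fun f f' h h' => by rw [add_mul, map_add, h, h', add_zero])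
    (fun r f h => by rw [CatAlg.smul_mul, map_smul, h, smul_zero])
  refine spanOf_induction (p := fun g => coeff ⟨x, y, α⟩ (of k δ * g) = 0) hg (fun γ hγ => ?_)
    (by simp) (fun f f' h h' => by rw [mul_add, map_add, h, h', add_zero])
    (fun r f h => by rw [CatAlg.mul_smul, map_smul, h, smul_zero])
  obtain ⟨a, b, f⟩ := γ
  obtain ⟨b', c, g⟩ := δ
  by_cases h : b = b'
  · subst h
    rw [of_eq_ofHom, of_eq_ofHom, ofHom_mul_ofHom]
    refine coeff_of_ne fun h => ?_
    cases h
    exact (hα.2 _ f g rfl).elim hγ hδ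
  · rw [of_eq_ofHom, of_eq_ofHom, ofHom_mul_ofHom_of_ne _ _ h, map_zero]

/-- At y, the module A/J is kAut(y). The coefficient of the identity vanishes on J, so the Higman
map of the regular module descends. -/
theorem isRelProj_degreeZero [∀ x y : E, Finite (x ⟶ y)] (y : E) :
    IsRelProj k (autHom k y) (CatAlg k E ⧸ positivePart (lengthGrading k E)) := by
  set J := positivePart (lengthGrading k E)
  let c : (CatAlg k E ⧸ J) →ₗ[k] k := (J.restrictScalars k).liftQ (coeff ⟨y, y, 𝟙 y⟩)
      (fun f hf => hE.coeff_eq_zero_of_mem hf) ∘ₗ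
    (Submodule.Quotient.restrictScalarsEquiv k J).symm.toLinearMap
  have hc (f : CatAlg k E) : c (J.mkQ f) = coeff ⟨y, y, 𝟙 y⟩ f := rfl
  refine ⟨c.smulRight (J.mkQ (idem k y)), fun f => ?_⟩
  obtain ⟨f, rfl⟩ := J.mkQ_surjective f
  have h := (Submodule.Quotient.mk_eq_zero J).2 (hE.idem_mul_sub_mem y f)
  rw [← Submodule.mkQ_apply, map_sub, sub_eq_zero, ← hE.sum_coeff_autHom, map_sum] at h
  rw [average_apply]
  refine Eq.trans ?_ h
  refine Finset.sum_congr rfl fun g _ => ?_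
  have h1 : autHom k y g⁻¹ • J.mkQ f = J.mkQ (autHom k y g⁻¹ * f) := rfl
  have h2 : autHom k y g • J.mkQ (idem k y) = J.mkQ (autHom k y g) := by
    rw [← map_smul, smul_eq_mul, ← autHom_one, ← map_mul, mul_one]
  rw [h1, LinearMap.smulRight_apply, hc, smul_comm, h2, LinearMap.map_smul_of_tower]

theorem isRelProj_top [∀ x y : E, Finite (x ⟶ y)] (y : E) (P : Type*) [AddCommGroup P]
    [Module k P] [Module (CatAlg k E) P] [IsScalarTower k (CatAlg k E) P]
    [Module.Projective (CatAlg k E) P] :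
    IsRelProj k (autHom k y)
      (P ⧸ ((positivePart (lengthGrading k E) : Ideal (CatAlg k E)) • ⊤ :
        Submodule (CatAlg k E) P)) := by
  obtain ⟨s, p, hps⟩ := exists_retract_top (positivePart (lengthGrading k E))
    (fun r hr s => hE.mul_mem_positivePart hr s) P
  exact ((hE.isRelProj_degreeZero (k := k) y).finsupp P).of_retract s p hps

variable (k) in
/-- Up to isomorphism, a linear resolution of the degree zero part starts with `kE`. -/
theorem exists_equiv_of_linearResolution (R : LinearResolution (lengthGrading k E)
    (degreeZeroGrading (lengthGrading k E))) :
    letI := R.addCommGroup; letI := R.module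
    ∃ e : CatAlg k E ≃ₗ[CatAlg k E] R.P 0,
      ∀ a : CatAlg k E, R.ε (e a) = (positivePart (lengthGrading k E)).mkQ a := by
  let := R.addCommGroup
  let := R.moduleBase
  let := R.module
  have := R.isScalarTower
  set J := positivePart (lengthGrading k E) with hJ
  have h𝒜 := hE.isInternal_lengthGrading (k := k)
  obtain ⟨p, hp⟩ := R.surjective (J.mkQ 1)
  -- The degree 0 component p₀ of a lift of 1 is still a lift: the rest has positive degree, while
  -- the target is concentrated in degree 0.
  obtain ⟨p₀, hp₀, v, hv, -, rfl⟩ := (R.graded 0).exists_add h𝒜 (R.generated 0) p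
  have hεv : R.ε v = 0 := by
    have := map_mem_iSup R.ε R.ε_mem hv
    refine (iSup_le fun i => ?_ : _ ≤ (⊥ : Submodule k (DegreeZero (lengthGrading k E)))) this
    rw [degreeZeroGrading, if_neg (by push_cast; omega)]
  rw [map_add, hεv, add_zero] at hp
  have hε (a : CatAlg k E) : R.ε (a • p₀) = J.mkQ a := by
    rw [map_smul, hp, ← map_smul, smul_eq_mul, mul_one]
  -- The kernel of ε is the image of P 1, which lives in degrees at least 1. So ε is injective on
  -- degree 0, and p₀ generates P 0.
  have hinter (x : R.P 0) (hx : x ∈ R.piece 0 0) (hx' : R.ε x = 0) : x = 0 := by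
    obtain ⟨z, rfl⟩ := (R.exact_zero x).1 hx'
    refine (R.graded 0).eq_zero_of_mem hx (map_mem_iSup (R.d 0) (R.d_mem 0) ?_)
    have := (R.graded 1).mem_iSup_of_generated h𝒜 (R.generated 1) z
    simpa using this
  let q : CatAlg k E →ₗ[CatAlg k E] R.P 0 := LinearMap.toSpanSingleton _ _ p₀
  have hq : Function.Surjective q := by
    rw [← LinearMap.range_eq_top, eq_top_iff, ← R.generated 0, Submodule.span_le]
    intro x hx
    obtain ⟨a, ha⟩ := J.mkQ_surjective (R.ε x)
    let a₀ := proj k {α | HasLength α 0} a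
    have ha₀ : a₀ ∈ lengthGrading k E 0 := by
      have := proj_mem (S := {α : Mor E | HasLength α 0}) (mem_spanOf_univ a)
      rwa [Set.inter_univ] at this
    have ha₁ : J.mkQ a = J.mkQ a₀ := by
      rw [← sub_eq_zero, ← map_sub]
      refine (Submodule.Quotient.mk_eq_zero J).2 (hE.mem_positivePart_iff.2 ?_)
      refine Submodule.span_mono (Set.image_mono fun α hα => ?_) (sub_proj_mem a)
      exact fun h => hα ((hasLength_zero_iff α).2 h)
    refine ⟨a₀, (sub_eq_zero.1 (hinter _ (sub_mem hx ?_) ?_)).symm⟩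
    · have := (R.graded 0).smul_mem 0 0 a₀ ha₀ p₀ hp₀
      simpa using! this
    · rw [map_sub, ← ha, ha₁]
      exact sub_eq_zero.2 (hε a₀).symm
  have := R.projective 0
  obtain ⟨σ, hσ⟩ := Module.projective_lifting_property q LinearMap.id hq
  have hσ (x : R.P 0) : q (σ x) = x := LinearMap.congr_fun hσ x
  -- Modulo the nilpotent J, σ(p₀) is 1, hence it is a unit. If a p₀ = 0 then a σ(p₀) = 0, so a = 0.
  have hu : 1 - σ p₀ ∈ J := by
    refine (Submodule.Quotient.mk_eq_zero J).1 ?_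
    rw [← Submodule.mkQ_apply, ← hε, sub_smul, one_smul, show σ p₀ • p₀ = p₀ from hσ p₀, sub_self,
      map_zero]
  have hu' : IsUnit (σ p₀) := by
    have := (hE.isNilpotent_of_mem_positivePart hu).isUnit_one_sub
    rwa [sub_sub_cancel] at this
  refine ⟨LinearEquiv.ofBijective q ⟨(injective_iff_map_eq_zero q).2 fun a ha =>
    hu'.mul_left_eq_zero.1 ?_, hq⟩, hε⟩
  have ha : a • p₀ = 0 := ha
  rw [← smul_eq_mul, ← map_smul, ha, map_zero]

/-- In a linear resolution of the degree zero part, the kernel of the first differential lies in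
`J P`. -/
theorem ker_d_le (R : LinearResolution (lengthGrading k E)
    (degreeZeroGrading (lengthGrading k E))) :
    letI := R.addCommGroup; letI := R.module
    LinearMap.ker (R.d 0) ≤ (positivePart (lengthGrading k E) : Ideal (CatAlg k E)) • ⊤ := by
  let := R.addCommGroup
  let := R.moduleBase
  let := R.module
  have := R.isScalarTower
  have h𝒜 := hE.isInternal_lengthGrading (k := k)
  intro x hx
  obtain ⟨z, rfl⟩ := (R.exact_succ 0 x).1 hx
  have h2 := map_mem_iSup (R.d 1) (R.d_mem 1)
    ((R.graded 2).mem_iSup_of_generated h𝒜 (R.generated 2) z)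
  obtain ⟨y, hy, t, ht, ht', h⟩ := (R.graded 1).exists_add h𝒜 (R.generated 1) (R.d 1 z)
  -- The kernel is the image of P 2 and so lies in degrees at least 2, which kills the degree 1
  -- component; what remains of P 1, being generated in degree 1, is in JP.
  have hy0 : y = 0 := (R.graded 1).eq_zero_of_mem hy (by
    rw [eq_sub_of_add_eq h.symm]
    refine sub_mem ?_ ht
    exact_mod_cast h2)
  subst hy0
  rw [zero_add] at h
  exact h ▸ ht'

/-- If the degree zero part has a linear resolution, then the stabilizers of the unfactorizable
morphisms have invertible order. -/
theorem isWeighted_of_linearResolution [∀ x y : E, Finite (x ⟶ y)]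
    (R : LinearResolution (lengthGrading k E) (degreeZeroGrading (lengthGrading k E)))
    {x y : E} (β : x ⟶ y) (hβ : Unfactorizable β) : IsWeighted k β := by
  let := R.addCommGroup
  let := R.moduleBase
  let := R.module
  have := R.isScalarTower
  have := R.projective 1
  obtain ⟨e, he⟩ := hE.exists_equiv_of_linearResolution k R
  have hker := hE.ker_d_le R
  set J := positivePart (lengthGrading k E)
  let D : R.P 1 →ₗ[CatAlg k E] CatAlg k E := e.symm.toLinearMap ∘ₗ R.d 0
  have heD (z : R.P 1) : e (D z) = R.d 0 z := e.apply_symm_apply _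
  have hD (z : R.P 1) : D z ∈ J := by
    refine (Submodule.Quotient.mk_eq_zero J).1 ?_
    rw [← Submodule.mkQ_apply, ← he, heD]
    exact (R.exact_zero _).2 ⟨z, rfl⟩
  have hDker (z : R.P 1) (hz : D z = 0) :
      Submodule.Quotient.mk (p := (J : Ideal (CatAlg k E)) • (⊤ : Submodule (CatAlg k E) (R.P 1)))
        z = 0 := by
    refine (Submodule.Quotient.mk_eq_zero _).2 (hker ?_)
    rw [LinearMap.mem_ker, ← heD, hz, map_zero]
  obtain ⟨z, hz⟩ : ∃ z, D z = ofHom k β := by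
    obtain ⟨z, hz⟩ := (R.exact_zero (e (ofHom k β))).1 (by
      rw [he]
      exact (Submodule.Quotient.mk_eq_zero J).2 (hE.ofHom_mem_positivePart_iff.2 hβ.1))
    exact ⟨z, e.injective (by rw [heD, hz])⟩
  let N : Submodule (CatAlg k E) (R.P 1) := (J : Ideal (CatAlg k E)) • ⊤
  -- D maps P 1 into J, hence JP 1 into J², where an unfactorizable morphism has coefficient zero.
  have hN : N.restrictScalars k ≤ LinearMap.ker (coeff ⟨x, y, β⟩ ∘ₗ D.restrictScalars k) := by
    intro n hn
    have hn : n ∈ N := hn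
    refine Submodule.smul_induction_on hn (fun r hr m _ => ?_) fun _ _ => add_mem
    change coeff ⟨x, y, β⟩ (D (r • m)) = 0
    rw [map_smul]
    exact hE.coeff_mul_eq_zero_of_mem hβ hr (hD m)
  let c : (R.P 1 ⧸ N) →ₗ[k] k := (N.restrictScalars k).liftQ _ hN ∘ₗ
    (Submodule.Quotient.restrictScalarsEquiv k N).symm.toLinearMap
  have hc (m : R.P 1) : c (N.mkQ m) = coeff ⟨x, y, β⟩ (D m) := rfl
  refine (hE.isRelProj_top (k := k) y (R.P 1)).exists_weight β (N.mkQ z) c (fun g hg => ?_)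
    (fun g hg m => ?_) ?_
  -- For g in the stabilizer, gz and z have the same image β, so they differ by an element of the
  -- kernel of D, which is zero modulo JP 1.
  · rw [← map_smul, ← sub_eq_zero, ← map_sub]
    refine hDker _ ?_
    rw [map_sub, map_smul, hz, smul_eq_mul, autHom_mul_ofHom, hg, sub_self]
  · obtain ⟨m, rfl⟩ := N.mkQ_surjective m
    rw [← map_smul, hc, hc, map_smul]
    have := coeff_autHom_mul g β (D m)
    rwa [hg] at this
  · rw [hc, hz]
    exact coeff_of_self _

end IsFiniteFreeEI

end Koszul

/-! ### Standard modules, trace submodules and stabilizers. -/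

section Standard

open CatAlg

variable {k : Type w} [Field k] {E : Type u} [Category.{v} E] [Fintype E]

namespace StratIndex

variable (l : StratIndex k E)

theorem e_mem_proj : l.e ∈ l.proj := Submodule.mem_span_singleton_self _

theorem mul_e {f : CatAlg k E} (hf : f ∈ l.proj) : f * l.e = f := by
  obtain ⟨a, rfl⟩ := Submodule.mem_span_singleton.1 hf
  rw [smul_eq_mul, mul_assoc, l.primitive.idem.eq]

theorem mul_e_mem_proj (f : CatAlg k E) : f * l.e ∈ l.proj :=
  Submodule.smul_mem _ f l.e_mem_proj

theorem mul_idem_of_mem {f : CatAlg k E} (hf : f ∈ l.proj) : f * idem k l.obj = f := by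
  rw [← l.mul_e hf, mul_assoc, l.mul_idem]

end StratIndex

namespace IsFiniteFreeEI

variable (hE : IsFiniteFreeEI E)
include hE

theorem idem_mul_mul_idem_mem {x y : E} (h : x ≠ y) (f : CatAlg k E) :
    idem k y * f * idem k x ∈ positivePart (lengthGrading k E) := by
  classical
  induction f using induction_of with
  | hof α =>
    rw [CatAlg.idem_mul_of]
    split_ifs with hy
    · rw [CatAlg.of_mul_idem]
      split_ifs with hx
      · refine hE.ofHom_mem_positivePart_iff.2 fun hi => h ?_
        rw [← hx, ← hy]
        exact hE.eq_of_isIso α.hom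
      · exact zero_mem _
    · rw [zero_mul]
      exact zero_mem _
  | hzero => simp
  | hadd f g hf hg =>
    rw [mul_add, add_mul]
    exact add_mem hf hg
  | hsmul r f hf =>
    rw [CatAlg.mul_smul, CatAlg.smul_mul]
    exact Submodule.smul_of_tower_mem _ r hf

theorem idem_mul_mul_idem_eq_zero {x y : E} (h : Nonempty (y ⟶ x)) {f : CatAlg k E}
    (hf : f ∈ positivePart (lengthGrading k E)) : idem k y * f * idem k x = 0 := by
  classical
  rw [hE.mem_positivePart_iff] at hf
  refine spanOf_induction (p := fun f => idem k y * f * idem k x = 0) hf (fun α hα => ?_) (by simp)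
    (fun f g hf hg => by rw [mul_add, add_mul, hf, hg, add_zero])
    (fun r f hf => by rw [CatAlg.mul_smul, CatAlg.smul_mul, hf, smul_zero])
  rw [CatAlg.idem_mul_of]
  split_ifs with hy
  · rw [CatAlg.of_mul_idem, if_neg]
    rintro rfl
    subst hy
    exact hα (hE.isIso_of_hom α.hom h.some)
  · rw [zero_mul]

variable (k) in
/-- The identity of an object is a sum of primitive idempotents of its endomorphism algebra. -/
theorem exists_stratIndex_sum (y : E) : ∃ (n : ℕ) (μ : Fin n → StratIndex k E),
    (∀ i, (μ i).obj = y) ∧ ∑ i, (μ i).e = idem k y := by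
  have := hE.finite_hom
  obtain ⟨n, f, hf, hs⟩ := exists_primitive_decomposition k (idem k y) (idem_mul_idem y)
  exact ⟨n, fun i => ⟨y, f i, (hf i).2.1, (hf i).2.2, (hf i).1⟩, fun _ => rfl, hs⟩

/-- Identifies Δ_l with Ae/(J ∩ Ae), concentrated at the object x of l. The image of a generator e_μ
lies in 1_y A 1_x with y ≠ x, hence in J. Conversely, for f in J the component 1_y f vanishes if
there is a morphism y ⟶ x; otherwise it is a sum of elements e_μ f, each in a trace. -/
theorem mem_traceSum_iff (l : StratIndex k E) (f : l.proj) :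
    f ∈ l.traceSum ↔ f.1 ∈ positivePart (lengthGrading k E) := by
  constructor
  · intro hf
    have : l.traceSum ≤ (positivePart (lengthGrading k E)).comap l.proj.subtype := by
      refine iSup_le fun μ => iSup_le fun hμ => iSup_le fun φ => ?_
      rintro _ ⟨⟨a, ha⟩, rfl⟩
      obtain ⟨a, rfl⟩ := Submodule.mem_span_singleton.1 ha
      have h1 : (⟨a • μ.e, ha⟩ : μ.proj) = a • ⟨μ.e, μ.e_mem_proj⟩ := rfl
      rw [h1, map_smul]
      refine Submodule.smul_mem _ _ ?_
      have h2 : idem k μ.obj • (⟨μ.e, μ.e_mem_proj⟩ : μ.proj) = ⟨μ.e, μ.e_mem_proj⟩ :=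
        Subtype.ext μ.idem_mul
      have h3 : idem k μ.obj * (φ ⟨μ.e, μ.e_mem_proj⟩).1 * idem k l.obj =
          (φ ⟨μ.e, μ.e_mem_proj⟩).1 := by
        rw [mul_assoc, l.mul_idem_of_mem (φ _).2]
        exact congrArg Subtype.val ((φ.map_smul _ _).symm.trans (congrArg φ h2))
      change (φ ⟨μ.e, μ.e_mem_proj⟩).1 ∈ positivePart (lengthGrading k E)
      rw [← h3]
      refine hE.idem_mul_mul_idem_mem (fun h => hμ ?_) _
      rw [StratIndex.le, ← h]
      exact ⟨𝟙 _⟩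
    exact this hf
  · intro hf
    have h1 : f = ∑ y : E, idem k y • f := by
      rw [← Finset.sum_smul, sum_idem, one_smul]
    rw [h1]
    refine sum_mem fun y _ => ?_
    by_cases hy : Nonempty (y ⟶ l.obj)
    · have h2 : idem k y • f = 0 := Subtype.ext (by
        have h3 := hE.idem_mul_mul_idem_eq_zero hy hf
        rwa [mul_assoc, l.mul_idem_of_mem f.2] at h3)
      rw [h2]
      exact zero_mem _
    · obtain ⟨n, μ, hμ, hs⟩ := hE.exists_stratIndex_sum k y
      rw [← hs, Finset.sum_smul]
      refine sum_mem fun i _ => ?_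
      have hle : ¬ (μ i).le l := by rwa [StratIndex.le, hμ]
      let φ : (μ i).proj →ₗ[CatAlg k E] l.proj :=
        LinearMap.toSpanSingleton (CatAlg k E) l.proj f ∘ₗ (μ i).proj.subtype
      exact Submodule.mem_iSup_of_mem (μ i) (Submodule.mem_iSup_of_mem hle
        (Submodule.mem_iSup_of_mem φ ⟨⟨(μ i).e, (μ i).e_mem_proj⟩, rfl⟩))

theorem idem_smul_standard (l : StratIndex k E) {y : E} (hy : l.obj ≠ y) (m : l.standard) :
    idem k y • m = 0 := by
  obtain ⟨f, rfl⟩ := l.traceSum.mkQ_surjective m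
  rw [← map_smul]
  refine (Submodule.Quotient.mk_eq_zero _).2 ((hE.mem_traceSum_iff l _).2 ?_)
  have := hE.idem_mul_mul_idem_mem hy f.1
  rwa [mul_assoc, l.mul_idem_of_mem f.2] at this

variable [∀ x y : E, Finite (x ⟶ y)]

theorem isRelProj_standard (l : StratIndex k E) (y : E) :
    IsRelProj k (autHom k y) l.standard := by
  by_cases hy : l.obj = y
  · let c : l.standard →ₗ[k] k := (l.traceSum.restrictScalars k).liftQ
        (coeff ⟨y, y, 𝟙 y⟩ ∘ₗ l.proj.subtype.restrictScalars k)
        (fun f hf => hE.coeff_eq_zero_of_mem ((hE.mem_traceSum_iff l f).1 hf)) ∘ₗ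
      (Submodule.Quotient.restrictScalarsEquiv k l.traceSum).symm.toLinearMap
    have hc (f : l.proj) : c (l.traceSum.mkQ f) = coeff ⟨y, y, 𝟙 y⟩ f.1 := rfl
    refine ⟨c.smulRight (l.traceSum.mkQ ⟨l.e, l.e_mem_proj⟩), fun f => ?_⟩
    obtain ⟨f, rfl⟩ := l.traceSum.mkQ_surjective f
    have h1 (g : Aut y) : autHom k y g • (c.smulRight (l.traceSum.mkQ ⟨l.e, l.e_mem_proj⟩))
        (autHom k y g⁻¹ • l.traceSum.mkQ f) = (coeff ⟨y, y, 𝟙 y⟩ (autHom k y g⁻¹ * f.1) •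
          autHom k y g) • l.traceSum.mkQ ⟨l.e, l.e_mem_proj⟩ := by
      have h2 : autHom k y g⁻¹ • l.traceSum.mkQ f = l.traceSum.mkQ (autHom k y g⁻¹ • f) := rfl
      rw [h2, LinearMap.smulRight_apply, hc, smul_comm, ← smul_assoc]
      rfl
    rw [average_apply, Finset.sum_congr rfl fun g _ => h1 g, ← Finset.sum_smul,
      hE.sum_coeff_autHom, ← map_smul, autHom_one, ← map_smul]
    congr 1
    refine Subtype.ext ?_
    change idem k y * f.1 * idem k y * l.e = idem k y * f.1
    subst hy
    rw [mul_assoc, l.idem_mul, mul_assoc, l.mul_e f.2]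
  · exact .of_one_smul_eq_zero fun m => hE.idem_smul_standard l hy m

/-- Each standard module is projective over kAut(y) or zero at y, and relative projectivity is
closed under extensions. -/
theorem isRelProj_of_hasDeltaFiltration (y : E) {S : Set (StratIndex k E)} {M : Type*}
    [AddCommGroup M] [Module k M] [Module (CatAlg k E) M] [IsScalarTower k (CatAlg k E) M]
    (h : HasDeltaFiltration S M) : IsRelProj k (autHom k y) M := by
  obtain ⟨n, F, hF0, hFn, hF⟩ := h
  have key (i : ℕ) (hi : i ≤ n) : IsRelProj k (autHom k y) (F i) := by
    induction i with
    | zero =>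
      refine .of_one_smul_eq_zero fun m => Subtype.ext ?_
      have hm := m.2
      exact (Submodule.mem_bot _).1 (hF0.le (Submodule.smul_mem _ _ hm))
    | succ i ih =>
      obtain ⟨hle, μ, -, ⟨e⟩⟩ := hF i hi
      have h1 := ih (by omega)
      have h2 := (hE.isRelProj_standard μ y).of_equiv e.symm
      exact (h1.of_equiv (Submodule.submoduleOfEquivOfLe hle).symm).of_exact_middle h2
        (Submodule.subtype_injective _) (Submodule.mkQ_surjective _)
        (LinearMap.exact_subtype_mkQ _)
  have hn := key n le_rfl
  exact hn.of_equiv ((LinearEquiv.ofEq _ _ hFn).trans Submodule.topEquiv)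

/-- If `E` is standardly stratified, then the stabilizers of the unfactorizable morphisms have
invertible order. -/
theorem isWeighted_of_isStandardlyStratified (h : IsStandardlyStratified k E) {x y : E}
    (β : x ⟶ y) (hβ : Unfactorizable β) : IsWeighted k β := by
  obtain ⟨n, μ, hμ, hs⟩ := hE.exists_stratIndex_sum k x
  have hmem (i : Fin n) : ofHom k β * (μ i).e ∈ (μ i).proj := (μ i).mul_e_mem_proj _
  have hmem' (i : Fin n) : (⟨_, hmem i⟩ : (μ i).proj) ∈ (μ i).traceSum :=
    (hE.mem_traceSum_iff _ _).2 (hE.mul_mem_positivePart (hE.ofHom_mem_positivePart_iff.2 hβ.1) _)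
  have hrel : IsRelProj k (autHom k y) (∀ i, (μ i).traceSum) :=
    .pi fun i => hE.isRelProj_of_hasDeltaFiltration y (h (μ i))
  let ι (i : Fin n) : (μ i).traceSum →ₗ[CatAlg k E] CatAlg k E :=
    (μ i).proj.subtype ∘ₗ (μ i).traceSum.subtype
  -- The element β is represented by the tuple of the βe_i, and s adds the components back together
  -- because ∑ e_i = 1_x. A product is used because β itself need not lie in a single P_l.
  let s : (∀ i, (μ i).traceSum) →ₗ[CatAlg k E] CatAlg k E := ∑ i, ι i ∘ₗ LinearMap.proj i
  refine hrel.exists_weight β (fun i => ⟨_, hmem' i⟩)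
    (coeff ⟨x, y, β⟩ ∘ₗ s.restrictScalars k) (fun g hg => ?_) (fun g hg m => ?_) ?_
  · refine funext fun i => Subtype.ext (Subtype.ext ?_)
    change autHom k y g * (ofHom k β * (μ i).e) = ofHom k β * (μ i).e
    rw [← mul_assoc, autHom_mul_ofHom, hg]
  · have := coeff_autHom_mul g β (s m)
    rw [hg] at this
    rw [LinearMap.comp_apply, LinearMap.comp_apply, LinearMap.restrictScalars_apply,
      LinearMap.restrictScalars_apply, map_smul]
    exact this
  · have h1 : s (fun i => ⟨_, hmem' i⟩) = ofHom k β := by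
      simp only [s, LinearMap.sum_apply]
      change ∑ i, ofHom k β * (μ i).e = ofHom k β
      rw [← Finset.mul_sum, hs, ofHom_mul_idem]
    rw [LinearMap.comp_apply, LinearMap.restrictScalars_apply, h1]
    exact coeff_of_self _

/-- If all morphisms are weighted, the kernel of `P_l → Δ_l` is relatively projective. -/
theorem isRelProj_traceSum (hw : ∀ (x y : E) (β : x ⟶ y), IsWeighted k β) (l : StratIndex k E)
    (y : E) : IsRelProj k (autHom k y) l.traceSum := by
  classical
  choose W hW using fun x y : E => exists_uniform_weight (k := k) (G := Aut y) (X := x ⟶ y)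
  -- Rescaling each morphism by its weight gives a Higman map on all of A that preserves J.
  -- Multiplication by e on the right, which commutes with the left action, brings it back into P_l.
  let θ : CatAlg k E →ₗ[k] CatAlg k E := CatAlg.lift fun α => W α.src α.tgt α.hom • of k α
  have hθ {x y : E} (α : x ⟶ y) : θ (ofHom k α) = W x y α • ofHom k α := CatAlg.lift_of _ _
  have hθJ {f : CatAlg k E} (hf : f ∈ positivePart (lengthGrading k E)) :
      θ f ∈ positivePart (lengthGrading k E) := by
    refine spanOf_induction (p := fun f => θ f ∈ positivePart (lengthGrading k E))
      (hE.mem_positivePart_iff.1 hf) (fun α hα => ?_) (by simp)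
      (fun f g hf hg => by rw [map_add]; exact add_mem hf hg)
      (fun r f hf => by rw [map_smul]; exact Submodule.smul_of_tower_mem _ r hf)
    rw [of_eq_ofHom, hθ]
    exact Submodule.smul_of_tower_mem _ _ (hE.ofHom_mem_positivePart_iff.2 hα)
  have havg (f : CatAlg k E) :
      ∑ g : Aut y, autHom k y g * θ (autHom k y g⁻¹ * f) = idem k y * f := by
    induction f using induction_of with
    | hof α =>
      obtain ⟨x, z, f⟩ := α
      rw [of_eq_ofHom]
      by_cases hz : z = y
      · subst hz
        have h1 (g : Aut z) : autHom k z g * θ (autHom k z g⁻¹ * ofHom k f) =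
            W x z (g⁻¹ • f) • ofHom k f := by
          rw [autHom_mul_ofHom, hθ, CatAlg.mul_smul, autHom_mul_ofHom, smul_inv_smul]
        rw [idem_mul_ofHom, Finset.sum_congr rfl fun g _ => h1 g, ← Finset.sum_smul]
        have h2 := hW x z f (hw x z f)
        rw [← Equiv.sum_comp (Equiv.inv (Aut z))] at h2
        simp only [Equiv.inv_apply] at h2
        rw [h2, one_smul]
      · rw [idem_eq_ofHom (k := k) y, ofHom_mul_ofHom_of_ne _ _ hz]
        refine Finset.sum_eq_zero fun g _ => ?_
        rw [autHom_apply y g⁻¹, ofHom_mul_ofHom_of_ne _ _ hz, map_zero, mul_zero]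
    | hzero => simp
    | hadd f g hf hg => simp only [mul_add, map_add, Finset.sum_add_distrib, hf, hg]
    | hsmul r f hf => simp only [CatAlg.mul_smul, map_smul, ← Finset.smul_sum, hf]
  let Θ : l.traceSum →ₗ[k] l.traceSum :=
    { toFun := fun f => ⟨⟨θ f.1.1 * l.e, l.mul_e_mem_proj _⟩, (hE.mem_traceSum_iff l _).2
        (hE.mul_mem_positivePart (hθJ ((hE.mem_traceSum_iff l _).1 f.2)) _)⟩
      map_add' := fun f g => Subtype.ext (Subtype.ext (by
        change θ (f.1.1 + g.1.1) * l.e = θ f.1.1 * l.e + θ g.1.1 * l.e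
        rw [map_add, add_mul]))
      map_smul' := fun r f => Subtype.ext (Subtype.ext (by
        change θ (r • f.1.1) * l.e = r • (θ f.1.1 * l.e)
        rw [map_smul, CatAlg.smul_mul])) }
  refine ⟨Θ, fun f => Subtype.ext (Subtype.ext ?_)⟩
  rw [average_apply, AddSubmonoidClass.coe_finsetSum, AddSubmonoidClass.coe_finsetSum]
  change ∑ g : Aut y, autHom k y g * (θ (autHom k y g⁻¹ * f.1.1) * l.e) = idem k y * f.1.1
  simp only [← mul_assoc]
  rw [← Finset.sum_mul]
  simp only [havg]
  rw [mul_assoc, l.mul_e f.1.2]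

end IsFiniteFreeEI

end Standard

/-! ### Fitting's lemma and a weak form of Krull–Schmidt. -/

section Endomorphisms

variable {R : Type*} [Ring R] {M : Type*} [AddCommGroup M] [Module R M]

/-- An endomorphism of an indecomposable module of finite length is injective or nilpotent. -/
theorem injective_or_isNilpotent [IsNoetherian R M] [IsArtinian R M]
    (h : ∀ p : Module.End R M, IsIdempotentElem p → p = 0 ∨ p = 1) (φ : Module.End R M) :
    Function.Injective φ ∨ IsNilpotent φ := by
  -- Fitting decomposition: the projection onto the stable kernel is an idempotent, so it is 0 (φ is
  -- injective) or 1 (φ is nilpotent).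
  have hc := φ.isCompl_iSup_ker_pow_iInf_range_pow
  set K := ⨆ n, LinearMap.ker (φ ^ n)
  let p : Module.End R M := K.subtype ∘ₗ K.projectionOnto _ hc
  have hpK (x : M) (hx : x ∈ K) : p x = x :=
    congrArg Subtype.val (Submodule.projectionOnto_apply_left hc ⟨x, hx⟩)
  have hp : IsIdempotentElem p := LinearMap.ext fun x => hpK (p x) (Subtype.mem _)
  rcases h p hp with h0 | h1
  · refine Or.inl (LinearMap.ker_eq_bot.1 (eq_bot_iff.2 fun x hx => ?_))
    have hxK : x ∈ K := Submodule.mem_iSup_of_mem 1 (by rwa [pow_one])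
    rw [← hpK x hxK, h0]
    exact zero_mem _
  · obtain ⟨n, hn⟩ := Filter.eventually_atTop.1 φ.eventually_iSup_ker_pow_eq
    refine Or.inr ⟨n, LinearMap.ext fun x => ?_⟩
    have hx : x ∈ K := by
      have h2 : p x = x := by rw [h1]; rfl
      rw [← h2]
      exact Subtype.mem _
    exact (hn n le_rfl).le hx

/-- If the identity of a nonzero module `N` is a sum of maps factoring through modules `D t` whose
endomorphisms are injective or nilpotent, then some `D t` embeds into `N`. -/
theorem exists_injective_of_sum_eq_one {N : Type*} [AddCommGroup N] [Module R N] [Nontrivial N]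
    {ι : Type*} [Fintype ι] {D : ι → Type*} [∀ t, AddCommGroup (D t)] [∀ t, Module R (D t)]
    (hD : ∀ t (φ : Module.End R (D t)), Function.Injective φ ∨ IsNilpotent φ)
    (f : ∀ t, N →ₗ[R] D t) (g : ∀ t, D t →ₗ[R] N) (h : ∀ x, ∑ t, g t (f t x) = x) :
    ∃ t, ∃ i : D t →ₗ[R] N, Function.Injective i := by
  by_contra! hc
  -- If no D t embeds, then ψg is never injective, so fψg is nilpotent, and therefore so is ψgf.
  -- Each gf is thus in the Jacobson radical of End(N), and so is their sum 1, which is absurd for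
  -- nonzero N.
  have hmem (t : ι) : (g t ∘ₗ f t : Module.End R N) ∈
      Ideal.jacobson (⊥ : Ideal (Module.End R N)) := by
    refine Ideal.mem_jacobson_iff.2 fun ψ => ?_
    obtain ⟨n, hn⟩ : IsNilpotent (f t ∘ₗ ψ ∘ₗ g t : Module.End R (D t)) :=
      (hD t _).resolve_left fun hi => hc t (ψ ∘ₗ g t) fun x y hxy =>
        hi (congrArg (f t) hxy)
    have hpow (j : ℕ) : (ψ * (g t ∘ₗ f t)) ^ (j + 1) =
        ψ ∘ₗ g t ∘ₗ ((f t ∘ₗ ψ ∘ₗ g t : Module.End R (D t)) ^ j) ∘ₗ f t := by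
      induction j with
      | zero => rw [zero_add, pow_one, pow_zero]; rfl
      | succ j ih =>
        rw [pow_succ, ih, pow_succ]
        rfl
    have hnil : IsNilpotent (ψ * (g t ∘ₗ f t : Module.End R N)) :=
      ⟨n + 1, by rw [hpow, hn]; ext; simp⟩
    obtain ⟨u, hu⟩ := hnil.isUnit_one_add
    refine ⟨(u⁻¹ : (Module.End R N)ˣ), ?_⟩
    have h1 : (u⁻¹ : (Module.End R N)ˣ) * (1 + ψ * (g t ∘ₗ f t : Module.End R N)) = 1 := by
      rw [← hu, Units.inv_mul]
    rw [Ideal.mem_bot, mul_assoc, ← h1]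
    rw [mul_add, mul_one]
    abel
  have hone : (1 : Module.End R N) ∈ Ideal.jacobson (⊥ : Ideal (Module.End R N)) := by
    have h1 : (1 : Module.End R N) = ∑ t, g t ∘ₗ f t := LinearMap.ext fun x => by
      rw [LinearMap.sum_apply]
      exact (h x).symm
    rw [h1]
    exact sum_mem fun t _ => hmem t
  have htop : (⊥ : Ideal (Module.End R N)) = ⊤ :=
    Ideal.jacobson_eq_top_iff.1 ((Ideal.eq_top_iff_one _).2 hone)
  have h01 : (1 : Module.End R N) = 0 := by
    have : (1 : Module.End R N) ∈ (⊥ : Ideal (Module.End R N)) := htop ▸ Submodule.mem_top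
    exact this
  exact one_ne_zero h01

end Endomorphisms

/-! ### Construction of standard filtrations. -/

section Filtration

open CatAlg

variable {k : Type w} [Field k] {E : Type u} [Category.{v} E] [Fintype E]

/-- A delta filtration of a quotient by a standard module extends to the whole module. -/
theorem HasDeltaFiltration.of_quotient {S : Set (StratIndex k E)} {M : Type*} [AddCommGroup M]
    [Module (CatAlg k E) M] {D : Submodule (CatAlg k E) M} {μ : StratIndex k E} (hμ : μ ∈ S)
    (e : D ≃ₗ[CatAlg k E] μ.standard) (h : HasDeltaFiltration S (M ⧸ D)) :
    HasDeltaFiltration S M := by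
  obtain ⟨n, F, hF0, hFn, hF⟩ := h
  let F' : ℕ → Submodule (CatAlg k E) M
    | 0 => ⊥
    | i + 1 => (F i).comap D.mkQ
  have hF1 : F' 1 = D := by
    change (F 0).comap D.mkQ = D
    rw [hF0, Submodule.comap_bot, Submodule.ker_mkQ]
  refine ⟨n + 1, F', rfl, ?_, fun i hi => ?_⟩
  · change (F n).comap D.mkQ = ⊤
    rw [hFn, Submodule.comap_top]
  · cases i with
    | zero =>
      refine ⟨bot_le, μ, hμ, ⟨?_⟩⟩
      have h0 : (F' 0).submoduleOf (F' (0 + 1)) = ⊥ := by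
        change (⊥ : Submodule (CatAlg k E) M).comap (F' (0 + 1)).subtype = ⊥
        rw [Submodule.comap_bot, Submodule.ker_subtype]
      exact (Submodule.quotEquivOfEqBot _ h0).trans ((LinearEquiv.ofEq _ _ hF1).trans e)
    | succ i =>
      obtain ⟨hle, ν, hν, ⟨e'⟩⟩ := hF i (by omega)
      refine ⟨Submodule.comap_mono hle, ν, hν, ?_⟩
      let q : F' (i + 1 + 1) →ₗ[CatAlg k E] F (i + 1) :=
        (D.mkQ ∘ₗ (F' (i + 1 + 1)).subtype).codRestrict (F (i + 1)) fun x => x.2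
      have hq : Function.Surjective q := fun y => by
        obtain ⟨x, hx⟩ := D.mkQ_surjective y.1
        exact ⟨⟨x, by change D.mkQ x ∈ F (i + 1); rw [hx]; exact y.2⟩, Subtype.ext hx⟩
      let q' : F' (i + 1 + 1) →ₗ[CatAlg k E] (F (i + 1) ⧸ (F i).submoduleOf (F (i + 1))) :=
        ((F i).submoduleOf (F (i + 1))).mkQ ∘ₗ q
      have hq' : Function.Surjective q' :=
        (Submodule.mkQ_surjective ((F i).submoduleOf (F (i + 1)))).comp hq
      have hker : (F' (i + 1)).submoduleOf (F' (i + 1 + 1)) = LinearMap.ker q' := by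
        ext x
        rw [LinearMap.mem_ker, LinearMap.comp_apply, Submodule.mkQ_apply,
          Submodule.Quotient.mk_eq_zero]
        rfl
      exact ⟨((Submodule.quotEquivOfEq _ _ hker).trans
        (q'.quotKerEquivOfSurjective hq')).trans e'⟩

/-- A map which commutes with `Aut y` between modules supported on `y` is `kE`-linear. -/
theorem smul_eq_of_isEquivariant (hE : IsFiniteFreeEI E) {y : E} {M N : Type*} [AddCommGroup M]
    [Module k M] [Module (CatAlg k E) M] [IsScalarTower k (CatAlg k E) M] [AddCommGroup N]
    [Module k N] [Module (CatAlg k E) N] [IsScalarTower k (CatAlg k E) N]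
    (hM : ∀ m : M, idem k y • m = m) (hN : ∀ n : N, idem k y • n = n) (f : M →ₗ[k] N)
    (hf : IsEquivariant (autHom k y) f) (c : CatAlg k E) (m : M) : f (c • m) = c • f m := by
  classical
  induction c using induction_of with
  | hof α =>
    by_cases h : α.src = y ∧ α.tgt = y
    · obtain ⟨x, z, α⟩ := α
      obtain ⟨rfl, h⟩ := h
      obtain rfl : z = x := h
      have := hE.isIso_of_end z α
      exact hf (asIso α) m
    · have h0 : idem k y * of k α * idem k y = 0 := by
        rw [CatAlg.idem_mul_of]
        split_ifs with h1
        · rw [CatAlg.of_mul_idem, if_neg fun h2 => h ⟨h2, h1⟩]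
        · exact zero_mul _
      have h1 : of k α • m = 0 := by
        rw [← hM (of k α • m)]
        conv_lhs => rw [← hM m]
        rw [smul_smul, smul_smul, h0, zero_smul]
      have h2 : of k α • f m = 0 := by
        rw [← hN (of k α • f m)]
        conv_lhs => rw [← hN (f m)]
        rw [smul_smul, smul_smul, h0, zero_smul]
      rw [h1, h2, map_zero]
  | hzero => simp
  | hadd c d hc hd => rw [add_smul, map_add, hc, hd, add_smul]
  | hsmul r c hc => rw [smul_assoc, map_smul, hc, smul_assoc]

theorem idem_mul_mul_idem_eq_zero_of_isEmpty {y z : E} (h : IsEmpty (y ⟶ z)) (f : CatAlg k E) :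
    idem k z * f * idem k y = 0 := by
  classical
  induction f using induction_of with
  | hof α =>
    rw [CatAlg.idem_mul_of]
    split_ifs with hz
    · rw [CatAlg.of_mul_idem, if_neg]
      rintro rfl
      subst hz
      exact h.elim α.hom
    · rw [zero_mul]
  | hzero => simp
  | hadd f g hf hg => rw [mul_add, add_mul, hf, hg, add_zero]
  | hsmul r f hf => rw [CatAlg.mul_smul, CatAlg.smul_mul, hf, smul_zero]

/-- A relatively projective module supported on `y` has equivariant coordinates with values in the
category algebra. -/
theorem exists_coordinates [∀ x y : E, Finite (x ⟶ y)] {y : E} {N : Type*} [AddCommGroup N]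
    [Module k N] [Module (CatAlg k E) N] [IsScalarTower k (CatAlg k E) N] [Module.Finite k N]
    (hN : ∀ m : N, idem k y • m = m) (hrel : IsRelProj k (autHom k y) N) :
    ∃ (d : ℕ) (b : Fin d → N) (a : Fin d → N →ₗ[k] CatAlg k E),
      (∀ j, IsEquivariant (autHom k y) (a j)) ∧ ∀ m, ∑ j, a j m • b j = m := by
  obtain ⟨θ, hθ⟩ := hrel
  let b := Module.finBasis k N
  refine ⟨_, b, fun j => average (autHom k y) ((b.coord j ∘ₗ θ).smulRight (idem k y)),
    fun j => isEquivariant_average _ _, fun m => ?_⟩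
  -- The coordinates come from expanding each θ(g⁻¹m) in m = ∑ gθ(g⁻¹m) in a k-basis: the
  -- coefficient of b_j is ∑ b_j^*(θ(g⁻¹m)) g.
  have h1 (j) : average (autHom k y) ((b.coord j ∘ₗ θ).smulRight (idem k y)) m • b j =
      ∑ g : Aut y, b.coord j (θ (autHom k y g⁻¹ • m)) • autHom k y g • b j := by
    rw [average_apply, Finset.sum_smul]
    refine Finset.sum_congr rfl fun g _ => ?_
    rw [LinearMap.smulRight_apply, smul_comm, smul_assoc, smul_eq_mul, ← autHom_one, ← map_mul,
      mul_one]
    rfl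
  simp only [h1]
  rw [Finset.sum_comm]
  conv_rhs => rw [← hN m, ← autHom_one, ← hθ, average_apply]
  refine Finset.sum_congr rfl fun g _ => ?_
  conv_rhs => rw [← b.sum_repr (θ (autHom k y g⁻¹ • m)), Finset.smul_sum]
  exact Finset.sum_congr rfl fun j _ => (smul_comm _ _ _).symm

namespace IsFiniteFreeEI

variable (hE : IsFiniteFreeEI E)
include hE

theorem idem_obj_smul_standard (l : StratIndex k E) (m : l.standard) :
    idem k l.obj • m = m := by
  conv_rhs => rw [← one_smul (CatAlg k E) m, ← sum_idem, Finset.sum_smul]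
  exact (Finset.sum_eq_single l.obj (fun z _ hz => hE.idem_smul_standard l hz.symm m)
    fun h => absurd (Finset.mem_univ _) h).symm

theorem nontrivial_standard (l : StratIndex k E) : Nontrivial l.standard := by
  refine ⟨⟨l.traceSum.mkQ ⟨l.e, l.e_mem_proj⟩, 0, fun h => l.primitive.ne_zero ?_⟩⟩
  have h1 := (hE.mem_traceSum_iff l _).1 ((Submodule.Quotient.mk_eq_zero _).1 h)
  have h2 := hE.idem_mul_mul_idem_eq_zero (x := l.obj) (y := l.obj) ⟨𝟙 _⟩ h1
  rwa [l.idem_mul, l.mul_idem] at h2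

/-- An endomorphism is determined by the image c of the generator, with c in eAe. Since J vanishes
between 1_x and 1_x, idempotency of p lifts to c² = c exactly, and primitivity of e applies to c and
e − c. -/
theorem end_standard_eq_zero_or_one (l : StratIndex k E) (p : Module.End (CatAlg k E) l.standard)
    (hp : IsIdempotentElem p) : p = 0 ∨ p = 1 := by
  let E₀ : l.standard := l.traceSum.mkQ ⟨l.e, l.e_mem_proj⟩
  have hgen (f : l.proj) : l.traceSum.mkQ f = f.1 • E₀ := by
    rw [← map_smul]
    exact congrArg _ (Subtype.ext (l.mul_e f.2).symm)
  have hext (q : Module.End (CatAlg k E) l.standard) (h : p E₀ = q E₀) : p = q := by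
    refine LinearMap.ext fun m => ?_
    obtain ⟨f, rfl⟩ := l.traceSum.mkQ_surjective m
    rw [hgen, map_smul, map_smul, h]
  obtain ⟨f, hf⟩ := l.traceSum.mkQ_surjective (p E₀)
  have heE : l.e • E₀ = E₀ := (hgen ⟨l.e, l.e_mem_proj⟩).symm
  let c := l.e * f.1
  have hce : c * l.e = c := by rw [mul_assoc, l.mul_e f.2]
  have hec : l.e * c = c := by rw [← mul_assoc, l.primitive.idem.eq]
  have hcmem : c ∈ l.proj := hce ▸ l.mul_e_mem_proj c
  have hpc : p E₀ = c • E₀ := by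
    conv_lhs => rw [← heE]
    rw [map_smul, ← hf, hgen, smul_smul]
  have hcc : IsIdempotentElem c := by
    have h1 : p (p E₀) = p E₀ := LinearMap.congr_fun hp E₀
    rw [hpc, map_smul, hpc, smul_smul, ← sub_eq_zero, ← sub_smul] at h1
    have hmem : c * c - c ∈ l.proj := sub_mem (Submodule.smul_mem _ c hcmem) hcmem
    rw [← hgen ⟨_, hmem⟩] at h1
    have h2 := (hE.mem_traceSum_iff l _).1 ((Submodule.Quotient.mk_eq_zero _).1 h1)
    have h3 := hE.idem_mul_mul_idem_eq_zero (x := l.obj) (y := l.obj) ⟨𝟙 _⟩ h2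
    rw [mul_assoc, l.mul_idem_of_mem hmem] at h3
    have h4 : idem k l.obj * c = c := by rw [← mul_assoc, l.idem_mul]
    rw [mul_sub, ← mul_assoc, h4, sub_eq_zero] at h3
    exact h3
  have hc' : IsIdempotentElem (l.e - c) := by
    rw [IsIdempotentElem, mul_sub, sub_mul, sub_mul, l.primitive.idem.eq, hce, hec, hcc.eq]
    abel
  rcases l.primitive.indecomposable c (l.e - c) hcc hc' (by rw [mul_sub, hce, hcc.eq, sub_self])
    (by rw [sub_mul, hec, hcc.eq, sub_self]) (by abel) with h | h
  · exact Or.inl (hext _ (by rw [hpc, h, zero_smul]; rfl))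
  · rw [sub_eq_zero] at h
    exact Or.inr (hext _ (by rw [hpc, ← h, heE]; rfl))

theorem exists_map_to_standard {y : E} {N : Type*} [AddCommGroup N]
    [Module k N] [Module (CatAlg k E) N] [IsScalarTower k (CatAlg k E) N]
    (hN : ∀ m : N, idem k y • m = m) {l : StratIndex k E} (hl : l.obj = y)
    (a : N →ₗ[k] CatAlg k E) (ha : IsEquivariant (autHom k y) a) :
    ∃ f : N →ₗ[CatAlg k E] l.standard,
      ∀ m, f m = l.traceSum.mkQ ⟨a m * l.e, l.mul_e_mem_proj _⟩ := by
  let f₀ : N →ₗ[k] l.proj :=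
    { toFun := fun m => ⟨a m * l.e, l.mul_e_mem_proj _⟩
      map_add' := fun m m' => Subtype.ext (by
        change a (m + m') * _ = a m * _ + a m' * _
        rw [map_add, add_mul])
      map_smul' := fun r m => Subtype.ext (by
        change a (r • m) * _ = r • (a m * _)
        rw [map_smul, CatAlg.smul_mul]) }
  have hf₀ : IsEquivariant (autHom k y) f₀ := fun g m => Subtype.ext (by
    change a (autHom k y g • m) * l.e = autHom k y g * (a m * l.e)
    rw [ha, smul_eq_mul, mul_assoc])
  let f₁ : N →ₗ[k] l.standard := l.traceSum.mkQ.restrictScalars k ∘ₗ f₀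
  have hf₁ : IsEquivariant (autHom k y) f₁ := fun g m =>
    (congrArg l.traceSum.mkQ (hf₀ g m)).trans (l.traceSum.mkQ.map_smul _ _)
  have hΔ (m : l.standard) : idem k y • m = m := by
    have := hE.idem_obj_smul_standard l m
    rwa [hl] at this
  exact ⟨{ toFun := f₁
           map_add' := map_add _
           map_smul' := smul_eq_of_isEquivariant hE hN hΔ f₁ hf₁ }, fun m => rfl⟩

/-- J annihilates a module concentrated at one object, so f ↦ fn kills the trace submodule. -/
theorem exists_map_from_standard {y : E} {N : Type*} [AddCommGroup N] [Module (CatAlg k E) N]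
    (hN : ∀ m : N, idem k y • m = m) (l : StratIndex k E) (n : N) :
    ∃ g : l.standard →ₗ[CatAlg k E] N, ∀ f : l.proj, g (l.traceSum.mkQ f) = f.1 • n := by
  have hkill (r : CatAlg k E) (hr : r ∈ positivePart (lengthGrading k E)) : r • n = 0 := by
    rw [← hN (r • n)]
    conv_lhs => rw [← hN n]
    rw [smul_smul, smul_smul, hE.idem_mul_mul_idem_eq_zero ⟨𝟙 y⟩ hr, zero_smul]
  exact ⟨l.traceSum.liftQ (LinearMap.toSpanSingleton (CatAlg k E) N n ∘ₗ l.proj.subtype)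
    fun r hr => hkill r.1 ((hE.mem_traceSum_iff _ r).1 hr), fun f => rfl⟩

variable [∀ x y : E, Finite (x ⟶ y)]

theorem end_standard_injective_or_isNilpotent (l : StratIndex k E)
    (φ : Module.End (CatAlg k E) l.standard) : Function.Injective φ ∨ IsNilpotent φ := by
  have : Module.Finite k l.proj :=
    inferInstanceAs (Module.Finite k (l.proj.restrictScalars k))
  have : Module.Finite k l.standard :=
    Module.Finite.of_surjective (l.traceSum.mkQ.restrictScalars k) l.traceSum.mkQ_surjective
  have : IsNoetherian (CatAlg k E) l.standard := isNoetherian_of_tower k inferInstance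
  have : IsArtinian (CatAlg k E) l.standard := isArtinian_of_tower k inferInstance
  exact injective_or_isNilpotent (hE.end_standard_eq_zero_or_one l) φ

/-- A nonzero relatively projective module supported on `y` contains a standard module. -/
theorem exists_standard_injective {y : E} {N : Type*} [AddCommGroup N] [Module k N]
    [Module (CatAlg k E) N] [IsScalarTower k (CatAlg k E) N] [Module.Finite k N] [Nontrivial N]
    (hN : ∀ m : N, idem k y • m = m) (hrel : IsRelProj k (autHom k y) N) :
    ∃ l : StratIndex k E, l.obj = y ∧ ∃ i : l.standard →ₗ[CatAlg k E] N, Function.Injective i := by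
  obtain ⟨n, μ, hμ, hs⟩ := hE.exists_stratIndex_sum k y
  obtain ⟨d, b, a, ha, hab⟩ := exists_coordinates hN hrel
  have hfg (t : Fin d × Fin n) : ∃ (f : N →ₗ[CatAlg k E] (μ t.2).standard)
      (g : (μ t.2).standard →ₗ[CatAlg k E] N), ∀ m, g (f m) = (a t.1 m * (μ t.2).e) • b t.1 := by
    obtain ⟨f, hf⟩ := hE.exists_map_to_standard hN (hμ t.2) (a t.1) (ha t.1)
    obtain ⟨g, hg⟩ := hE.exists_map_from_standard hN (μ t.2) (b t.1)
    exact ⟨f, g, fun m => by rw [hf, hg]⟩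
  choose f g hfg using hfg
  -- The equivariant coordinates together with 1_y = ∑ e_i factor the identity of N through standard
  -- modules.
  have hgf (m : N) : ∑ t, g t (f t m) = m := by
    rw [Finset.sum_congr rfl fun t _ => hfg t m, Fintype.sum_prod_type]
    conv_rhs => rw [← hab m]
    refine Finset.sum_congr rfl fun j _ => ?_
    dsimp only
    rw [← Finset.sum_smul, ← Finset.mul_sum, hs, ← smul_smul, hN]
  obtain ⟨t, i, hi⟩ := exists_injective_of_sum_eq_one
    (fun t : Fin d × Fin n => hE.end_standard_injective_or_isNilpotent (μ t.2)) f g hgf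
  exact ⟨μ t.2, hμ _, i, hi⟩

/-- A finite-dimensional module whose components are relatively projective has a filtration by
standard modules supported on its support. -/
theorem hasDeltaFiltration_of_isRelProj (S : Set E) (M : Type*) [AddCommGroup M] [Module k M]
    [Module (CatAlg k E) M] [IsScalarTower k (CatAlg k E) M] [Module.Finite k M]
    (hS : ∀ z ∉ S, ∀ m : M, idem k z • m = 0)
    (hrel : ∀ y : E, IsRelProj k (autHom k y) M) :
    HasDeltaFiltration {μ : StratIndex k E | μ.obj ∈ S} M := by
  induction hn : Module.finrank k M using Nat.strong_induction_on generalizing M with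
  | _ n ih =>
    rcases subsingleton_or_nontrivial M with hM | hM
    · exact ⟨0, fun _ => ⊥, rfl, Subsingleton.elim _ _, fun i hi => absurd hi (Nat.not_lt_zero i)⟩
    let T : Set E := {z | ∃ m : M, idem k z • m ≠ 0}
    have hT : T.Nonempty := by
      by_contra hT
      obtain ⟨m, hm⟩ := exists_ne (0 : M)
      refine hm ?_
      rw [← one_smul (CatAlg k E) m, ← sum_idem, Finset.sum_smul]
      refine Finset.sum_eq_zero fun z _ => ?_
      by_contra hz
      exact hT ⟨z, m, hz⟩
    -- An object with the most predecessors is maximal in the support of M. Morphisms leaving y for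
    -- other objects then act by zero, so 1_y M is a submodule. It contains some Δ_l, and M/Δ_l is
    -- again relatively projective at every object, of smaller dimension.
    obtain ⟨y, ⟨m₀, hm₀⟩, hy⟩ := Set.exists_max_image T
      (fun z => Set.ncard {t : E | Nonempty (t ⟶ z)}) (Set.toFinite _) hT
    have hmax (z : E) (hz : z ≠ y) (f : y ⟶ z) (m : M) : idem k z • m = 0 := by
      by_contra hm
      refine (hy z ⟨m, hm⟩).not_gt (Set.ncard_lt_ncard ⟨fun t ht => ht.map (· ≫ f), fun hs => ?_⟩
        (Set.toFinite _))
      obtain ⟨g⟩ := hs (show z ∈ {t : E | Nonempty (t ⟶ z)} from ⟨𝟙 z⟩)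
      exact hz (hE.eq_of_hom g f)
    let N : Submodule (CatAlg k E) M :=
      { carrier := {m | idem k y • m = m}
        add_mem' := fun {a b} ha hb => by
          change idem k y • (a + b) = a + b
          rw [smul_add, show idem k y • a = a from ha, show idem k y • b = b from hb]
        zero_mem' := smul_zero _
        smul_mem' := fun c m hm => by
          change idem k y • c • m = c • m
          have hm : idem k y • m = m := hm
          conv_rhs => rw [← one_smul (CatAlg k E) (c • m), ← sum_idem, Finset.sum_smul]
          refine Eq.symm (Finset.sum_eq_single y (fun z _ hz => ?_)
            fun h => absurd (Finset.mem_univ _) h)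
          by_cases h : IsEmpty (y ⟶ z)
          · rw [← hm, smul_smul, smul_smul,
              idem_mul_mul_idem_eq_zero_of_isEmpty h, zero_smul]
          · exact hmax z hz (not_isEmpty_iff.1 h).some _ }
    have hNy (m : N) : idem k y • m = m := Subtype.ext m.2
    have hmem (m : M) : idem k y • m ∈ N := by
      change idem k y • idem k y • m = idem k y • m
      rw [smul_smul, idem_mul_idem]
    have hNnt : Nontrivial N :=
      ⟨⟨⟨_, hmem m₀⟩, 0, fun h => hm₀ (congrArg Subtype.val h)⟩⟩
    have : Module.Finite k N := inferInstanceAs (Module.Finite k (N.restrictScalars k))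
    let r : M →ₗ[k] N :=
      { toFun := fun m => ⟨idem k y • m, hmem m⟩
        map_add' := fun a b => Subtype.ext (smul_add _ _ _)
        map_smul' := fun c a => Subtype.ext (smul_comm _ _ _) }
    have hr : IsEquivariant (autHom k y) r := fun g m => Subtype.ext (by
      change idem k y • autHom k y g • m = autHom k y g • idem k y • m
      rw [smul_smul, smul_smul, ← autHom_one, ← map_mul, ← map_mul, one_mul, mul_one])
    have hNrel : IsRelProj k (autHom k y) N := (hrel y).of_equivariant_retract
      (isEquivariant_restrictScalars _ N.subtype) hr fun m => rfl
    obtain ⟨l, hl, i, hi⟩ := hE.exists_standard_injective hNy hNrel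
    let j : l.standard →ₗ[CatAlg k E] M := N.subtype ∘ₗ i
    have hj : Function.Injective j := N.subtype_injective.comp hi
    have hD : LinearMap.range j ≠ ⊥ := by
      have := hE.nontrivial_standard l
      obtain ⟨x, hx⟩ := exists_ne (0 : l.standard)
      intro h
      have h1 : j x ∈ LinearMap.range j := ⟨x, rfl⟩
      rw [h, Submodule.mem_bot] at h1
      exact hx (hj (by rw [h1, map_zero]))
    have hlS : l.obj ∈ S := by
      by_contra h
      rw [hl] at h
      exact hm₀ (hS y h m₀)
    have hfin : Module.Finite k (M ⧸ LinearMap.range j) :=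
      Module.Finite.of_surjective ((LinearMap.range j).mkQ.restrictScalars k)
        (LinearMap.range j).mkQ_surjective
    have hlt : Module.finrank k (M ⧸ LinearMap.range j) < n := by
      rw [← hn]
      have h1 := ((LinearMap.range j).restrictScalars k).finrank_quotient_add_finrank
      have h2 := (Submodule.Quotient.restrictScalarsEquiv k (LinearMap.range j)).finrank_eq
      have h3 : 0 < Module.finrank k ((LinearMap.range j).restrictScalars k) :=
        Submodule.one_le_finrank_iff.2 fun h => hD ((Submodule.restrictScalars_eq_bot_iff _ _ _).1 h)
      omega
    refine HasDeltaFiltration.of_quotient (μ := l) hlS (LinearEquiv.ofInjective j hj).symm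
      (ih _ hlt (M ⧸ LinearMap.range j) (fun z hz m => ?_) (fun z => ?_) rfl)
    · obtain ⟨m, rfl⟩ := (LinearMap.range j).mkQ_surjective m
      rw [← map_smul, hS z hz, map_zero]
    · exact (hE.isRelProj_standard l z).of_exact_right (hrel z) hj
        (LinearMap.range j).mkQ_surjective (LinearMap.exact_map_mkQ_range j)

/-- The kernel of P_l → Δ_l lies in J, so its support consists of objects strictly above that of l;
this gives the condition l ≺ μ on the factors. -/
theorem isStandardlyStratified (hw : ∀ (x y : E) (β : x ⟶ y), IsWeighted k β) :
    IsStandardlyStratified k E := by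
  intro l
  have : Module.Finite k l.proj :=
    inferInstanceAs (Module.Finite k (l.proj.restrictScalars k))
  have : Module.Finite k l.traceSum :=
    inferInstanceAs (Module.Finite k (l.traceSum.restrictScalars k))
  refine hE.hasDeltaFiltration_of_isRelProj
    {z | Nonempty (l.obj ⟶ z) ∧ ¬ Nonempty (z ⟶ l.obj)} l.traceSum (fun z hz f => ?_)
    (hE.isRelProj_traceSum hw l)
  refine Subtype.ext (Subtype.ext ?_)
  change idem k z * f.1.1 = 0
  rw [← l.mul_idem_of_mem f.1.2, ← mul_assoc]
  by_cases h : Nonempty (z ⟶ l.obj)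
  · exact hE.idem_mul_mul_idem_eq_zero h ((hE.mem_traceSum_iff l _).1 f.2)
  · exact idem_mul_mul_idem_eq_zero_of_isEmpty
      (not_nonempty_iff.1 fun h' => hz ⟨h', h⟩) _

end IsFiniteFreeEI

end Filtration

end FreeEI

end

/-! ### The equivalence. -/

theorem theorem6p8 (k : Type w) [Field k] [IsAlgClosed k] (E : Type u)
    [CategoryTheory.Category.{v} E] [Fintype E] (hE : FreeEI.IsFiniteFreeEI E) :
    List.TFAE [
      CategoryTheory.projectiveDimension (ModuleCat.of (FreeEI.CatAlg k E)
        (FreeEI.DegreeZero (FreeEI.lengthGrading k E))) ≤ 1,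
      FreeEI.IsKoszulAlgebra (FreeEI.lengthGrading k E),
      FreeEI.IsStandardlyStratified k E,
      CategoryTheory.projectiveDimension (ModuleCat.of (FreeEI.CatAlg k E)
        (FreeEI.DegreeZero (FreeEI.lengthGrading k E))) < ⊤] := by
  have := hE.finite_hom
  -- Each of the four conditions is compared separately with the weight condition on unfactorizable
  -- morphisms.
  refine List.tfae_of_forall
    (∀ (x y : E) (β : x ⟶ y), FreeEI.Unfactorizable β → FreeEI.IsWeighted k β) _ ?_
  have pd_le_one (hw : ∀ (x y : E) (β : x ⟶ y), FreeEI.Unfactorizable β → FreeEI.IsWeighted k β) :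
      projectiveDimension (ModuleCat.of (FreeEI.CatAlg k E)
        (FreeEI.DegreeZero (FreeEI.lengthGrading k E))) ≤ 1 := by
    have := hE.projective_positivePart hw
    exact FreeEI.projectiveDimension_quotient_le_one _
  have of_lt_top (h : projectiveDimension (ModuleCat.of (FreeEI.CatAlg k E)
        (FreeEI.DegreeZero (FreeEI.lengthGrading k E))) < ⊤) (x y : E) (β : x ⟶ y)
      (hβ : FreeEI.Unfactorizable β) : FreeEI.IsWeighted k β := by
    obtain ⟨n, hn⟩ := FreeEI.exists_hasProjectiveDimensionLT_of_quotient _ h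
    exact hE.isWeighted_of_hasProjectiveDimensionLT hn β hβ
  have lt_top : (1 : WithBot ℕ∞) < ⊤ := WithBot.coe_lt_coe.2 (ENat.natCast_lt_top 1)
  simp only [List.mem_cons, List.not_mem_nil, or_false, forall_eq_or_imp, forall_eq]
  refine ⟨⟨fun h => of_lt_top (h.trans_lt lt_top), pd_le_one⟩, ⟨fun h x y β hβ => ?_, fun hw => ?_⟩,
    ⟨fun h x y β hβ => hE.isWeighted_of_isStandardlyStratified h β hβ,
      fun hw => hE.isStandardlyStratified fun x y β => hE.isWeighted hw β⟩,
    ⟨of_lt_top, fun hw => (pd_le_one hw).trans_lt lt_top⟩⟩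
  · obtain ⟨R⟩ := h.koszul.resolution
    exact hE.isWeighted_of_linearResolution R β hβ
  · exact hE.isKoszulAlgebra (hE.projective_positivePart hw)
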